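/- **Theorem 1.** For a metric space $(X,d)$ let $(x,y)_w=\frac12\big(d(w,x)+d(w,y)-d(x,y)\big)$, and call $(X,d)$ $\delta$-hyperbolic if $(x,y)_w\ge\min\{(x,z)_w,(y,z)_w\}-\delta$ for all $w,x,y,z\in X$. The algorithm *TreeRep* takes the table of distances of $n\ge1$ distinct points, in an arbitrary order (one or two points give the one-node tree or a single weighted edge). Starting from the first three points, with the other points as list $L$, it runs the following *recursive step* on nodes $x,y,z$ and a list $L$ of points not yet placed (all distances among them being stored). 1. Compute the weights $(y,z)_x,(x,z)_y,(x,y)_z$ of the universal tree, in which a node $r$ is joined to $x,y,z$ respectively. 2. *Zone sorting.* For each $w\in L$ let $a=(x,y)_w$, $b=(y,z)_w$, $c=(z,x)_w$. If $a=b=c$, put $w$ into $Z_1(r)$. Otherwise let $m$ be the first of $a,b,c$ that is maximal, and let $v=z$, $x$, $y$ according to whether $m$ is $a$, $b$, $c$; put $w$ into $Z_1(v)$ if $d(w,v)$ equals one of the two other products, and into $Z_2(v)$ if not. 3. If one of the three weights is $0$, then $r$ is contracted onto the first of $x,y,z$ whose weight is $0$. Otherwise, if $a=b=c=0$ for some $w\in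 L$, the first such $w$ takes the place of $r$ and leaves the list. Otherwise $r$ is a new (Steiner) node, the three weights are stored as its distances to $x,y,z$, and $d(w,r)=\max\{a,b,c\}$ is stored for $w\in L$. Add the edges $xr,yr,zr$ with the three weights (omitting an edge from a node to itself). 4. For $(Z,v)=(Z_1(r),r),(Z_1(x),x),(Z_1(y),y),(Z_1(z),z)$: if $Z$ is a single point $u$, add the edge $uv$ of weight $d(u,v)$; if $Z$ has at least two points, remove its first two points $u,u'$ and run the recursive step on $v,u,u'$ and the rest of $Z$. Then for $v=x,y,z$: if $Z_2(v)\neq\emptyset$, remove from it the point $u$ closest to $r$, delete the edge $vr$, and run the recursive step on $r,v,u$ and the rest of $Z_2(v)$. At the end negative edge weights are replaced by $0$. Memory accesses, comparisons, list operations and arithmetic operations on real numbers cost one step each. On $K$ threads, every loop over a list of points (in particular zone sorting), and every pass over the tables, is divided into $K$ blocks of consecutive items that are processed independently; its time is the time of the slowest thread plus $1+\lceil\log_2K\rceil$ steps for starting and joining the threads. There is an absolute constant $C$ such that for every $\delta\ge0$, every $\delta$-hyperbolic metric space $(X,d)$, all distinct points $x_1,\dots,x_n\in X$ with $n\ge 1$,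 and every order in which the algorithm takes them: * TreeRep returns a weighted tree $T$ with non-negative edge weights, whose nodes are the $n$ points and some Steiner nodes. Let $d_T$ be its shortest path metric. * If $\delta=0$, then $d_T(x_i,x_j)=d(x_i,x_j)$ for all $i,j$, and $T$ has the fewest possible nodes: every finite tree $T'$ with non-negative edge weights that has nodes $v_1,\dots,v_n$ with $d_{T'}(v_i,v_j)=d(x_i,x_j)$ for all $i,j$ has at least as many nodes as $T$. * The worst-case running time (on one thread) is at most $Cn^2$. * For every $K\ge1$, TreeRep on $K$ threads returns the same tree, in time at most $C\left(\frac{n^2}{K}+n\,(1+\lceil\log_2K\rceil)\right)$. -/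

import Mathlib

/-! ### Hyperbolic metrics -/

/-- The Gromov product `(x, y)_w = (d(w, x) + d(w, y) - d(x, y)) / 2`. -/
noncomputable def gromovProduct {X : Type*} [MetricSpace X] (x y w : X) : ℝ :=
  (dist w x + dist w y - dist x y) / 2

/-- `X` is `δ`-hyperbolic: `(x, y)_w ≥ min ((x, z)_w) ((y, z)_w) - δ` for all `w, x, y, z`. -/
def IsHyperbolic (X : Type*) [MetricSpace X] (δ : ℝ) : Prop :=
  ∀ w x y z : X,
    min (gromovProduct x z w) (gromovProduct y z w) - δ ≤ gromovProduct x y w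

/-! ### Weighted graphs and their shortest path metric -/

/-- A simple graph together with a weight for every edge (only the values of `weight` on edges
of `graph` matter). -/
structure WeightedGraph (V : Type*) where
  graph : SimpleGraph V
  weight : Sym2 V → ℝ

namespace WeightedGraph

variable {V : Type*}

/-- A weighted tree: the graph is a tree and its edges have non-negative weights. -/
def IsWeightedTree (T : WeightedGraph V) : Prop :=
  T.graph.IsTree ∧ ∀ e ∈ T.graph.edgeSet, 0 ≤ T.weight e

/-- The length of a walk: the sum of the weights of its edges. -/
def walkLength (T : WeightedGraph V) {u v : V} (p : T.graph.Walk u v) : ℝ :=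
  (p.edges.map T.weight).sum

/-- The shortest path metric: the infimum of the lengths of the walks from `u` to `v`. -/
noncomputable def pathDist (T : WeightedGraph V) (u v : V) : ℝ :=
  ⨅ p : T.graph.Walk u v, T.walkLength p

end WeightedGraph

/-! ### Programs with a running time

`Timed α` is a program that returns an `α` and whose number of elementary steps is recorded.
An elementary step is one access to a cell of the memory, one arithmetic operation on or one
comparison of real numbers, one comparison of labels, or one operation on the end of a list. -/

/-- A result together with the number of steps that were needed to compute it. -/
structure Timed (α : Type) where
  val : α
  time : ℕ

namespace Timed

/-- Steps add up when programs are run one after the other. -/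
instance : Monad Timed where
  pure a := ⟨a, 0⟩
  bind p f := ⟨(f p.val).val, p.time + (f p.val).time⟩

/-- Spend `k` steps. -/
def tick (k : ℕ) : Timed Unit := ⟨(), k⟩

/-- Run the body `f` on the items of a list one after the other and collect its outputs. -/
def loop {α β : Type} (f : α → Timed (Option β)) : List α → Timed (List β)
  | [] => pure []
  | a :: l => do
      let b ← f a
      tick 1
      let bs ← loop f l
      pure (b.toList ++ bs)

/-- The share of thread `t` among `K` threads: the `t`-th block of `⌈|L| / K⌉` consecutive items. -/
def block {α : Type} (K t : ℕ) (L : List α) : List α :=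
  (L.drop (t * (L.length ⌈/⌉ K))).take (L.length ⌈/⌉ K)

/-- Run `thread` independently on the `K` blocks of `L`, one block per thread. The time is that of
the slowest thread, and `1 + ⌈log₂ K⌉` further steps for starting the threads and for joining
them along a balanced binary tree. -/
def parallel {α β : Type} (K : ℕ) (thread : List α → Timed β) (L : List α) : Timed (List β) :=
  let outs := (List.range K).map fun t => thread (block K t L)
  ⟨outs.map Timed.val, (outs.map Timed.time).foldr max 0 + (1 + Nat.clog 2 K)⟩

/-- A loop whose iterations are distributed among `K` threads. -/
def parLoop {α β : Type} (K : ℕ) (f : α → Timed (Option β)) (L : List α) : Timed (List β) := do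
  let outs ← parallel K (loop f) L
  pure outs.flatten

end Timed

namespace TreeRep

open Timed

/-! ### The memory -/

/-- Potential nodes: the data points and the Steiner nodes `0, 1, 2, …`. -/
abbrev Node (n : ℕ) := Fin n ⊕ ℕ

/-- The memory: the table `dist` of the distances known so far, the table `edge` of the edges of the
tree built so far with their weights, and the number of Steiner nodes created so far, which are
`0, …, steiner - 1`. -/
structure Memory (n : ℕ) where
  dist : Node n → Node n → ℝ
  edge : Sym2 (Node n) → Option ℝ
  steiner : ℕ

variable {n : ℕ}

/-- Read a distance. -/
def read (M : Memory n) (p q : Node n) : Timed ℝ := ⟨M.dist p q, 1⟩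

/-- The memory after `v` is stored as the distance between `p` and `q`. -/
def Memory.setDist (M : Memory n) (p q : Node n) (v : ℝ) : Memory n :=
  { M with dist := fun p' q' => if (p' = p ∧ q' = q) ∨ (p' = q ∧ q' = p) then v else M.dist p' q' }

/-- Store a distance (two cells). -/
def write (M : Memory n) (p q : Node n) (v : ℝ) : Timed (Memory n) := ⟨M.setDist p q v, 2⟩

/-- Store the distances from `r` to the nodes of a list, by `K` threads. The cells are distinct for
distinct nodes of the list, so the order of the writes is immaterial. -/
def writeAll (K : ℕ) (M : Memory n) (r : Node n) (l : List (Node n × ℝ)) : Timed (Memory n) := do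
  let _ ← parLoop K (fun _ => do tick 2; pure (none : Option Unit)) l
  pure (l.foldl (fun M' c => M'.setDist c.1 r c.2) M)

/-- Add the edge `pq` with weight `v`. (For `p = q` this is a loop, which is discarded in the end.) -/
def addEdge (M : Memory n) (p q : Node n) (v : ℝ) : Timed (Memory n) :=
  ⟨{ M with edge := fun e => if e = s(p, q) then some v else M.edge e }, 1⟩

/-- Delete the edge `pq`. -/
def deleteEdge (M : Memory n) (p q : Node n) : Timed (Memory n) :=
  ⟨{ M with edge := fun e => if e = s(p, q) then none else M.edge e }, 1⟩

/-- Create a Steiner node. -/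
def newSteiner (M : Memory n) : Timed (Memory n × Node n) :=
  ⟨({ M with steiner := M.steiner + 1 }, Sum.inr M.steiner), 1⟩

/-- Compute the Gromov product `(p, q)_w` from the stored distances. -/
noncomputable def gromov (M : Memory n) (p q w : Node n) : Timed ℝ := do
  let dp ← read M w p
  let dq ← read M w q
  let dpq ← read M p q
  tick 3
  pure ((dp + dq - dpq) / 2)

/-! ### Sorting points into the seven zones of a universal tree -/

/-- The zones of the universal tree on `x, y, z` with Steiner node `r`: the zones of type one of
`r, x, y, z` and the zones of type two of `x, y, z`. -/
inductive Zone
  | r1 | x1 | y1 | z1 | x2 | y2 | z2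
  deriving DecidableEq

/-- The zone of `w`, and the distance from `w` to the Steiner node, which is the largest of the
three Gromov products based at `w`. -/
noncomputable def classify (M : Memory n) (x y z w : Node n) : Timed (Zone × ℝ) := do
  let a ← gromov M x y w
  let b ← gromov M y z w
  let c ← gromov M z x w
  tick 10
  if a = b ∧ b = c then pure (.r1, a)
  else if a = max a (max b c) then do
    let e ← read M w z
    pure (if e = b ∨ e = c then .z1 else .z2, a)
  else if b = max a (max b c) then do
    let e ← read M w x
    pure (if e = a ∨ e = c then .x1 else .x2, b)
  else do
    let e ← read M w y
    pure (if e = a ∨ e = b then .y1 else .y2, c)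

/-- A data point with its zone and its distance to the Steiner node. -/
abbrev Labelled (n : ℕ) := Node n × Zone × ℝ

/-- The zone-sorting step: classify all points of `L`, by `K` threads. -/
noncomputable def sortZones (K : ℕ) (M : Memory n) (x y z : Node n) (L : List (Node n)) :
    Timed (List (Labelled n)) :=
  parLoop K (fun w => do let c ← classify M x y z w; pure (some (w, c))) L

/-- The list of the points in a zone. -/
def zoneList (K : ℕ) (S : List (Labelled n)) (q : Zone) : Timed (List (Node n)) :=
  parLoop K (fun c => do tick 1; pure (if c.2.1 = q then some c.1 else none)) S

/-! ### Placing the Steiner node -/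

/-- Place the Steiner node `r` of the universal tree on `x, y, z` with edge weights
`a = (y, z)_x`, `b = (x, z)_y` and `c = (x, y)_z`, where `S` are the sorted points. If an edge
from `r` to one of `x, y, z` has weight zero, then it is contracted: `r` is that node. Otherwise,
if the three Gromov products based at a point `w` of `S` vanish, then `w` takes the place of `r` and
is removed from `S`. Otherwise a new Steiner node is created and its distances are stored.
Returns the memory, the node `r` and the points that remain to be placed. -/
noncomputable def placeSteiner (K : ℕ) (M : Memory n) (x y z : Node n) (a b c : ℝ)
    (S : List (Labelled n)) : Timed (Memory n × Node n × List (Labelled n)) := do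
  tick 3
  if a = 0 then pure (M, x, S)
  else if b = 0 then pure (M, y, S)
  else if c = 0 then pure (M, z, S)
  else do
    let zeros ← parLoop K (fun s => do
      tick 2
      pure (if s.2.1 = Zone.r1 ∧ s.2.2 = 0 then some s.1 else none)) S
    tick 1
    match zeros.head? with
    | some w => do
        let S' ← parLoop K (fun s => do
          tick 1
          pure (if s.1 = w then none else some s)) S
        pure (M, w, S')
    | none => do
        let (M, r) ← newSteiner M
        let M ← write M x r a
        let M ← write M y r b
        let M ← write M z r c
        let M ← writeAll K M r (S.map fun s => (s.1, s.2.2))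
        pure (M, r, S)

/-! ### The recursion -/

/-- Recursion on a zone of type one, with the points `L`, of the node `v`. The argument `step` is the
recursive step, with the universal tree on the last three of its arguments. -/
def zone1 (step : Memory n → List (Node n) → Node n → Node n → Node n → Timed (Memory n))
    (M : Memory n) (L : List (Node n)) (v : Node n) : Timed (Memory n) := do
  tick 2
  match L with
  | [] => pure M
  | [u] => do
      let d ← read M u v
      addEdge M u v d
  | u :: z :: L' => step M L' v u z

/-- The candidate with the smaller value; the first one in case of a tie. -/
noncomputable def closer : Option (Node n × ℝ) → Option (Node n × ℝ) → Option (Node n × ℝ)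
  | none, q => q
  | some p, none => some p
  | some p, some q => if q.2 < p.2 then some q else some p

/-- The point of a list that is closest to `v`, with its distance. -/
noncomputable def closestSeq (M : Memory n) (v : Node n) :
    List (Node n) → Timed (Option (Node n × ℝ))
  | [] => pure none
  | w :: l => do
      let d ← read M w v
      let best ← closestSeq M v l
      tick 2
      pure (closer (some (w, d)) best)

/-- The point of a list that is closest to `v`, by `K` threads; the candidates of the threads are
compared as the threads are joined. -/
noncomputable def closest (K : ℕ) (M : Memory n) (v : Node n) (L : List (Node n)) :
    Timed (Option (Node n × ℝ)) := do
  let outs ← parallel K (closestSeq M v) L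
  pure (outs.foldr closer none)

/-- Recursion on a zone of type two, with the points `L`, of the edge between `u` and the Steiner
node `v`. -/
noncomputable def zone2 (K : ℕ)
    (step : Memory n → List (Node n) → Node n → Node n → Node n → Timed (Memory n))
    (M : Memory n) (L : List (Node n)) (u v : Node n) : Timed (Memory n) := do
  tick 1
  if L = [] then pure M
  else do
    let best ← closest K M v L
    match best with
    | none => pure M
    | some (z, _) => do
        let M ← deleteEdge M u v
        let L' ← parLoop K (fun w => do tick 1; pure (if w = z then none else some w)) L
        step M L' v u z

/-- The recursive step: build the universal tree on `x, y, z`, sort the points of `L` into its seven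
zones, and recurse on each zone. The second argument bounds the depth of the recursion; each
recursive call has a shorter list, so any number greater than the length of `L` is large enough. -/
noncomputable def recursiveStep (K : ℕ) :
    ℕ → Memory n → List (Node n) → Node n → Node n → Node n → Timed (Memory n)
  | 0, M, _, _, _, _ => pure M
  | fuel + 1, M, L, x, y, z => do
      let a ← gromov M y z x
      let b ← gromov M x z y
      let c ← gromov M x y z
      let S ← sortZones K M x y z L
      let (M, r, S) ← placeSteiner K M x y z a b c S
      let M ← addEdge M x r a
      let M ← addEdge M y r b
      let M ← addEdge M z r c
      let Lr1 ← zoneList K S .r1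
      let Lx1 ← zoneList K S .x1
      let Ly1 ← zoneList K S .y1
      let Lz1 ← zoneList K S .z1
      let Lx2 ← zoneList K S .x2
      let Ly2 ← zoneList K S .y2
      let Lz2 ← zoneList K S .z2
      let M ← zone1 (recursiveStep K fuel) M Lr1 r
      let M ← zone1 (recursiveStep K fuel) M Lx1 x
      let M ← zone1 (recursiveStep K fuel) M Ly1 y
      let M ← zone1 (recursiveStep K fuel) M Lz1 z
      let M ← zone2 K (recursiveStep K fuel) M Lx2 x r
      let M ← zone2 K (recursiveStep K fuel) M Ly2 y r
      zone2 K (recursiveStep K fuel) M Lz2 z r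

/-! ### The algorithm -/

/-- Pass over the `2n` rows of the two tables, of `2n` entries each, spending `k` steps per pair of
entries, by `K` threads. (There are `n` data points, and fewer than `n` Steiner nodes are created.) -/
def tablePass (K n k : ℕ) : Timed Unit := do
  let _ ← parLoop K (fun _ => do tick (k * (2 * n)); pure (none : Option Unit)) (List.range (2 * n))
  pure ()

/-- The initial memory: the distances of the data points, and no edges. -/
def initial (d : Fin n → Fin n → ℝ) : Memory n where
  dist
    | .inl i, .inl j => d i j
    | _, _ => 0
  edge _ := none
  steiner := 0

/-- Build the tree for the points in the list, which are taken from its front. -/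
noncomputable def build (K : ℕ) (M : Memory n) : List (Node n) → Timed (Memory n)
  | [] => pure M
  | [_] => pure M
  | [x, y] => do
      let d ← read M x y
      addEdge M x y d
  | x :: y :: z :: L => recursiveStep K n M L x y z

/-- The weighted graph in the memory, on the data points and the Steiner nodes created. -/
noncomputable def Memory.toGraph (M : Memory n) : WeightedGraph (Fin n ⊕ Fin M.steiner) where
  graph := SimpleGraph.fromEdgeSet {e | (M.edge (e.map (Sum.map id Fin.val))).isSome}
  weight e := (M.edge (e.map (Sum.map id Fin.val))).getD 0

/-- The output: a number `steiner` of Steiner nodes, and a weighted graph on the data points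
and the Steiner nodes. -/
structure Output (n : ℕ) where
  steiner : ℕ
  tree : WeightedGraph (Fin n ⊕ Fin steiner)

/-- TreeRep on `K` threads, for the table `d` of the distances of `n` points. The points are picked
in the order given by the list `order`, whose first three entries are the three data points that the
algorithm starts from. In the end, negative edge weights are replaced by zero. -/
noncomputable def treeRep (K : ℕ) (d : Fin n → Fin n → ℝ) (order : List (Fin n)) :
    Timed (Output n) := do
  tablePass K n 2
  let M ← build K (initial d) (order.map Sum.inl)
  tablePass K n 2
  let M := { M with edge := fun e => (M.edge e).map (max 0) }
  pure ⟨M.steiner, M.toGraph⟩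

/-- TreeRep on `K` threads, for the points `p 0, …, p (n - 1)` of a metric space. -/
noncomputable def onPoints {X : Type*} [MetricSpace X] (K : ℕ) (p : Fin n → X)
    (order : List (Fin n)) : Timed (Output n) :=
  treeRep K (fun i j => dist (p i) (p j)) order

end TreeRep

/-! Four arguments carry the theorem.

Threads. Blocks of consecutive items concatenate to the whole list, so a parallel loop computes what
the sequential loop computes (`val_parLoop`). The search for a closest point folds an associative
operation (`closer_assoc`). So the result does not depend on `K`, and the function `stepVal`
describes it.

Tree, for every table with zero diagonal. The step on `x, y, z, L` connects these nodes and all new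
Steiner nodes, and it adds at most one non-loop edge fewer than the number of distinct nodes among
`x, y, z, L`, plus one per new Steiner node (`stepVal_grows`). On all `n` points this leaves a
connected graph with at most `n - 1 + steiner` edges on `n + steiner` nodes, hence a tree. No
geometry enters.

Exactness and minimality. Let the `n` points have positions in a space `Y` with a tree metric `D`: a
pseudometric with the four point condition and medians. Every node then gets a position, a new
Steiner node that of the median of `x, y, z`. All edge weights are distances of positions, positive
off loops, and the zones are separated from each other by `r` or by their apex, so distances between
zones add up along these cut points (`Zoned.le_of_zones`). The upper bound on the path metric is
stated by duality: every pseudometric that is at most the weight on each edge is at most `D` on all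
nodes (`Builds.below`). This survives adding and deleting edges. With the triangle inequality along
walks, `d_T` equals `D` of the positions (`pathDist_output`). The run depends on the distances only,
so `Y` can be chosen afterwards. A zero-hyperbolic space embeds in the union of the segments from a
base point (`IsHyperbolic.exists_isTreeMetric`), which gives exactness. For minimality `Y` is the
node set of a competing tree `T'`: edge weights of `T` are positive, so distinct nodes of `T` have
distinct positions in `T'` (`position_injective`).

Time. Without recursion a step costs a bounded multiple of `n / K + 1 + log K`. The zones partition
the remaining points, and a recursive call on a zone uses up at least one of its points, so there
are at most linearly many calls (`time_recursiveStep_le`). -/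

/-! ### The value of a program does not depend on the number of threads -/

namespace Timed

@[simp] theorem val_bind {α β : Type} (p : Timed α) (f : α → Timed β) :
    (p >>= f).val = (f p.val).val := rfl

@[simp] theorem time_bind {α β : Type} (p : Timed α) (f : α → Timed β) :
    (p >>= f).time = p.time + (f p.val).time := rfl

@[simp] theorem val_pure {α : Type} (a : α) : (pure a : Timed α).val = a := rfl

@[simp] theorem time_pure {α : Type} (a : α) : (pure a : Timed α).time = 0 := rfl

@[simp] theorem time_tick (k : ℕ) : (tick k).time = k := rfl

theorem val_loop {α β : Type} (f : α → Timed (Option β)) (L : List α) :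
    (loop f L).val = L.filterMap fun a => (f a).val := by
  induction L with
  | nil => rfl
  | cons a l ih =>
    rw [loop, List.filterMap_cons]
    simp only [val_bind, val_pure, ih]
    cases (f a).val <;> simp

theorem flatMap_range_take_drop {α : Type} (c : ℕ) (L : List α) (K : ℕ) :
    ((List.range K).flatMap fun t => (L.drop (t * c)).take c) = L.take (K * c) := by
  induction K with
  | zero => simp
  | succ K ih =>
    rw [List.range_succ, List.flatMap_append, ih, Nat.succ_mul, List.take_add]
    simp

theorem length_le_mul_ceilDiv {α : Type} {K : ℕ} (hK : 1 ≤ K) (L : List α) :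
    L.length ≤ K * (L.length ⌈/⌉ K) := by
  have := le_smul_ceilDiv (a := K) (b := L.length) hK
  simpa using this

theorem flatMap_range_block {α : Type} {K : ℕ} (hK : 1 ≤ K) (L : List α) :
    ((List.range K).flatMap fun t => block K t L) = L := by
  unfold block
  rw [flatMap_range_take_drop, List.take_of_length_le (length_le_mul_ceilDiv hK L)]

/-- `filterMap` commutes with concatenation, and the `K` blocks concatenate to `L`, since `K * ⌈|L|
/ K⌉ ≥ |L|`. -/
theorem val_parLoop {α β : Type} {K : ℕ} (hK : 1 ≤ K) (f : α → Timed (Option β)) (L : List α) :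
    (parLoop K f L).val = L.filterMap fun a => (f a).val := by
  conv_rhs => rw [← flatMap_range_block hK L]
  simp only [parLoop, parallel, val_bind, val_pure, List.map_map, List.flatMap, List.filterMap_flatten]
  congr 2
  funext t
  simp [val_loop]

end Timed

/-! ### Values of the subroutines -/

namespace TreeRep

open Timed

variable {n : ℕ}

/-- The Gromov product of the stored distances. -/
noncomputable def product (M : Memory n) (p q w : Node n) : ℝ :=
  (M.dist w p + M.dist w q - M.dist p q) / 2

@[simp] theorem val_gromov (M : Memory n) (p q w : Node n) :
    (gromov M p q w).val = product M p q w := rfl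

/-- The memory after an edge is added. -/
def Memory.insertEdge (M : Memory n) (p q : Node n) (v : ℝ) : Memory n :=
  { M with edge := fun e => if e = s(p, q) then some v else M.edge e }

/-- The memory after an edge is deleted. -/
def Memory.eraseEdge (M : Memory n) (p q : Node n) : Memory n :=
  { M with edge := fun e => if e = s(p, q) then none else M.edge e }

@[simp] theorem val_addEdge (M : Memory n) (p q : Node n) (v : ℝ) :
    (addEdge M p q v).val = M.insertEdge p q v := rfl

@[simp] theorem val_deleteEdge (M : Memory n) (p q : Node n) :
    (deleteEdge M p q).val = M.eraseEdge p q := rfl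

/-- The points with their labels. -/
noncomputable def sorted (M : Memory n) (x y z : Node n) (L : List (Node n)) :
    List (Labelled n) :=
  L.map fun w => (w, (classify M x y z w).val)

theorem val_sortZones {K : ℕ} (hK : 1 ≤ K) (M : Memory n) (x y z : Node n) (L : List (Node n)) :
    (sortZones K M x y z L).val = sorted M x y z L := by
  simp [sortZones, val_parLoop hK, sorted]

/-- The points of a zone. -/
def zoneOf (S : List (Labelled n)) (q : Zone) : List (Node n) :=
  S.filterMap fun c => if c.2.1 = q then some c.1 else none

theorem val_zoneList {K : ℕ} (hK : 1 ≤ K) (S : List (Labelled n)) (q : Zone) :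
    (zoneList K S q).val = zoneOf S q := by
  simp [zoneList, val_parLoop hK, zoneOf]

/-- The points all of whose Gromov products vanish. -/
noncomputable def zeroPoints (S : List (Labelled n)) : List (Node n) :=
  S.filterMap fun s => if s.2.1 = Zone.r1 ∧ s.2.2 = 0 then some s.1 else none

/-- The memory after a Steiner node is created and its distances are stored. -/
def Memory.addSteiner (M : Memory n) (x y z : Node n) (a b c : ℝ) (S : List (Labelled n)) :
    Memory n :=
  (S.map fun s => (s.1, s.2.2)).foldl (fun M' t => M'.setDist t.1 (.inr M.steiner) t.2)
    (((({ M with steiner := M.steiner + 1 } : Memory n).setDist x (.inr M.steiner) a).setDist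
      y (.inr M.steiner) b).setDist z (.inr M.steiner) c)

/-- The value of `placeSteiner`. -/
noncomputable def place (M : Memory n) (x y z : Node n) (a b c : ℝ) (S : List (Labelled n)) :
    Memory n × Node n × List (Labelled n) :=
  if a = 0 then (M, x, S)
  else if b = 0 then (M, y, S)
  else if c = 0 then (M, z, S)
  else match (zeroPoints S).head? with
    | some w => (M, w, S.filterMap fun s => if s.1 = w then none else some s)
    | none => (M.addSteiner x y z a b c S, .inr M.steiner, S)

theorem val_placeSteiner {K : ℕ} (hK : 1 ≤ K) (M : Memory n) (x y z : Node n) (a b c : ℝ)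
    (S : List (Labelled n)) : (placeSteiner K M x y z a b c S).val = place M x y z a b c S := by
  unfold placeSteiner place
  simp only [val_bind]
  split_ifs
  · rfl
  · rfl
  · rfl
  · have hz : (parLoop K (fun s : Labelled n => do
        tick 2
        pure (if s.2.1 = Zone.r1 ∧ s.2.2 = 0 then some s.1 else none)) S).val = zeroPoints S := by
      simp [val_parLoop hK, zeroPoints]
    rw [val_bind, val_bind, hz]
    cases (zeroPoints S).head? with
    | none => rfl
    | some w => simp [val_parLoop hK]

/-! ### The closest point -/

theorem closer_none_right (p : Option (Node n × ℝ)) : closer p none = p := by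
  cases p <;> rfl

/-- Ties go to the left, so both sides are the leftmost minimum. This makes the bracketing of the
fold by threads irrelevant. -/
theorem closer_assoc (p q r : Option (Node n × ℝ)) :
    closer (closer p q) r = closer p (closer q r) := by
  rcases p with _ | p
  · rfl
  rcases q with _ | q
  · rfl
  rcases r with _ | r
  · simp only [closer_none_right]
  simp only [closer]
  split_ifs <;> simp only <;> split_ifs <;> first | rfl | (exfalso; linarith)

/-- The point of a list closest to `v`. -/
noncomputable def closestOf (M : Memory n) (v : Node n) (L : List (Node n)) :
    Option (Node n × ℝ) :=
  (L.map fun w => some (w, M.dist w v)).foldr closer none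

theorem val_closestSeq (M : Memory n) (v : Node n) (L : List (Node n)) :
    (closestSeq M v L).val = closestOf M v L := by
  induction L with
  | nil => rfl
  | cons w l ih => simp [closestSeq, closestOf, ih, read]

theorem closestOf_append (M : Memory n) (v : Node n) (L L' : List (Node n)) :
    closestOf M v (L ++ L') = closer (closestOf M v L) (closestOf M v L') := by
  induction L with
  | nil => rfl
  | cons w l ih =>
    simp only [closestOf, List.cons_append, List.map_cons, List.foldr_cons] at ih ⊢
    rw [ih, closer_assoc]

theorem closestOf_flatten (M : Memory n) (v : Node n) (l : List (List (Node n))) :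
    closestOf M v l.flatten = (l.map (closestOf M v)).foldr closer none := by
  induction l with
  | nil => rfl
  | cons L l ih => rw [List.flatten_cons, closestOf_append, ih]; rfl

theorem val_closest {K : ℕ} (hK : 1 ≤ K) (M : Memory n) (v : Node n) (L : List (Node n)) :
    (closest K M v L).val = closestOf M v L := by
  conv_rhs => rw [← flatMap_range_block hK L]
  rw [List.flatMap, closestOf_flatten]
  simp only [closest, parallel, val_bind, val_pure, List.map_map]
  congr 2
  funext t
  simp [val_closestSeq]

theorem closestOf_eq_none_iff {M : Memory n} {v : Node n} {L : List (Node n)} :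
    closestOf M v L = none ↔ L = [] := by
  cases L with
  | nil => simp [closestOf]
  | cons w l =>
    simp only [closestOf, List.map_cons, List.foldr_cons, reduceCtorEq, iff_false]
    cases (l.map fun w => some (w, M.dist w v)).foldr closer none
    · simp [closer]
    · simp only [closer]; split_ifs <;> simp

/-- Membership is all that the correctness proof needs from the closest point. -/
theorem mem_of_closestOf_eq_some {M : Memory n} {v : Node n} {L : List (Node n)}
    {t : Node n × ℝ} (h : closestOf M v L = some t) : t.1 ∈ L := by
  induction L generalizing t with
  | nil => simp [closestOf] at h
  | cons w l ih =>
    have hc : closestOf M v (w :: l) = closer (some (w, M.dist w v)) (closestOf M v l) := rfl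
    rw [hc] at h
    cases hl : closestOf M v l with
    | none => rw [hl] at h; simp only [closer, Option.some.injEq] at h; simp [← h]
    | some s =>
      rw [hl] at h
      simp only [closer] at h
      split_ifs at h
      · obtain rfl := Option.some.inj h; exact List.mem_cons_of_mem _ (ih hl)
      · obtain rfl := Option.some.inj h; simp

/-! ### The recursive step as a function -/

/-- The value of `zone1`. -/
def zone1Val (step : Memory n → List (Node n) → Node n → Node n → Node n → Memory n)
    (M : Memory n) (L : List (Node n)) (v : Node n) : Memory n :=
  match L with
  | [] => M
  | [u] => M.insertEdge u v (M.dist u v)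
  | u :: z :: L' => step M L' v u z

/-- The value of `zone2`. -/
noncomputable def zone2Val
    (step : Memory n → List (Node n) → Node n → Node n → Node n → Memory n)
    (M : Memory n) (L : List (Node n)) (u v : Node n) : Memory n :=
  match closestOf M v L with
  | none => M
  | some (z, _) =>
    step (M.eraseEdge u v) (L.filterMap fun w => if w = z then none else some w) v u z

theorem val_zone1
    {step : Memory n → List (Node n) → Node n → Node n → Node n → Timed (Memory n)}
    {step' : Memory n → List (Node n) → Node n → Node n → Node n → Memory n}
    (h : ∀ M L x y z, (step M L x y z).val = step' M L x y z)
    (M : Memory n) (L : List (Node n)) (v : Node n) :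
    (zone1 step M L v).val = zone1Val step' M L v := by
  rcases L with _ | ⟨u, _ | ⟨z, L⟩⟩
  · rfl
  · rfl
  · exact h _ _ _ _ _

theorem val_zone2 {K : ℕ} (hK : 1 ≤ K)
    {step : Memory n → List (Node n) → Node n → Node n → Node n → Timed (Memory n)}
    {step' : Memory n → List (Node n) → Node n → Node n → Node n → Memory n}
    (h : ∀ M L x y z, (step M L x y z).val = step' M L x y z)
    (M : Memory n) (L : List (Node n)) (u v : Node n) :
    (zone2 K step M L u v).val = zone2Val step' M L u v := by
  unfold zone2 zone2Val
  rw [val_bind]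
  split_ifs with hL
  · subst hL; rfl
  · rw [val_bind, val_closest hK]
    rcases closestOf M v L with _ | ⟨z, d⟩
    · rfl
    · simp [val_parLoop hK, h]

/-- Whether a zone is of type two. -/
def Zone.isTwo : Zone → Bool
  | .x2 | .y2 | .z2 => true
  | _ => false

/-- The node of the universal tree at which a zone is attached. -/
def Zone.apex (x y z r : Node n) : Zone → Node n
  | .r1 => r
  | .x1 | .x2 => x
  | .y1 | .y2 => y
  | .z1 | .z2 => z

/-- All zones, in the order in which they are processed. -/
def Zone.all : List Zone := [.r1, .x1, .y1, .z1, .x2, .y2, .z2]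

/-- The recursion on the zone `q`, with the points `L`, attached at `v`, of a universal tree with
Steiner node `r`. -/
noncomputable def processZone
    (step : Memory n → List (Node n) → Node n → Node n → Node n → Memory n)
    (r : Node n) (q : Zone) (L : List (Node n)) (v : Node n) (M : Memory n) : Memory n :=
  if q.isTwo then zone2Val step M L v r else zone1Val step M L v

/-- The memory after the edges of the universal tree are added. -/
def Memory.addStar (M : Memory n) (x y z r : Node n) (a b c : ℝ) : Memory n :=
  ((M.insertEdge x r a).insertEdge y r b).insertEdge z r c

/-- The value of `recursiveStep`. -/
noncomputable def stepVal :
    ℕ → Memory n → List (Node n) → Node n → Node n → Node n → Memory n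
  | 0, M, _, _, _, _ => M
  | fuel + 1, M, L, x, y, z =>
    let P := place M x y z (product M y z x) (product M x z y) (product M x y z)
      (sorted M x y z L)
    Zone.all.foldl
      (fun M' q => processZone (stepVal fuel) P.2.1 q (zoneOf P.2.2 q) (q.apex x y z P.2.1) M')
      (P.1.addStar x y z P.2.1 (product M y z x) (product M x z y) (product M x y z))

theorem val_recursiveStep {K : ℕ} (hK : 1 ≤ K) (fuel : ℕ) (M : Memory n) (L : List (Node n))
    (x y z : Node n) : (recursiveStep K fuel M L x y z).val = stepVal fuel M L x y z := by
  induction fuel generalizing M L x y z with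
  | zero => rfl
  | succ fuel ih =>
    simp only [recursiveStep, val_bind, val_gromov, val_sortZones hK, val_placeSteiner hK,
      val_addEdge, val_zoneList hK, val_zone1 ih, val_zone2 hK ih]
    rfl

/-- The value of `build`. -/
noncomputable def buildVal (M : Memory n) : List (Node n) → Memory n
  | [] => M
  | [_] => M
  | [x, y] => M.insertEdge x y (M.dist x y)
  | x :: y :: z :: L => stepVal n M L x y z

theorem val_build {K : ℕ} (hK : 1 ≤ K) (M : Memory n) (L : List (Node n)) :
    (build K M L).val = buildVal M L := by
  rcases L with _ | ⟨x, _ | ⟨y, _ | ⟨z, L⟩⟩⟩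
  · rfl
  · rfl
  · rfl
  · exact val_recursiveStep hK _ _ _ _ _ _

/-- The weighted graph in the memory, with negative weights replaced by zero. -/
noncomputable def Memory.outputTree (M : Memory n) : WeightedGraph (Fin n ⊕ Fin M.steiner) :=
  ({ M with edge := fun e => (M.edge e).map (max 0) } : Memory n).toGraph

theorem val_treeRep {K : ℕ} (hK : 1 ≤ K) (d : Fin n → Fin n → ℝ) (order : List (Fin n)) :
    (treeRep K d order).val =
      ⟨_, (buildVal (initial d) (order.map Sum.inl)).outputTree⟩ := by
  unfold treeRep
  rw [val_bind, val_bind, val_bind, val_build hK]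
  rfl

/-! ### Frames -/

/-- The data points and the Steiner nodes created so far. -/
def Valid (M : Memory n) : Node n → Prop
  | .inl _ => True
  | .inr s => s < M.steiner

/-- The Steiner nodes of `M'` that are not in `M`. -/
def Fresh (M M' : Memory n) (p : Node n) : Prop := Valid M' p ∧ ¬ Valid M p

theorem Valid.mono {M M' : Memory n} (h : M.steiner ≤ M'.steiner) {p : Node n} (hp : Valid M p) :
    Valid M' p := by
  cases p with
  | inl => trivial
  | inr s => exact lt_of_lt_of_le hp h

theorem not_fresh_self {M M' : Memory n} (h : M'.steiner = M.steiner) (p : Node n) :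
    ¬ Fresh M M' p := by
  rintro ⟨h1, h2⟩
  exact h2 (h1.mono h.le)

/-- `M'` is obtained from `M` by changing only edges among the nodes in `P` and new Steiner nodes, and
by storing distances of new Steiner nodes. -/
structure Frame (M M' : Memory n) (P : Node n → Prop) : Prop where
  steiner : M.steiner ≤ M'.steiner
  dist : ∀ p q, Valid M p → Valid M q → M'.dist p q = M.dist p q
  diag : (∀ p, M.dist p p = 0) → ∀ p, M'.dist p p = 0
  edge : ∀ p q, M'.edge s(p, q) ≠ M.edge s(p, q) → P p ∨ Fresh M M' p

theorem Frame.rfl {M : Memory n} {P : Node n → Prop} : Frame M M P :=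
  ⟨le_refl _, fun _ _ _ _ => Eq.refl _, fun h => h, fun _ _ h => absurd (Eq.refl _) h⟩

theorem Frame.mono {M M' : Memory n} {P Q : Node n → Prop} (h : Frame M M' P)
    (hPQ : ∀ p, P p → Q p) : Frame M M' Q :=
  ⟨h.steiner, h.dist, h.diag, fun p q hpq => (h.edge p q hpq).imp_left (hPQ p)⟩

theorem Fresh.left {M M₁ M₂ : Memory n} (h : M₁.steiner ≤ M₂.steiner) {p : Node n}
    (hp : Fresh M M₁ p) : Fresh M M₂ p :=
  ⟨hp.1.mono h, hp.2⟩

theorem Fresh.right {M M₁ M₂ : Memory n} (h : M.steiner ≤ M₁.steiner) {p : Node n}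
    (hp : Fresh M₁ M₂ p) : Fresh M M₂ p :=
  ⟨hp.1, fun h' => hp.2 (h'.mono h)⟩

theorem Fresh.cases {M M₁ M₂ : Memory n} {p : Node n} (hp : Fresh M M₂ p) :
    Fresh M M₁ p ∨ Fresh M₁ M₂ p := by
  by_cases h : Valid M₁ p
  · exact .inl ⟨h, hp.2⟩
  · exact .inr ⟨hp.1, h⟩

theorem Frame.trans {M M₁ M₂ : Memory n} {P : Node n → Prop} (h₁ : Frame M M₁ P)
    (h₂ : Frame M₁ M₂ P) : Frame M M₂ P := by
  refine ⟨h₁.steiner.trans h₂.steiner, fun p q hp hq => ?_, fun h => h₂.diag (h₁.diag h),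
    fun p q hpq => ?_⟩
  · rw [h₂.dist p q (hp.mono h₁.steiner) (hq.mono h₁.steiner), h₁.dist p q hp hq]
  · by_cases h : M₂.edge s(p, q) = M₁.edge s(p, q)
    · rw [h] at hpq
      exact (h₁.edge p q hpq).imp_right (.left h₂.steiner)
    · exact (h₂.edge p q h).imp_right (.right h₁.steiner)

theorem Frame.insertEdge (M : Memory n) (p q : Node n) (v : ℝ) :
    Frame M (M.insertEdge p q v) (fun t => t = p ∨ t = q) := by
  refine ⟨le_refl _, fun _ _ _ _ => Eq.refl _, fun h => h, fun a b hab => .inl ?_⟩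
  by_contra h
  refine hab (if_neg fun he => h ?_)
  rcases Sym2.eq_iff.1 he with ⟨h1, -⟩ | ⟨h1, -⟩ <;> simp [h1]

theorem Frame.eraseEdge (M : Memory n) (p q : Node n) :
    Frame M (M.eraseEdge p q) (fun t => t = p ∨ t = q) := by
  refine ⟨le_refl _, fun _ _ _ _ => Eq.refl _, fun h => h, fun a b hab => .inl ?_⟩
  by_contra h
  refine hab (if_neg fun he => h ?_)
  rcases Sym2.eq_iff.1 he with ⟨h1, -⟩ | ⟨h1, -⟩ <;> simp [h1]

/-- The edge between two valid nodes changes only if both are in `P`. -/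
theorem Frame.edge_eq {M M' : Memory n} {P : Node n → Prop} (h : Frame M M' P) {p q : Node n}
    (hp : Valid M p) (hq : Valid M q) (hpq : ¬ (P p ∧ P q)) : M'.edge s(p, q) = M.edge s(p, q) := by
  by_contra hne
  refine hpq ⟨(h.edge p q hne).resolve_right fun hf => hf.2 hp, ?_⟩
  rw [Sym2.eq_swap] at hne
  exact (h.edge q p hne).resolve_right fun hf => hf.2 hq

/-- All edges are between valid nodes. -/
def ValidEdges (M : Memory n) : Prop := ∀ p q, (M.edge s(p, q)).isSome → Valid M p

theorem Frame.validEdges {M M' : Memory n} {P : Node n → Prop} (h : Frame M M' P)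
    (hP : ∀ p, P p → Valid M p) (hM : ValidEdges M) : ValidEdges M' := by
  intro p q hpq
  by_cases he : M'.edge s(p, q) = M.edge s(p, q)
  · rw [he] at hpq
    exact (hM p q hpq).mono h.steiner
  · rcases h.edge p q he with hp | hp
    · exact (hP p hp).mono h.steiner
    · exact hp.1

/-! ### Connectedness and the number of edges -/

/-- The relation `R` contains the edges of `M`. -/
def Supports (R : Setoid (Node n)) (M : Memory n) : Prop :=
  ∀ p q, (M.edge s(p, q)).isSome → R p q

theorem Supports.of_insertEdge {R : Setoid (Node n)} {M : Memory n} {p q : Node n} {v : ℝ}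
    (h : Supports R (M.insertEdge p q v)) : Supports R M ∧ R p q := by
  have hpq : R p q := h p q (by simp [Memory.insertEdge])
  refine ⟨fun a b hab => h a b ?_, hpq⟩
  simp only [Memory.insertEdge]
  split_ifs
  · rfl
  · exact hab

/-- Deleting an edge is harmless if its two ends get connected again by later edges. -/
theorem Supports.of_eraseEdge {R : Setoid (Node n)} {M : Memory n} {p q : Node n}
    (h : Supports R (M.eraseEdge p q)) (hpq : R p q) : Supports R M := by
  intro a b hab
  by_cases he : s(a, b) = s(p, q)
  · rcases Sym2.eq_iff.1 he with ⟨rfl, rfl⟩ | ⟨rfl, rfl⟩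
    · exact hpq
    · exact R.symm hpq
  · refine h a b ?_
    simpa [Memory.eraseEdge, he] using hab

/-- There are at most `k` edges, not counting loops. -/
def EdgeBound (M : Memory n) (k : ℕ) : Prop :=
  ∃ F : Finset (Sym2 (Node n)), F.card ≤ k ∧ ∀ e, (M.edge e).isSome → ¬ e.IsDiag → e ∈ F

theorem EdgeBound.mono {M : Memory n} {k l : ℕ} (h : EdgeBound M k) (hkl : k ≤ l) :
    EdgeBound M l :=
  let ⟨F, h1, h2⟩ := h
  ⟨F, h1.trans hkl, h2⟩

theorem EdgeBound.insertEdge {M : Memory n} {k : ℕ} (h : EdgeBound M k) (p q : Node n) (v : ℝ) :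
    EdgeBound (M.insertEdge p q v) (k + if p = q then 0 else 1) := by
  obtain ⟨F, h1, h2⟩ := h
  split_ifs with hpq
  · refine ⟨F, h1, fun e he hd => h2 e ?_ hd⟩
    have : e ≠ s(p, q) := by rintro rfl; exact hd (by simpa using hpq)
    simpa [Memory.insertEdge, this] using he
  · refine ⟨insert s(p, q) F, (Finset.card_insert_le _ _).trans (by omega), fun e he hd => ?_⟩
    by_cases h3 : e = s(p, q)
    · simp [h3]
    · refine Finset.mem_insert_of_mem (h2 e ?_ hd)
      simpa [Memory.insertEdge, h3] using he

/-- The deletion pays for one later edge, but only if the edge was present and is not a loop. -/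
theorem EdgeBound.eraseEdge {M : Memory n} {k : ℕ} (h : EdgeBound M k) {p q : Node n}
    (hpq : p ≠ q) (he : (M.edge s(p, q)).isSome) :
    ∃ l, k = l + 1 ∧ EdgeBound (M.eraseEdge p q) l := by
  obtain ⟨F, h1, h2⟩ := h
  have hF := h2 _ he (by simpa using hpq)
  have hc := Finset.card_erase_add_one hF
  refine ⟨k - 1, by omega, F.erase s(p, q), by omega, fun e h3 h4 => ?_⟩
  have h5 : e ≠ s(p, q) := by rintro rfl; simp [Memory.eraseEdge] at h3
  refine Finset.mem_erase.2 ⟨h5, h2 e ?_ h4⟩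
  simpa [Memory.eraseEdge, h5] using h3

theorem EdgeBound.of_eraseEdge {M : Memory n} {k : ℕ} (h : EdgeBound M k) (p q : Node n) :
    EdgeBound (M.eraseEdge p q) k := by
  obtain ⟨F, h1, h2⟩ := h
  refine ⟨F, h1, fun e h3 h4 => h2 e ?_ h4⟩
  simp only [Memory.eraseEdge] at h3
  split_ifs at h3
  · simp at h3
  · exact h3

/-- A part of the algorithm that takes `M` to `M'` and connects the nodes of the list `A` to each
other and to the new Steiner nodes. -/
structure Grows (M M' : Memory n) (A : List (Node n)) (k : ℕ) : Prop where
  frame : Frame M M' (· ∈ A)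
  -- Quantifying over all equivalence relations that contain the final edges expresses connectedness
  -- without walks, and composes backwards through insertions and deletions.
  joined : ∀ R : Setoid (Node n), Supports R M' →
    Supports R M ∧ ∀ p q, p ∈ A ∨ Fresh M M' p → q ∈ A ∨ Fresh M M' q → R p q
  count : ∀ m, EdgeBound M m → EdgeBound M' (m + k + (M'.steiner - M.steiner))

/-- The assumptions of the recursive step. -/
structure StepPre (fuel : ℕ) (M : Memory n) (L : List (Node n)) (x y z : Node n) : Prop where
  length : L.length < fuel
  nodup : L.Nodup
  x_notMem : x ∉ L
  y_notMem : y ∉ L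
  z_notMem : z ∉ L
  -- The case `x = y` is allowed: for an arbitrary table a zone of type two may be nonempty although
  -- its apex is `r`, and the recursive call then repeats this node.
  xz : x ≠ z
  yz : y ≠ z
  valid : ∀ p ∈ x :: y :: z :: L, Valid M p
  diag : ∀ p, M.dist p p = 0

/-! ### The zones -/

/-- The nodes that are involved in the recursion on a zone. -/
def ZoneNode (r : Node n) (q : Zone) (L : List (Node n)) (v p : Node n) : Prop :=
  p = v ∨ p ∈ L ∨ (q.isTwo = true ∧ p = r)

/-- The assumptions of the recursion on a zone. -/
structure ZonePre (fuel : ℕ) (M : Memory n) (r : Node n) (L : List (Node n)) (v : Node n) :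
    Prop where
  length : L.length ≤ fuel
  nodup : L.Nodup
  apex_notMem : v ∉ L
  root_notMem : r ∉ L
  valid : ∀ p ∈ v :: r :: L, Valid M p
  diag : ∀ p, M.dist p p = 0

theorem ZonePre.of_frame {fuel : ℕ} {M M' : Memory n} {r : Node n} {L : List (Node n)}
    {v : Node n} {P : Node n → Prop} (h : ZonePre fuel M r L v) (hF : Frame M M' P) :
    ZonePre fuel M' r L v :=
  ⟨h.length, h.nodup, h.apex_notMem, h.root_notMem, fun p hp => (h.valid p hp).mono hF.steiner,
    hF.diag h.diag⟩

theorem filterMap_ne_eq_filter (L : List (Node n)) (z : Node n) :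
    (L.filterMap fun w => if w = z then none else some w) = L.filter (· ≠ z) := by
  rw [← List.filterMap_eq_filter]
  congr 1
  funext w
  by_cases h : w = z <;> simp [h, Option.guard]

theorem ZonePre.stepPre_one {fuel : ℕ} {M : Memory n} {r : Node n} {L : List (Node n)}
    {v u z : Node n} (h : ZonePre fuel M r (u :: z :: L) v) : StepPre fuel M L v u z := by
  obtain ⟨h1, h2, h3, h4, h5, h6⟩ := h
  simp only [List.length_cons, List.nodup_cons, List.mem_cons, not_or] at h1 h2 h3 h5
  refine ⟨by omega, h2.2.2, h3.2.2, h2.1.2, h2.2.1, h3.2.1, h2.1.1, fun p hp => h5 p ?_, h6⟩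
  simp only [List.mem_cons] at hp
  tauto

theorem ZonePre.stepPre_two {fuel : ℕ} {M : Memory n} {r : Node n} {L : List (Node n)}
    {v z : Node n} (h : ZonePre fuel M r L v) (hz : z ∈ L) :
    StepPre fuel (M.eraseEdge v r) (L.filter (· ≠ z)) r v z := by
  have hlen : (L.filter (· ≠ z)).length < L.length :=
    List.length_filter_lt_length_iff_exists.2 ⟨z, hz, by simp⟩
  refine ⟨hlen.trans_le h.length, h.nodup.filter _, fun hm => h.root_notMem (List.mem_filter.1 hm).1,
    fun hm => h.apex_notMem (List.mem_filter.1 hm).1, by simp, ?_, ?_, fun p hp => h.valid p ?_,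
    h.diag⟩
  · rintro rfl; exact h.root_notMem hz
  · rintro rfl; exact h.apex_notMem hz
  · simp only [List.mem_cons, List.mem_filter] at hp ⊢
    rcases hp with rfl | rfl | rfl | hp
    · simp
    · simp
    · simp [hz]
    · simp [hp.1]

theorem length_filter_ne {α : Type} [DecidableEq α] {L : List α} (h : L.Nodup) {z : α}
    (hz : z ∈ L) : (L.filter (· ≠ z)).length + 1 = L.length := by
  have h1 := h.erase_eq_filter z
  have h2 := List.length_erase_add_one hz
  rw [h1] at h2
  rw [← h2]
  congr 3
  funext w
  by_cases hw : w = z <;> simp [hw]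

/-- The recursion on a zone, if the recursive step is correct. -/
theorem processZone_grows {fuel : ℕ}
    {step : Memory n → List (Node n) → Node n → Node n → Node n → Memory n}
    (hstep : ∀ M L x y z, StepPre fuel M L x y z →
      Grows M (step M L x y z) (x :: y :: z :: L) ((if x = y then 1 else 2) + L.length))
    {M : Memory n} {r : Node n} {q : Zone} {L : List (Node n)} {v : Node n}
    (h : ZonePre fuel M r L v)
    (he : q.isTwo = true → v ≠ r → (M.edge s(v, r)).isSome) :
    Frame M (processZone step r q L v M) (ZoneNode r q L v) ∧
    (∀ R : Setoid (Node n), Supports R (processZone step r q L v M) →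
      Supports R M ∧ ∀ p, p ∈ L ∨ Fresh M (processZone step r q L v M) p → R p v) ∧
    ∀ m, EdgeBound M m → EdgeBound (processZone step r q L v M)
      (m + L.length + ((processZone step r q L v M).steiner - M.steiner)) := by
  unfold processZone
  split_ifs with hq
  · unfold zone2Val
    cases hc : closestOf M r L with
    | none =>
      rw [closestOf_eq_none_iff] at hc
      subst hc
      refine ⟨.rfl, fun R hR => ⟨hR, fun p hp => ?_⟩, fun m hm => hm.mono (by omega)⟩
      exact absurd hp (by simpa using not_fresh_self (Eq.refl _) p)
    | some t =>
      obtain ⟨z, d⟩ := t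
      have hz : z ∈ L := mem_of_closestOf_eq_some hc
      have hlen := length_filter_ne h.nodup hz
      simp only [filterMap_ne_eq_filter]
      have hs := hstep _ _ _ _ _ (h.stepPre_two hz)
      set M' := step (M.eraseEdge v r) (L.filter (· ≠ z)) r v z
      refine ⟨?_, fun R hR => ?_, fun m hm => ?_⟩
      · refine ((Frame.eraseEdge M v r).mono ?_).trans (hs.frame.mono ?_)
        · rintro p (rfl | rfl)
          · exact .inl (Eq.refl _)
          · exact .inr (.inr ⟨hq, Eq.refl _⟩)
        · intro p hp
          simp only [List.mem_cons, List.mem_filter] at hp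
          rcases hp with rfl | rfl | rfl | hp
          · exact .inr (.inr ⟨hq, Eq.refl _⟩)
          · exact .inl (Eq.refl _)
          · exact .inr (.inl hz)
          · exact .inr (.inl hp.1)
      · obtain ⟨h1, h2⟩ := hs.joined R hR
        -- The recursive step has `r` and `v` among its nodes, so it reconnects the ends of the
        -- deleted edge.
        refine ⟨h1.of_eraseEdge (h2 v r (by simp) (by simp)), fun p hp => h2 p v ?_ (by simp)⟩
        refine hp.imp_left fun hp => ?_
        simp only [List.mem_cons, List.mem_filter]
        by_cases hpz : p = z <;> simp [hpz, hp]
      · have hst : (M.eraseEdge v r).steiner = M.steiner := Eq.refl _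
        -- For `v = r` only a loop is lost and `1 + (|L| - 1)` edges are paid for. Otherwise one
        -- edge is lost and the price is `2 + (|L| - 1)`. The balance is `|L|` in both cases.
        by_cases hvr : v = r
        · refine (hs.count m (hm.of_eraseEdge _ _)).mono ?_
          rw [hst, if_pos hvr.symm]
          omega
        · obtain ⟨l, rfl, hl⟩ := hm.eraseEdge hvr (he hq hvr)
          refine (hs.count l hl).mono ?_
          rw [hst, if_neg (Ne.symm hvr)]
          omega
  · rcases L with _ | ⟨u, _ | ⟨z, L⟩⟩
    · refine ⟨.rfl, fun R hR => ⟨hR, fun p hp => ?_⟩, fun m hm => hm.mono (by omega)⟩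
      exact absurd hp (by simpa [zone1Val] using not_fresh_self (Eq.refl _) p)
    · refine ⟨(Frame.insertEdge _ _ _ _).mono ?_, fun R hR => ?_, fun m hm => ?_⟩
      · rintro p (rfl | rfl) <;> simp [ZoneNode]
      · obtain ⟨h1, h2⟩ := hR.of_insertEdge
        refine ⟨h1, fun p hp => ?_⟩
        rcases hp with hp | hp
        · obtain rfl := List.mem_singleton.1 hp; exact h2
        · exact absurd hp (not_fresh_self (Eq.refl _) p)
      · refine (hm.insertEdge u v (M.dist u v)).mono ?_
        simp only [List.length_singleton]
        split_ifs <;> omega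
    · have hs := hstep _ _ _ _ _ h.stepPre_one
      have huv : v ≠ u := fun he => h.apex_notMem (by simp [he])
      refine ⟨hs.frame.mono ?_, fun R hR => ?_, fun m hm => ?_⟩
      · intro p hp
        simp only [ZoneNode, List.mem_cons] at hp ⊢
        tauto
      · obtain ⟨h1, h2⟩ := hs.joined R hR
        refine ⟨h1, fun p hp => h2 p v (hp.imp_left fun hp => ?_) (by simp)⟩
        simp only [List.mem_cons] at hp ⊢
        tauto
      · refine (hs.count m hm).mono ?_
        rw [if_neg huv]
        simp only [zone1Val, List.length_cons]
        omega

/-- The edge of a zone of type two is not among the nodes of another zone. -/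
def ZonesApart (r : Node n) (L : Zone → List (Node n)) (v : Zone → Node n) : Prop :=
  ∀ q q', q ≠ q' → q'.isTwo = true → v q' ≠ r →
    ¬ (ZoneNode r q (L q) (v q) (v q') ∧ ZoneNode r q (L q) (v q) r)

/-- The recursion on several zones, if the recursive step is correct. -/
theorem processZones_grows {fuel : ℕ}
    {step : Memory n → List (Node n) → Node n → Node n → Node n → Memory n}
    (hstep : ∀ M L x y z, StepPre fuel M L x y z →
      Grows M (step M L x y z) (x :: y :: z :: L) ((if x = y then 1 else 2) + L.length))
    {r : Node n} {L : Zone → List (Node n)} {v : Zone → Node n} (hd : ZonesApart r L v)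
    (qs : List Zone) (hqs : qs.Nodup) (M : Memory n)
    (h : ∀ q, ZonePre fuel M r (L q) (v q))
    (he : ∀ q ∈ qs, q.isTwo = true → v q ≠ r → (M.edge s(v q, r)).isSome) :
    Frame M (qs.foldl (fun M q => processZone step r q (L q) (v q) M) M)
      (fun p => ∃ q ∈ qs, ZoneNode r q (L q) (v q) p) ∧
    (∀ R : Setoid (Node n),
      Supports R (qs.foldl (fun M q => processZone step r q (L q) (v q) M) M) →
      Supports R M ∧ ∀ p, (∃ q ∈ qs, p ∈ L q) ∨
        Fresh M (qs.foldl (fun M q => processZone step r q (L q) (v q) M) M) p →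
        ∃ q ∈ qs, R p (v q)) ∧
    ∀ m, EdgeBound M m →
      EdgeBound (qs.foldl (fun M q => processZone step r q (L q) (v q) M) M)
        (m + (qs.map fun q => (L q).length).sum +
          ((qs.foldl (fun M q => processZone step r q (L q) (v q) M) M).steiner - M.steiner)) := by
  induction qs generalizing M with
  | nil =>
    refine ⟨.rfl, fun R hR => ⟨hR, fun p hp => ?_⟩, fun m hm => hm.mono (by simp)⟩
    exact absurd hp (by simpa using not_fresh_self (Eq.refl _) p)
  | cons q qs ih =>
    rw [List.nodup_cons] at hqs
    obtain ⟨f1, j1, c1⟩ := processZone_grows hstep (h q) (he q (by simp))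
    rw [List.foldl_cons]
    set M₁ := processZone step r q (L q) (v q) M
    have hr : Valid M r := (h q).valid r (by simp)
    obtain ⟨f2, j2, c2⟩ := ih hqs.2 M₁ (fun q' => (h q').of_frame f1) (fun q' hq' h2 hne => by
      have hqq : q ≠ q' := by rintro rfl; exact hqs.1 hq'
      -- The recursion on `q` cannot change the edge from `v q'` to `r`, because its ends are not
      -- both nodes of the zone `q`.
      rw [f1.edge_eq ((h q').valid _ (by simp)) hr (hd q q' hqq h2 hne)]
      exact he q' (List.mem_cons_of_mem _ hq') h2 hne)
    set M₂ := qs.foldl (fun M q => processZone step r q (L q) (v q) M) M₁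
    refine ⟨(f1.mono fun p hp => ⟨q, by simp, hp⟩).trans
      (f2.mono fun p ⟨q', hq', hp⟩ => ⟨q', List.mem_cons_of_mem _ hq', hp⟩), fun R hR => ?_,
      fun m hm => ?_⟩
    · obtain ⟨s1, t2⟩ := j2 R hR
      obtain ⟨s0, t1⟩ := j1 R s1
      refine ⟨s0, fun p hp => ?_⟩
      have hp' : (p ∈ L q ∨ Fresh M M₁ p) ∨ ((∃ q ∈ qs, p ∈ L q) ∨ Fresh M₁ M₂ p) := by
        rcases hp with ⟨q', hq', hp⟩ | hp
        · rcases List.mem_cons.1 hq' with rfl | hq'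
          · exact .inl (.inl hp)
          · exact .inr (.inl ⟨q', hq', hp⟩)
        · exact hp.cases.imp .inr .inr
      rcases hp' with hp | hp
      · exact ⟨q, by simp, t1 p hp⟩
      · obtain ⟨q', hq', h'⟩ := t2 p hp
        exact ⟨q', List.mem_cons_of_mem _ hq', h'⟩
    · refine (c2 _ (c1 m hm)).mono ?_
      have := f1.steiner
      have := f2.steiner
      simp only [List.map_cons, List.sum_cons]
      omega

/-! ### Placing the Steiner node -/

theorem setDist_of_ne (M : Memory n) {r p q : Node n} (t : Node n) (v : ℝ) (hp : p ≠ r)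
    (hq : q ≠ r) : (M.setDist t r v).dist p q = M.dist p q :=
  if_neg (by tauto)

theorem foldl_setDist_steiner (l : List (Node n × ℝ)) (r : Node n) (M : Memory n) :
    (l.foldl (fun M' t => M'.setDist t.1 r t.2) M).steiner = M.steiner := by
  induction l generalizing M with
  | nil => rfl
  | cons t l ih => exact ih _

theorem foldl_setDist_edge (l : List (Node n × ℝ)) (r : Node n) (M : Memory n) :
    (l.foldl (fun M' t => M'.setDist t.1 r t.2) M).edge = M.edge := by
  induction l generalizing M with
  | nil => rfl
  | cons t l ih => exact ih _

theorem foldl_setDist_of_ne (l : List (Node n × ℝ)) {r : Node n} (M : Memory n) {p q : Node n}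
    (hp : p ≠ r) (hq : q ≠ r) :
    (l.foldl (fun M' t => M'.setDist t.1 r t.2) M).dist p q = M.dist p q := by
  induction l generalizing M with
  | nil => rfl
  | cons t l ih => rw [List.foldl_cons, ih, setDist_of_ne _ _ _ hp hq]

theorem foldl_setDist_of_notMem (l : List (Node n × ℝ)) {r : Node n} (M : Memory n) {p : Node n}
    (hp : p ≠ r) (hl : p ∉ l.map Prod.fst) :
    (l.foldl (fun M' t => M'.setDist t.1 r t.2) M).dist p r = M.dist p r ∧
    (l.foldl (fun M' t => M'.setDist t.1 r t.2) M).dist r p = M.dist r p := by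
  induction l generalizing M with
  | nil => exact ⟨rfl, rfl⟩
  | cons t l ih =>
    simp only [List.map_cons, List.mem_cons, not_or] at hl
    obtain ⟨h1, h2⟩ := ih (M.setDist t.1 r t.2) hl.2
    rw [List.foldl_cons, h1, h2]
    exact ⟨if_neg (by tauto), if_neg (by tauto)⟩

theorem foldl_setDist_of_mem (l : List (Node n × ℝ)) {r : Node n} (M : Memory n)
    (hl : (l.map Prod.fst).Nodup) (hr : r ∉ l.map Prod.fst) {t : Node n × ℝ} (ht : t ∈ l) :
    (l.foldl (fun M' t => M'.setDist t.1 r t.2) M).dist t.1 r = t.2 ∧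
    (l.foldl (fun M' t => M'.setDist t.1 r t.2) M).dist r t.1 = t.2 := by
  induction l generalizing M with
  | nil => simp at ht
  | cons s l ih =>
    simp only [List.map_cons, List.nodup_cons, List.mem_cons, not_or] at hl hr
    rw [List.foldl_cons]
    rcases List.mem_cons.1 ht with rfl | ht
    · obtain ⟨h1, h2⟩ := foldl_setDist_of_notMem l (M.setDist t.1 r t.2) (Ne.symm hr.1) hl.1
      rw [h1, h2]
      exact ⟨if_pos (by simp), if_pos (by simp)⟩
    · exact ih _ hl.2 hr.2 ht

theorem foldl_setDist_diag (l : List (Node n × ℝ)) {r : Node n} (M : Memory n)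
    (hr : r ∉ l.map Prod.fst) (hM : ∀ p, M.dist p p = 0) (p : Node n) :
    (l.foldl (fun M' t => M'.setDist t.1 r t.2) M).dist p p = 0 := by
  induction l generalizing M with
  | nil => exact hM p
  | cons t l ih =>
    simp only [List.map_cons, List.mem_cons, not_or] at hr
    refine ih _ hr.2 fun p => ?_
    rw [← hM p]
    exact if_neg (by rintro (⟨h, h'⟩ | ⟨h, h'⟩) <;> exact hr.1 (by rw [← h, ← h']))

/-- Treats the three separate writes and the pass over the points as a single fold. -/
theorem addSteiner_eq (M : Memory n) (x y z : Node n) (a b c : ℝ) (S : List (Labelled n)) :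
    M.addSteiner x y z a b c S =
      ((x, a) :: (y, b) :: (z, c) :: S.map fun s => (s.1, s.2.2)).foldl
        (fun M' t => M'.setDist t.1 (.inr M.steiner) t.2) { M with steiner := M.steiner + 1 } :=
  rfl

theorem steiner_addSteiner (M : Memory n) (x y z : Node n) (a b c : ℝ) (S : List (Labelled n)) :
    (M.addSteiner x y z a b c S).steiner = M.steiner + 1 := by
  rw [addSteiner_eq, foldl_setDist_steiner]

theorem Valid.ne_next {M : Memory n} {p : Node n} (h : Valid M p) : p ≠ .inr M.steiner := by
  rintro rfl; exact lt_irrefl _ h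

theorem map_fst_sorted (M : Memory n) (x y z : Node n) (L : List (Node n)) :
    (sorted M x y z L).map (fun s => s.1) = L := by
  simp [sorted, Function.comp_def]

/-- The points of a zone of the universal tree on `x, y, z` with Steiner node `r`. -/
noncomputable def zonePoints (M : Memory n) (x y z : Node n) (L : List (Node n)) (r : Node n)
    (q : Zone) : List (Node n) :=
  L.filter fun w => w ≠ r ∧ (classify M x y z w).val.1 = q

theorem zoneOf_filter_sorted (M : Memory n) (x y z : Node n) (L : List (Node n)) (r : Node n)
    (q : Zone) : zoneOf ((sorted M x y z L).filter fun s => s.1 ≠ r) q =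
      zonePoints M x y z L r q := by
  induction L with
  | nil => rfl
  | cons w l ih =>
    simp only [zoneOf, sorted, zonePoints, List.map_cons, List.filter_cons] at ih ⊢
    by_cases h1 : w = r <;> by_cases h2 : (classify M x y z w).val.1 = q <;> simp [h1, h2]
    all_goals simpa [h1, h2] using ih

theorem mem_zonePoints {M : Memory n} {x y z : Node n} {L : List (Node n)} {r : Node n}
    {q : Zone} {w : Node n} :
    w ∈ zonePoints M x y z L r q ↔ w ∈ L ∧ w ≠ r ∧ (classify M x y z w).val.1 = q := by
  simp [zonePoints]

/-- The zones partition the points other than `r`. -/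
theorem sum_length_zonePoints (M : Memory n) (x y z : Node n) (L : List (Node n)) (r : Node n) :
    (Zone.all.map fun q => (zonePoints M x y z L r q).length).sum =
      (L.filter (· ≠ r)).length := by
  induction L with
  | nil => rfl
  | cons w l ih =>
    simp only [Zone.all, zonePoints, List.filter_cons, List.map_cons, List.map_nil,
      List.sum_cons, List.sum_nil] at ih ⊢
    by_cases h1 : w = r
    · simpa [h1] using ih
    · rcases h : (classify M x y z w).val.1 <;>
        simp only [h1, ne_eq, not_false_eq_true, true_and, decide_true, reduceCtorEq,
          decide_false, if_true, Bool.false_eq_true, if_false, List.length_cons] <;>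
        simp only [ne_eq] at ih <;> omega

/-- What is known about the Steiner node for an arbitrary table of distances. -/
structure Placed (M : Memory n) (x y z : Node n) (L : List (Node n)) (M₁ : Memory n)
    (r : Node n) : Prop where
  edge : M₁.edge = M.edge
  frame : Frame M M₁ fun _ => False
  valid : Valid M₁ r
  root : Valid M r → r ∈ x :: y :: z :: L
  fresh : ∀ p, Fresh M M₁ p → p = r
  eq : x = y → r = x
  -- The balance of the star: contraction saves an edge, a point in the place of `r` leaves the
  -- list, and a new Steiner node pays for its third edge. For `x = y` two of the three edges are
  -- loops.
  count : (L.filter (· ≠ r)).length +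
      ((if x = r then 0 else 1) + (if y = r then 0 else 1) + if z = r then 0 else 1) ≤
    L.length + (if x = y then 1 else 2) + (M₁.steiner - M.steiner)

/-- The possible results of placing the Steiner node. -/
theorem place_cases (M : Memory n) (x y z : Node n) (a b c : ℝ) (L : List (Node n)) :
    (a = 0 ∧ place M x y z a b c (sorted M x y z L) = (M, x, sorted M x y z L)) ∨
    (a ≠ 0 ∧ b = 0 ∧ place M x y z a b c (sorted M x y z L) = (M, y, sorted M x y z L)) ∨
    (a ≠ 0 ∧ b ≠ 0 ∧ c = 0 ∧
      place M x y z a b c (sorted M x y z L) = (M, z, sorted M x y z L)) ∨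
    (a ≠ 0 ∧ b ≠ 0 ∧ c ≠ 0 ∧ ∃ w ∈ L, (classify M x y z w).val = (.r1, 0) ∧
      place M x y z a b c (sorted M x y z L) =
        (M, w, (sorted M x y z L).filter fun s => s.1 ≠ w)) ∨
    (a ≠ 0 ∧ b ≠ 0 ∧ c ≠ 0 ∧ (∀ w ∈ L, (classify M x y z w).val ≠ (.r1, 0)) ∧
      place M x y z a b c (sorted M x y z L) =
        (M.addSteiner x y z a b c (sorted M x y z L), .inr M.steiner, sorted M x y z L)) := by
  unfold place
  by_cases ha : a = 0
  · exact .inl ⟨ha, by simp [ha]⟩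
  by_cases hb : b = 0
  · exact .inr (.inl ⟨ha, hb, by simp [ha, hb]⟩)
  by_cases hc : c = 0
  · exact .inr (.inr (.inl ⟨ha, hb, hc, by simp [ha, hb, hc]⟩))
  simp only [ha, hb, hc, if_false]
  have hmem : ∀ w, w ∈ zeroPoints (sorted M x y z L) ↔
      w ∈ L ∧ (classify M x y z w).val = (.r1, 0) := by
    intro w
    simp only [zeroPoints, sorted, List.mem_filterMap, List.mem_map, Prod.ext_iff]
    constructor
    · rintro ⟨⟨s1, s2, s3⟩, ⟨t, ht, h1, h2, h3⟩, h⟩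
      dsimp only at h1 h2 h3 h
      subst h1 h2 h3
      simp only [Option.ite_none_right_eq_some, Option.some.injEq] at h
      obtain ⟨h1, rfl⟩ := h
      exact ⟨ht, h1⟩
    · rintro ⟨h1, h2⟩
      exact ⟨(w, (classify M x y z w).val), ⟨w, h1, rfl, rfl, rfl⟩, by simp [h2.1, h2.2]⟩
  cases hh : (zeroPoints (sorted M x y z L)).head? with
  | none =>
    refine .inr (.inr (.inr (.inr ⟨ha, hb, hc, fun w hw h => ?_, rfl⟩)))
    rw [List.head?_eq_none_iff] at hh
    have := (hmem w).2 ⟨hw, h⟩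
    simp [hh] at this
  | some w =>
    obtain ⟨h1, h2⟩ := (hmem w).1 (List.mem_of_head? hh)
    refine .inr (.inr (.inr (.inl ⟨ha, hb, hc, w, h1, h2, ?_⟩)))
    simp only [Prod.mk.injEq, true_and]
    rw [← List.filterMap_eq_filter]
    congr 1
    funext s
    by_cases h : s.1 = w <;> simp [h, Option.guard]

/-- Removing `r` from the list describes all five outcomes at once, because `r` is not in `L` unless
a point of `L` takes its place. -/
theorem place_spec {fuel : ℕ} {M : Memory n} {x y z : Node n} {L : List (Node n)}
    (h : StepPre fuel M L x y z) {a b c : ℝ} (ha : x = y → a = 0) :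
    Placed M x y z L (place M x y z a b c (sorted M x y z L)).1
      (place M x y z a b c (sorted M x y z L)).2.1 ∧
    (place M x y z a b c (sorted M x y z L)).2.2 =
      (sorted M x y z L).filter fun s => s.1 ≠ (place M x y z a b c (sorted M x y z L)).2.1 := by
  have hsub : ∀ r, r ∉ L → sorted M x y z L = (sorted M x y z L).filter fun s => s.1 ≠ r := by
    intro r hr
    refine (List.filter_eq_self.2 fun s hs => ?_).symm
    have : s.1 ∈ (sorted M x y z L).map (fun s => s.1) := List.mem_map_of_mem hs
    rw [map_fst_sorted] at this
    simp only [ne_eq, decide_not, Bool.not_eq_eq_eq_not, Bool.not_true, decide_eq_false_iff_not]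
    rintro rfl; exact hr this
  have hlen : ∀ r, (L.filter (· ≠ r)).length ≤ L.length := fun r => List.length_filter_le _ _
  rcases place_cases M x y z a b c L with ⟨-, hP⟩ | ⟨h0, -, hP⟩ | ⟨h0, -, -, hP⟩ |
    ⟨h0, -, -, w, hw, -, hP⟩ | ⟨h0, -, -, -, hP⟩ <;> rw [hP] <;> dsimp only
  · refine ⟨⟨rfl, .rfl, h.valid _ (by simp), fun _ => by simp,
      fun p hp => absurd hp (not_fresh_self rfl p), fun _ => rfl, ?_⟩, hsub x h.x_notMem⟩
    have := hlen x
    by_cases hxy : x = y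
    · rw [if_pos rfl, if_pos hxy, if_pos hxy.symm]; split_ifs <;> omega
    · rw [if_pos rfl, if_neg hxy]; split_ifs <;> omega
  · have hxy : x ≠ y := fun he => h0 (ha he)
    refine ⟨⟨rfl, .rfl, h.valid _ (by simp), fun _ => by simp,
      fun p hp => absurd hp (not_fresh_self rfl p), fun he => absurd he hxy, ?_⟩,
      hsub y h.y_notMem⟩
    have := hlen y
    simp only [if_neg hxy, if_true]; split_ifs <;> omega
  · have hxy : x ≠ y := fun he => h0 (ha he)
    refine ⟨⟨rfl, .rfl, h.valid _ (by simp), fun _ => by simp,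
      fun p hp => absurd hp (not_fresh_self rfl p), fun he => absurd he hxy, ?_⟩,
      hsub z h.z_notMem⟩
    have := hlen z
    simp only [if_neg hxy, if_true]; split_ifs <;> omega
  · have hxy : x ≠ y := fun he => h0 (ha he)
    refine ⟨⟨rfl, .rfl, h.valid _ (by simp [hw]), fun _ => by simp [hw],
      fun p hp => absurd hp (not_fresh_self rfl p), fun he => absurd he hxy, ?_⟩, rfl⟩
    have := length_filter_ne h.nodup hw
    rw [if_neg hxy]; split_ifs <;> omega
  · have hxy : x ≠ y := fun he => h0 (ha he)
    have hv : ∀ t ∈ (x, a) :: (y, b) :: (z, c) :: (sorted M x y z L).map fun s => (s.1, s.2.2),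
        Valid M t.1 := by
      intro t ht
      apply h.valid
      simp only [List.mem_cons, List.mem_map, sorted] at ht ⊢
      rcases ht with rfl | rfl | rfl | ⟨_, ⟨w, hw, rfl⟩, rfl⟩ <;> simp
      exact .inr (.inr (.inr hw))
    have hr : (.inr M.steiner : Node n) ∉
        ((x, a) :: (y, b) :: (z, c) :: (sorted M x y z L).map fun s => (s.1, s.2.2)).map
          Prod.fst := by
      intro hm
      obtain ⟨t, ht, he⟩ := List.mem_map.1 hm
      exact (hv t ht).ne_next he
    have hs := steiner_addSteiner M x y z a b c (sorted M x y z L)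
    refine ⟨⟨?_, ⟨by omega, fun p q hp hq => ?_, fun hd p => ?_, fun p q hpq => ?_⟩, ?_, ?_, ?_,
      fun he => absurd he hxy, ?_⟩, hsub _ fun hm => ?_⟩
    · rw [addSteiner_eq, foldl_setDist_edge]
    · rw [addSteiner_eq, foldl_setDist_of_ne _ _ hp.ne_next hq.ne_next]
    · rw [addSteiner_eq]; exact foldl_setDist_diag _ { M with steiner := M.steiner + 1 } hr hd p
    · rw [addSteiner_eq, foldl_setDist_edge] at hpq; exact absurd rfl hpq
    · change M.steiner < _; omega
    · intro hlt; exact absurd rfl (hlt.ne_next)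
    · rintro (p | p) ⟨h1, h2⟩
      · exact absurd trivial h2
      · change p < _ at h1
        change ¬ p < _ at h2
        congr 1; omega
    · have := hlen (.inr M.steiner)
      rw [if_neg hxy, hs]; split_ifs <;> omega
    · exact (h.valid _ (by simp [hm])).ne_next rfl

/-! ### The recursive step on an arbitrary table of distances -/

/-- Only the zone of type two at an apex different from `r` involves both that apex and `r`. A
coincidence `x = y` forces `r = x` and is therefore excluded. -/
theorem zoneNode_zonePoints_apart {fuel : ℕ} {M M₁ : Memory n} {x y z r : Node n}
    {L : List (Node n)} (h : StepPre fuel M L x y z) (hP : Placed M x y z L M₁ r) :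
    ZonesApart r (zonePoints M x y z L r) (Zone.apex x y z r) := by
  have hx := h.x_notMem
  have hy := h.y_notMem
  have hz := h.z_notMem
  have hxz := h.xz
  have hyz := h.yz
  have hxy := hP.eq
  rintro q q' hq h2 hne ⟨h3, h4⟩
  have hr : r ∉ zonePoints M x y z L r q := fun hm => (mem_zonePoints.1 hm).2.1 rfl
  have hL : ∀ p, p ∈ zonePoints M x y z L r q → p ∈ L := fun p hm => (mem_zonePoints.1 hm).1
  have hv : q'.apex x y z r ∉ zonePoints M x y z L r q := fun hm => by
    have := hL _ hm
    cases q' <;> simp [Zone.isTwo] at h2 <;> simp only [Zone.apex] at this <;> contradiction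
  simp only [ZoneNode, hr, hv, false_or] at h3 h4
  cases q' <;> simp [Zone.isTwo] at h2 <;> cases q <;>
    simp [Zone.apex, Zone.isTwo] at h3 h4 hne hq <;> grind

theorem zonePre_zonePoints {fuel : ℕ} {M M₁ M₂ : Memory n} {x y z r : Node n}
    {L : List (Node n)} (h : StepPre (fuel + 1) M L x y z) (hP : Placed M x y z L M₁ r)
    {P : Node n → Prop} (hF : Frame M₁ M₂ P) (q : Zone) :
    ZonePre fuel M₂ r (zonePoints M x y z L r q) (q.apex x y z r) := by
  have hx := h.x_notMem
  have hy := h.y_notMem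
  have hz := h.z_notMem
  have hst := hP.frame.steiner.trans hF.steiner
  have hL : ∀ p, p ∈ zonePoints M x y z L r q → p ∈ L := fun p hm => (mem_zonePoints.1 hm).1
  refine ⟨?_, h.nodup.filter _, fun hm => ?_, fun hm => (mem_zonePoints.1 hm).2.1 rfl,
    fun p hp => ?_, hF.diag (hP.frame.diag h.diag)⟩
  · have := h.length
    exact (List.length_filter_le _ _).trans (by omega)
  · have h1 := mem_zonePoints.1 hm
    cases q <;> simp only [Zone.apex] at h1 <;> first | exact h1.2.1 rfl | (exact absurd h1.1 ‹_›)
  · have hr : Valid M₂ r := hP.valid.mono hF.steiner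
    have h' : ∀ p ∈ x :: y :: z :: L, Valid M₂ p := fun p hp => (h.valid p hp).mono hst
    simp only [List.mem_cons] at hp
    rcases hp with rfl | rfl | hp
    · cases q <;> first | exact hr | exact h' _ (by simp [Zone.apex])
    · exact hr
    · exact h' _ (by simp [hL p hp])

theorem frame_addStar (M : Memory n) (x y z r : Node n) (a b c : ℝ) :
    Frame M (M.addStar x y z r a b c) (· ∈ [x, y, z, r]) := by
  refine (((Frame.insertEdge M x r a).mono ?_).trans ((Frame.insertEdge _ y r b).mono ?_)).trans
    ((Frame.insertEdge _ z r c).mono ?_) <;> rintro p (rfl | rfl) <;> simp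

theorem addStar_edge (M : Memory n) (x y z r : Node n) (a b c : ℝ) {v : Node n}
    (hv : v ∈ [x, y, z]) : ((M.addStar x y z r a b c).edge s(v, r)).isSome := by
  simp only [List.mem_cons, List.not_mem_nil, or_false] at hv
  simp only [Memory.addStar, Memory.insertEdge]
  split_ifs with h1 h2 h3
  · rfl
  · rfl
  · rfl
  · rcases hv with rfl | rfl | rfl <;> contradiction

/-- The number of edges is one less than the number of distinct nodes in the list `x, y, z, L`, and
one more for each new Steiner node. Star and zones are joined through `r`. -/
theorem stepVal_grows (fuel : ℕ) (M : Memory n) (L : List (Node n)) (x y z : Node n)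
    (h : StepPre fuel M L x y z) :
    Grows M (stepVal fuel M L x y z) (x :: y :: z :: L) ((if x = y then 1 else 2) + L.length) := by
  induction fuel generalizing M L x y z with
  | zero => exact absurd h.length (by simp)
  | succ fuel ih =>
    -- The product `(x, z)_x` vanishes since the diagonal of the table does, so a repeated node is
    -- always chosen as `r`.
    have ha : x = y → product M y z x = 0 := by
      rintro rfl
      simp [product, h.diag]
    obtain ⟨hP, hS⟩ := place_spec h (b := product M x z y) (c := product M x y z) ha
    rw [stepVal]
    set a := product M y z x
    set b := product M x z y
    set c := product M x y z
    rw [hS]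
    simp only [zoneOf_filter_sorted]
    set M₁ := (place M x y z a b c (sorted M x y z L)).1
    set r := (place M x y z a b c (sorted M x y z L)).2.1
    have hF := frame_addStar M₁ x y z r a b c
    obtain ⟨f, j, t⟩ := processZones_grows ih (zoneNode_zonePoints_apart h hP) Zone.all
      (by decide) (M₁.addStar x y z r a b c) (fun q => zonePre_zonePoints h hP hF q)
      (fun q _ h2 _ => addStar_edge _ _ _ _ _ _ _ _ (by
        cases q <;> simp [Zone.isTwo] at h2 <;> simp [Zone.apex]))
    set M₂ := M₁.addStar x y z r a b c
    set M₃ := Zone.all.foldl (fun M' q => processZone (stepVal fuel) r q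
      (zonePoints M x y z L r q) (q.apex x y z r) M') M₂
    have hst₂ : M₂.steiner = M₁.steiner := rfl
    have hrf : r ∈ x :: y :: z :: L ∨ Fresh M M₃ r := by
      by_cases hr : Valid M r
      · exact .inl (hP.root hr)
      · exact .inr ⟨(hP.valid.mono hF.steiner).mono f.steiner, hr⟩
    have hmemL : ∀ {q p}, p ∈ zonePoints M x y z L r q → p ∈ L := fun hp => (mem_zonePoints.1 hp).1
    refine ⟨⟨hP.frame.steiner.trans (hF.steiner.trans f.steiner), fun p q hp hq => ?_,
      fun hd => f.diag (hF.diag (hP.frame.diag hd)), fun p q hpq => ?_⟩, fun R hR => ?_,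
      fun m hm => ?_⟩
    · rw [f.dist p q ((hp.mono hP.frame.steiner).mono hF.steiner)
        ((hq.mono hP.frame.steiner).mono hF.steiner), hF.dist p q (hp.mono hP.frame.steiner)
        (hq.mono hP.frame.steiner), hP.frame.dist p q hp hq]
    · by_cases he : M₃.edge s(p, q) = M₂.edge s(p, q)
      · rw [he, ← hP.edge] at hpq
        rcases hF.edge p q hpq with hp | hp
        · simp only [List.mem_cons, List.not_mem_nil, or_false] at hp
          rcases hp with rfl | rfl | rfl | rfl
          · simp
          · simp
          · simp
          · exact hrf
        · exact absurd hp (not_fresh_self hst₂ p)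
      · rcases f.edge p q he with ⟨q', -, hp⟩ | hp
        · rcases hp with rfl | hp | ⟨-, rfl⟩
          · cases q' <;> simp only [Zone.apex] <;> first | exact hrf | exact .inl (by simp)
          · exact .inl (by simp [hmemL hp])
          · exact hrf
        · exact .inr (hp.right (hP.frame.steiner.trans hF.steiner))
    · obtain ⟨s2, hj⟩ := j R hR
      obtain ⟨s1, hz⟩ := s2.of_insertEdge
      obtain ⟨s1, hy⟩ := s1.of_insertEdge
      obtain ⟨s1, hx⟩ := s1.of_insertEdge
      have hap : ∀ q : Zone, R (q.apex x y z r) r := by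
        intro q; cases q <;> first | exact R.refl _ | assumption
      have hall : ∀ p, p ∈ x :: y :: z :: L ∨ Fresh M M₃ p → R p r := by
        intro p hp
        have hp' : p ∈ [x, y, z, r] ∨ ((∃ q ∈ Zone.all, p ∈ zonePoints M x y z L r q) ∨
            Fresh M₂ M₃ p) := by
          by_cases hpr : p = r
          · simp [hpr]
          rcases hp with hp | hp
          · simp only [List.mem_cons] at hp ⊢
            rcases hp with rfl | rfl | rfl | hp
            · simp
            · simp
            · simp
            · refine .inr (.inl ⟨(classify M x y z p).val.1, ?_, mem_zonePoints.2 ⟨hp, hpr, rfl⟩⟩)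
              cases (classify M x y z p).val.1 <;> decide
          · rcases hp.cases (M₁ := M₁) with hp | hp
            · exact absurd (hP.fresh p hp) hpr
            · rcases hp.cases (M₁ := M₂) with hp | hp
              · exact absurd hp (not_fresh_self hst₂ p)
              · exact .inr (.inr hp)
        rcases hp' with hp | hp
        · simp only [List.mem_cons, List.not_mem_nil, or_false] at hp
          rcases hp with rfl | rfl | rfl | rfl
          · exact hx
          · exact hy
          · exact hz
          · exact R.refl _
        · obtain ⟨q, -, hq⟩ := hj p hp
          exact R.trans hq (hap q)
      refine ⟨fun p q hpq => s1 p q (by rwa [hP.edge]), fun p q hp hq =>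
        R.trans (hall p hp) (R.symm (hall q hq))⟩
    · have hm1 : EdgeBound M₁ m := by
        obtain ⟨F, h1, h2⟩ := hm
        exact ⟨F, h1, by rwa [hP.edge]⟩
      have := t _ (((hm1.insertEdge x r a).insertEdge y r b).insertEdge z r c)
      rw [sum_length_zonePoints] at this
      refine this.mono ?_
      have := hP.count
      have := f.steiner
      have := hP.frame.steiner
      omega

end TreeRep

/-! ### The running time -/

namespace Timed

theorem time_loop_le {α β : Type} {f : α → Timed (Option β)} {c : ℕ} (L : List α)
    (hf : ∀ a ∈ L, (f a).time + 1 ≤ c) : (loop f L).time ≤ c * L.length := by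
  induction L with
  | nil => simp [loop]
  | cons a l ih =>
    have h1 := hf a (by simp)
    have h2 := ih fun b hb => hf b (List.mem_cons_of_mem _ hb)
    simp only [loop, time_bind, time_tick, time_pure, List.length_cons, mul_add]
    omega

theorem length_block_le {α : Type} (K t : ℕ) (L : List α) :
    (block K t L).length ≤ L.length ⌈/⌉ K :=
  List.length_take_le _ _

theorem ceilDiv_mono_left (K : ℕ) {m N : ℕ} (h : m ≤ N) : m ⌈/⌉ K ≤ N ⌈/⌉ K := by
  rw [Nat.ceilDiv_eq_add_pred_div, Nat.ceilDiv_eq_add_pred_div]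
  exact Nat.div_le_div_right (by omega)

theorem mem_of_mem_block {α : Type} {K t : ℕ} {L : List α} {a : α} (h : a ∈ block K t L) :
    a ∈ L :=
  List.mem_of_mem_drop (List.mem_of_mem_take h)

theorem time_parallel_le {α β : Type} {K : ℕ} {thread : List α → Timed β} {L : List α} {T : ℕ}
    (h : ∀ t, (thread (block K t L)).time ≤ T) :
    (parallel K thread L).time ≤ T + (1 + Nat.clog 2 K) := by
  refine Nat.add_le_add_right ?_ _
  rw [List.map_map]
  induction List.range K with
  | nil => simp
  | cons t l ih => exact max_le (h t) ih

theorem time_parLoop_le {α β : Type} {K : ℕ} {f : α → Timed (Option β)} {c : ℕ} {L : List α}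
    (hf : ∀ a ∈ L, (f a).time + 1 ≤ c) :
    (parLoop K f L).time ≤ c * (L.length ⌈/⌉ K) + (1 + Nat.clog 2 K) := by
  have := time_parallel_le (K := K) (thread := loop f) (L := L) (T := c * (L.length ⌈/⌉ K))
    fun t => (time_loop_le _ fun a ha => hf a (mem_of_mem_block ha)).trans
      (Nat.mul_le_mul_left _ (length_block_le _ _ _))
  simpa [parLoop] using this

/-- Accumulates the cost of a sequence of programs in `c`, while keeping only what is needed about
each intermediate value. -/
theorem add_time_bind_le {α β : Type} {p : Timed α} {f : α → Timed β} {a c t : ℕ}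
    (h : p.time ≤ a) (h' : ∀ v, v = p.val → c + a + (f v).time ≤ t) : c + (p >>= f).time ≤ t := by
  have := h' _ rfl
  rw [time_bind]
  omega

/-- The time of a loop over `N` items whose iterations take one step each. -/
def unitTime (K N : ℕ) : ℕ := N ⌈/⌉ K + 1 + Nat.clog 2 K

theorem one_le_unitTime (K N : ℕ) : 1 ≤ unitTime K N := by
  unfold unitTime; omega

/-- As `c ≥ 1`, the thread overhead can be multiplied by `c` too, which makes every loop a multiple
of one quantity. -/
theorem time_parLoop_le_unitTime {α β : Type} {K N : ℕ}
    {f : α → Timed (Option β)} {c : ℕ} {L : List α} (hN : L.length ≤ N) (hc : 1 ≤ c)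
    (hf : ∀ a ∈ L, (f a).time + 1 ≤ c) : (parLoop K f L).time ≤ c * unitTime K N := by
  refine (time_parLoop_le hf).trans ?_
  have h1 : L.length ⌈/⌉ K ≤ N ⌈/⌉ K := ceilDiv_mono_left K hN
  have h2 := Nat.mul_le_mul_left c h1
  have h3 := Nat.mul_le_mul_right (1 + Nat.clog 2 K) hc
  unfold unitTime
  rw [add_assoc, mul_add]
  omega

end Timed

/-! ### Running times of the subroutines and of the recursion -/

namespace TreeRep

open Timed

variable {n : ℕ}

/-- Three Gromov products at `6` steps each, `10` comparisons, and one more access. -/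
theorem time_classify_le (M : Memory n) (x y z w : Node n) : (classify M x y z w).time ≤ 29 := by
  unfold classify
  simp only [time_bind, gromov, read, time_tick, time_pure]
  split_ifs <;> simp

theorem time_sortZones_le {K N : ℕ} (M : Memory n) (x y z : Node n)
    {L : List (Node n)} (hN : L.length ≤ N) :
    (sortZones K M x y z L).time ≤ 30 * unitTime K N := by
  refine time_parLoop_le_unitTime hN (by norm_num) fun w _ => ?_
  have := time_classify_le M x y z w
  simp only [time_bind, time_pure]
  omega

theorem time_zoneList_le {K N : ℕ} {S : List (Labelled n)} (hN : S.length ≤ N)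
    (q : Zone) : (zoneList K S q).time ≤ 2 * unitTime K N :=
  time_parLoop_le_unitTime hN (by norm_num) fun w _ => by simp

theorem time_placeSteiner_le {K N : ℕ} (M : Memory n) (x y z : Node n) (a b c : ℝ)
    {S : List (Labelled n)} (hN : S.length ≤ N) :
    (placeSteiner K M x y z a b c S).time ≤ 17 * unitTime K N := by
  have h1 := one_le_unitTime K N
  unfold placeSteiner
  simp only [time_bind, time_tick]
  split_ifs
  · simp only [time_pure]; omega
  · simp only [time_pure]; omega
  · simp only [time_pure]; omega
  · have h2 : (parLoop K (fun s : Labelled n => do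
        tick 2
        pure (if s.2.1 = Zone.r1 ∧ s.2.2 = 0 then some s.1 else none)) S).time ≤
        3 * unitTime K N :=
      time_parLoop_le_unitTime hN (by norm_num) fun w _ => by simp
    simp only [time_bind, time_tick]
    split
    · rename_i w _
      have h3 : (parLoop K (fun s : Labelled n => do
          tick 1
          pure (if s.1 = w then none else some s)) S).time ≤ 2 * unitTime K N :=
        time_parLoop_le_unitTime hN (by norm_num) fun w _ => by simp
      simp only [time_bind, time_pure]
      omega
    · have h3 : (parLoop K (fun _ : Node n × ℝ => do tick 2; pure (none : Option Unit))
          (S.map fun s => (s.1, s.2.2))).time ≤ 3 * unitTime K N :=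
        time_parLoop_le_unitTime (by simpa using hN) (by norm_num) fun w _ => by simp
      simp only [newSteiner, write, writeAll, time_bind, time_pure]
      omega

theorem length_place_le (M : Memory n) (x y z : Node n) (a b c : ℝ) (S : List (Labelled n)) :
    (place M x y z a b c S).2.2.length ≤ S.length := by
  unfold place
  split_ifs
  · exact le_rfl
  · exact le_rfl
  · exact le_rfl
  · split
    · exact List.length_filterMap_le _ _
    · exact le_rfl

theorem sum_length_zoneOf (S : List (Labelled n)) :
    (zoneOf S .r1).length + (zoneOf S .x1).length + (zoneOf S .y1).length +
      (zoneOf S .z1).length + (zoneOf S .x2).length + (zoneOf S .y2).length +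
      (zoneOf S .z2).length = S.length := by
  induction S with
  | nil => rfl
  | cons s S ih =>
    obtain ⟨w, q, d⟩ := s
    rcases q <;>
      simp only [zoneOf, List.filterMap_cons, reduceCtorEq, if_true, if_false,
        List.length_cons] at ih ⊢ <;> omega

/-- The recursive call receives two points fewer, so the summand `+ 1` in its bound is covered by
the points used up. -/
theorem time_zone1_le
    {step : Memory n → List (Node n) → Node n → Node n → Node n → Timed (Memory n)} {B N : ℕ}
    (hstep : ∀ M L x y z, L.length ≤ N → (step M L x y z).time ≤ (L.length + 1) * B)
    (M : Memory n) {L : List (Node n)} (hN : L.length ≤ N) (v : Node n) :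
    (zone1 step M L v).time ≤ 4 + L.length * B := by
  rcases L with _ | ⟨u, _ | ⟨z, L⟩⟩
  · simp [zone1]
  · simp only [zone1, read, addEdge, time_bind, time_tick]; omega
  · simp only [zone1, time_bind, time_tick]
    simp only [List.length_cons] at hN ⊢
    have := hstep M L v u z (by omega)
    have := Nat.mul_le_mul_right B (show L.length + 1 ≤ L.length + 1 + 1 by omega)
    omega

theorem time_closestSeq (M : Memory n) (v : Node n) (L : List (Node n)) :
    (closestSeq M v L).time = 3 * L.length := by
  induction L with
  | nil => rfl
  | cons w l ih =>
    simp only [closestSeq, time_bind, time_tick, time_pure, read, ih, List.length_cons]; omega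

theorem time_closest_le {K N : ℕ} (M : Memory n) (v : Node n) {L : List (Node n)}
    (hN : L.length ≤ N) : (closest K M v L).time ≤ 3 * unitTime K N := by
  have h1 : L.length ⌈/⌉ K ≤ N ⌈/⌉ K := ceilDiv_mono_left K hN
  have := time_parallel_le (K := K) (thread := closestSeq M v) (L := L) (T := 3 * (N ⌈/⌉ K))
    fun t => by
      rw [time_closestSeq]
      exact Nat.mul_le_mul_left _ ((length_block_le _ _ _).trans h1)
  simp only [closest, time_bind, time_pure]
  unfold unitTime
  omega

/-- The recursive call receives one point fewer, so its bound is at most `|L| * B`. The rest is the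
search and the removal of the closest point. -/
theorem time_zone2_le {K N : ℕ} (hK : 1 ≤ K)
    {step : Memory n → List (Node n) → Node n → Node n → Node n → Timed (Memory n)} {B : ℕ}
    (hstep : ∀ M L x y z, L.length ≤ N → (step M L x y z).time ≤ (L.length + 1) * B)
    (M : Memory n) {L : List (Node n)} (hN : L.length ≤ N) (u v : Node n) :
    (zone2 K step M L u v).time ≤ 7 * unitTime K N + L.length * B := by
  have h1 := one_le_unitTime K N
  have h2 := time_closest_le (K := K) M v hN
  unfold zone2
  simp only [time_bind, time_tick]
  split_ifs with hL
  · simp only [time_pure]; omega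
  · simp only [time_bind, val_closest hK]
    cases hc : closestOf M v L with
    | none => simp only [time_pure]; omega
    | some t =>
      obtain ⟨z, d⟩ := t
      have hz := mem_of_closestOf_eq_some hc
      have hlen : (L.filter (· ≠ z)).length < L.length :=
        List.length_filter_lt_length_iff_exists.2 ⟨z, hz, by simp⟩
      have h3 : (parLoop K (fun w : Node n => do
          tick 1
          pure (if w = z then none else some w)) L).time ≤ 2 * unitTime K N :=
        time_parLoop_le_unitTime hN (by norm_num) fun w _ => by simp
      have h4 : (parLoop K (fun w : Node n => do
          tick 1
          pure (if w = z then none else some w)) L).val = L.filter (· ≠ z) := by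
        simp only [val_parLoop hK, val_bind, val_pure, filterMap_ne_eq_filter]
      have h5 := hstep (deleteEdge M u v).val (L.filter (· ≠ z)) v u z (by omega)
      have h6 := Nat.mul_le_mul_right B (Nat.succ_le_of_lt hlen)
      simp only [time_bind, h4]
      simp only [deleteEdge] at h5 ⊢
      simp only [Nat.succ_eq_add_one] at h6
      omega

/-- Every point of `L` and the step itself are charged `120 * unitTime K N`. The loops of the step
cost `30 + 17 + 14 + 21 = 82` units (sorting, placing, lists, zones of type two), and the remaining
`37` steps are at most `37` units. -/
theorem time_recursiveStep_le {K : ℕ} (hK : 1 ≤ K) (N fuel : ℕ) (M : Memory n)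
    (L : List (Node n)) (x y z : Node n) (hN : L.length ≤ N) :
    (recursiveStep K fuel M L x y z).time ≤ (L.length + 1) * (120 * unitTime K N) := by
  induction fuel generalizing M L x y z with
  | zero => simp [recursiveStep]
  | succ fuel ih =>
    have h1 := one_le_unitTime K N
    have hg : ∀ p q w, (gromov M p q w).time ≤ 6 := fun _ _ _ => le_rfl
    have he : ∀ (M : Memory n) p q v, (addEdge M p q v).time ≤ 1 := fun _ _ _ _ => le_rfl
    rw [recursiveStep, ← zero_add (Timed.time _)]
    refine add_time_bind_le (hg _ _ _) fun a _ => add_time_bind_le (hg _ _ _) fun b _ =>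
      add_time_bind_le (hg _ _ _) fun c _ =>
      add_time_bind_le (time_sortZones_le M x y z hN) fun S hS => ?_
    rw [val_sortZones hK] at hS
    have hS : S.length = L.length := by simp [hS, sorted]
    refine add_time_bind_le (time_placeSteiner_le M x y z a b c (hS.trans_le hN)) fun P hP => ?_
    rw [val_placeSteiner hK] at hP
    have hP : P.2.2.length ≤ L.length := hP ▸ (length_place_le M x y z a b c S).trans_eq hS
    obtain ⟨M₁, r, S'⟩ := P
    dsimp only at hP ⊢
    have hz : ∀ q, (zoneList K S' q).time ≤ 2 * unitTime K N := fun q =>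
      time_zoneList_le (hP.trans hN) q
    refine add_time_bind_le (he _ _ _ _) fun M₂ _ => add_time_bind_le (he _ _ _ _) fun M₃ _ =>
      add_time_bind_le (he _ _ _ _) fun M₄ _ => add_time_bind_le (hz _) fun L₁ hL₁ =>
      add_time_bind_le (hz _) fun L₂ hL₂ => add_time_bind_le (hz _) fun L₃ hL₃ =>
      add_time_bind_le (hz _) fun L₄ hL₄ => add_time_bind_le (hz _) fun L₅ hL₅ =>
      add_time_bind_le (hz _) fun L₆ hL₆ => add_time_bind_le (hz _) fun L₇ hL₇ => ?_
    rw [val_zoneList hK] at hL₁ hL₂ hL₃ hL₄ hL₅ hL₆ hL₇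
    have hsum := sum_length_zoneOf S'
    rw [← hL₁, ← hL₂, ← hL₃, ← hL₄, ← hL₅, ← hL₆, ← hL₇] at hsum
    have h₁ := fun M v => time_zone1_le ih M (L := L₁) (by omega) v
    have h₂ := fun M v => time_zone1_le ih M (L := L₂) (by omega) v
    have h₃ := fun M v => time_zone1_le ih M (L := L₃) (by omega) v
    have h₄ := fun M v => time_zone1_le ih M (L := L₄) (by omega) v
    have h₅ := fun M u v => time_zone2_le hK ih M (L := L₅) (by omega) u v
    have h₆ := fun M u v => time_zone2_le hK ih M (L := L₆) (by omega) u v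
    have h₇ := fun M u v => time_zone2_le hK ih M (L := L₇) (by omega) u v
    refine add_time_bind_le (h₁ _ _) fun M₅ _ => add_time_bind_le (h₂ _ _) fun M₆ _ =>
      add_time_bind_le (h₃ _ _) fun M₇ _ => add_time_bind_le (h₄ _ _) fun M₈ _ =>
      add_time_bind_le (h₅ _ _ _) fun M₉ _ => add_time_bind_le (h₆ _ _ _) fun M₁₀ _ =>
      (Nat.add_le_add_left (h₇ _ _ _) _).trans ?_
    have ht := Nat.mul_le_mul_right (120 * unitTime K N) (hsum.trans_le hP)
    simp only [add_mul] at ht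
    rw [add_mul, one_mul]
    -- With the products as atoms the remaining inequality is linear.
    generalize L₁.length * (120 * unitTime K N) = l₁ at ht ⊢
    generalize L₂.length * (120 * unitTime K N) = l₂ at ht ⊢
    generalize L₃.length * (120 * unitTime K N) = l₃ at ht ⊢
    generalize L₄.length * (120 * unitTime K N) = l₄ at ht ⊢
    generalize L₅.length * (120 * unitTime K N) = l₅ at ht ⊢
    generalize L₆.length * (120 * unitTime K N) = l₆ at ht ⊢
    generalize L₇.length * (120 * unitTime K N) = l₇ at ht ⊢
    generalize L.length * (120 * unitTime K N) = l at ht ⊢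
    omega

theorem time_build_le {K : ℕ} (hK : 1 ≤ K) (M : Memory n) {L : List (Node n)}
    (hL : L.length ≤ n) : (build K M L).time ≤ 2 + n * (120 * unitTime K n) := by
  rcases L with _ | ⟨x, _ | ⟨y, _ | ⟨z, L⟩⟩⟩
  · simp [build]
  · simp [build]
  · simp only [build, read, addEdge, time_bind]; omega
  · simp only [List.length_cons] at hL
    have h1 := time_recursiveStep_le hK n n M L x y z (by omega)
    have h2 := Nat.mul_le_mul_right (120 * unitTime K n) (show L.length + 1 ≤ n by omega)
    simp only [build]
    omega

theorem time_tablePass_le {K : ℕ} (n : ℕ) :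
    (tablePass K n 2).time ≤ (4 * n + 1) * (2 * n ⌈/⌉ K) + (1 + Nat.clog 2 K) := by
  have := time_parLoop_le (K := K) (f := fun _ : ℕ => do
    tick (2 * (2 * n)); pure (none : Option Unit)) (c := 4 * n + 1) (L := List.range (2 * n))
    (fun a _ => by simp only [time_bind, time_tick, time_pure]; omega)
  simpa [tablePass] using this

/-- With `u = n / K` and `⌈m / K⌉ ≤ m / K + 1`, every term is a multiple of `n * u`, `n` or `n * log
K`. The constant `300` leaves room. -/
theorem time_treeRep_le {K : ℕ} (hK : 1 ≤ K) (hn : 1 ≤ n) (d : Fin n → Fin n → ℝ)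
    {order : List (Fin n)} (ho : order.length = n) :
    ((treeRep K d order).time : ℝ) ≤ 300 * ((n : ℝ) ^ 2 / K + n * (1 + Nat.clog 2 K)) := by
  have h1 := time_tablePass_le (K := K) n
  have h2 := time_build_le hK (initial d) (L := order.map Sum.inl) (by simp [ho])
  have h3 : (treeRep K d order).time ≤
      2 * ((4 * n + 1) * (2 * n ⌈/⌉ K) + (1 + Nat.clog 2 K)) +
        (2 + n * (120 * unitTime K n)) := by
    simp only [treeRep, time_bind, time_pure]
    omega
  have hK' : (0 : ℝ) < K := by exact_mod_cast hK
  have hn' : (1 : ℝ) ≤ n := by exact_mod_cast hn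
  have hceil : ∀ m : ℕ, ((m ⌈/⌉ K : ℕ) : ℝ) ≤ m / K + 1 := by
    intro m
    rw [Nat.ceilDiv_eq_add_pred_div]
    refine Nat.cast_div_le.trans ?_
    rw [Nat.cast_sub (by omega), Nat.cast_add, Nat.cast_one, div_add_one hK'.ne']
    gcongr
    linarith
  have h4 : ((treeRep K d order).time : ℝ) ≤
      2 * ((4 * n + 1) * ((2 * n ⌈/⌉ K : ℕ) : ℝ) + (1 + Nat.clog 2 K)) +
        (2 + n * (120 * (((n ⌈/⌉ K : ℕ) : ℝ) + 1 + Nat.clog 2 K))) := by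
    refine (Nat.cast_le.2 h3).trans (le_of_eq ?_)
    unfold unitTime
    push_cast
    ring
  have h5 := hceil (2 * n)
  have h6 := hceil n
  push_cast at h5
  have hl : (0 : ℝ) ≤ Nat.clog 2 K := Nat.cast_nonneg _
  set u : ℝ := (n : ℝ) / K with hu
  have h7 : (2 * n : ℝ) / K = 2 * u := by rw [hu]; ring
  have h8 : (n : ℝ) ^ 2 / K = n * u := by rw [hu]; ring
  have hu0 : 0 ≤ u := by positivity
  rw [h7] at h5
  rw [h8]
  have h9 : (4 * n + 1) * ((2 * n ⌈/⌉ K : ℕ) : ℝ) ≤ (4 * n + 1) * (2 * u + 1) := by gcongr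
  have h10 : (n : ℝ) * (120 * (((n ⌈/⌉ K : ℕ) : ℝ) + 1 + Nat.clog 2 K)) ≤
      n * (120 * (u + 1 + 1 + Nat.clog 2 K)) := by gcongr
  have h11 : u ≤ n * u := le_mul_of_one_le_left hu0 hn'
  have h12 : (Nat.clog 2 K : ℝ) ≤ n * Nat.clog 2 K := le_mul_of_one_le_left hl hn'
  nlinarith

end TreeRep

/-! ### Tree metrics -/

/-- `c` is between `a` and `b`. -/
def Between {Y : Type*} (D : Y → Y → ℝ) (a c b : Y) : Prop := D a b = D a c + D c b

/-- A pseudometric that satisfies the four point condition and has medians. -/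
structure IsTreeMetric {Y : Type*} (D : Y → Y → ℝ) : Prop where
  self : ∀ a, D a a = 0
  symm : ∀ a b, D a b = D b a
  fourPoint : ∀ a b c d, D a b + D c d ≤ max (D a c + D b d) (D a d + D b c)
  median : ∀ a b c, ∃ m, Between D a m b ∧ Between D b m c ∧ Between D a m c

namespace IsTreeMetric

variable {Y : Type*} {D : Y → Y → ℝ}

theorem triangle (hD : IsTreeMetric D) (a b c : Y) : D a c ≤ D a b + D b c := by
  have h := hD.fourPoint a c b b
  rw [hD.self, hD.symm c b, max_self] at h
  linarith

theorem nonneg (hD : IsTreeMetric D) (a b : Y) : 0 ≤ D a b := by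
  have h := hD.triangle a b a
  rw [hD.self, hD.symm b a] at h
  linarith

theorem between_symm (hD : IsTreeMetric D) {a b c : Y} (h : Between D a c b) :
    Between D b c a := by
  unfold Between at *
  rw [hD.symm b a, hD.symm b c, hD.symm c a]
  linarith

theorem between_left (hD : IsTreeMetric D) (a b : Y) : Between D a a b := by
  unfold Between; rw [hD.self]; ring

theorem between_right (hD : IsTreeMetric D) (a b : Y) : Between D a b b := by
  unfold Between; rw [hD.self]; ring

/-- A point between `a` and `b` separates every other point from `a` or from `b`. -/
theorem separates (hD : IsTreeMetric D) {a b c : Y} (h : Between D a c b) (w : Y) :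
    Between D a c w ∨ Between D w c b := by
  unfold Between at *
  have h1 := hD.triangle a c w
  have h2 := hD.triangle w c b
  have h3 := hD.symm w c
  have h4 := hD.symm w b
  have h5 := hD.symm c b
  rcases le_max_iff.1 (hD.fourPoint a b w c) with h6 | h6
  · left; linarith
  · right; linarith

/-- The side of `c` that contains `a` and `b` contains what lies between them. If `c` separated `m`
from both `a` and `b`, then `D c m = 0`. -/
theorem between_of_between (hD : IsTreeMetric D) {a b m c q : Y} (hm : Between D a m b)
    (ha : Between D a c q) (hb : Between D b c q) : Between D m c q := by
  rcases hD.separates ha m with h1 | h1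
  · rcases hD.separates hb m with h2 | h2
    · unfold Between at *
      have h3 := hD.triangle a c b
      have h4 := hD.triangle m c q
      have h5 := hD.triangle c m q
      have h6 := hD.symm c b
      have h7 := hD.symm c m
      have h8 := hD.symm m b
      have h9 := hD.nonneg c m
      linarith
    · exact h2
  · exact h1

/-- Tree metrics from ultrametric Gromov products at a base point. -/
theorem of_gromov {h : Y → ℝ} {Γ : Y → Y → ℝ} (hself : ∀ a, Γ a a = h a)
    (hsymm : ∀ a b, Γ a b = Γ b a) (hmin : ∀ a b c, min (Γ a b) (Γ b c) ≤ Γ a c)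
    (hcut : ∀ a t, t ≤ h a → ∃ m, h m = t ∧ ∀ b, Γ m b = min t (Γ a b)) :
    IsTreeMetric fun a b => h a + h b - 2 * Γ a b := by
  have hle : ∀ a b, Γ a b ≤ h a := by
    intro a b
    have := hmin a b a
    rwa [hsymm b a, min_self, hself] at this
  -- For the pair `a, b` with the largest product the two other products agree, and the median is
  -- the point at height `Γ a b` below `a`.
  have key : ∀ a b c, Γ a c ≤ Γ a b → Γ b c ≤ Γ a b →
      ∃ m, Between (fun a b => h a + h b - 2 * Γ a b) a m b ∧
        Between (fun a b => h a + h b - 2 * Γ a b) b m c ∧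
        Between (fun a b => h a + h b - 2 * Γ a b) a m c := by
    intro a b c h1 h2
    obtain ⟨m, hm, hm'⟩ := hcut a (Γ a b) (hle a b)
    have h3 := hm' a
    have h4 := hm' b
    have h5 := hm' c
    rw [hself, min_eq_left (hle a b)] at h3
    rw [min_self] at h4
    rw [min_eq_right h1] at h5
    have h6 := hmin a b c
    have h7 := hmin b a c
    rw [min_eq_right h2] at h6
    rw [hsymm b a, min_eq_right h1] at h7
    refine ⟨m, ?_, ?_, ?_⟩ <;> simp only [Between] <;> rw [hsymm _ m] <;> linarith
  have hsm : ∀ {a b c}, Between (fun a b => h a + h b - 2 * Γ a b) a b c →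
      Between (fun a b => h a + h b - 2 * Γ a b) c b a := by
    intro a b c hb
    simp only [Between] at *
    rw [hsymm c a, hsymm c b, hsymm b a]
    linarith
  refine ⟨fun a => by rw [hself]; ring, fun a b => by rw [hsymm]; ring, fun a b c d => ?_,
    fun a b c => ?_⟩
  · rw [le_max_iff]
    -- A counterexample has `Γ a b + Γ c d` smaller than both other sums. The ultrametric inequality
    -- bounds each of `Γ a b` and `Γ c d` below in two ways, and every combination is contradictory.
    by_contra hcon
    rw [not_or, not_le, not_le] at hcon
    obtain ⟨h1, h2⟩ := hcon
    have e1 := hmin a c b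
    have e2 := hmin a d b
    have e3 := hmin c a d
    have e4 := hmin c b d
    rw [hsymm c b] at e1
    rw [hsymm d b] at e2
    rw [hsymm c a] at e3
    rw [hsymm c b] at e4
    rw [min_le_iff] at e1 e2 e3 e4
    rcases e1 with e1 | e1 <;> rcases e2 with e2 | e2 <;> rcases e3 with e3 | e3 <;>
      rcases e4 with e4 | e4 <;> linarith
  · rcases le_total (Γ a b) (Γ a c) with h1 | h1
    · rcases le_total (Γ a c) (Γ b c) with h2 | h2
      · obtain ⟨m, m1, m2, m3⟩ := key b c a (by rw [hsymm b a]; linarith) (by rw [hsymm c a]; linarith)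
        exact ⟨m, hsm m3, m1, hsm m2⟩
      · obtain ⟨m, m1, m2, m3⟩ := key a c b h1 (by rw [hsymm c b]; linarith)
        exact ⟨m, m3, hsm m2, m1⟩
    · rcases le_total (Γ a b) (Γ b c) with h2 | h2
      · obtain ⟨m, m1, m2, m3⟩ := key b c a (by rw [hsymm b a]; linarith) (by rw [hsymm c a]; linarith)
        exact ⟨m, hsm m3, m1, hsm m2⟩
      · exact key a b c h1 h2

end IsTreeMetric

/-! ### Zero-hyperbolic spaces -/

theorem gromovProduct_le {X : Type*} [MetricSpace X] (x y w : X) :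
    gromovProduct x y w ≤ dist w x := by
  unfold gromovProduct
  have := dist_triangle w x y
  linarith

theorem gromovProduct_comm {X : Type*} [MetricSpace X] (x y w : X) :
    gromovProduct x y w = gromovProduct y x w := by
  unfold gromovProduct
  rw [dist_comm x y]
  ring

/-- Every zero-hyperbolic space is a subspace of a tree. -/
theorem IsHyperbolic.exists_isTreeMetric.{u} {X : Type u} [MetricSpace X] (hX : IsHyperbolic X 0)
    (o : X) : ∃ (Y : Type u) (D : Y → Y → ℝ) (f : X → Y), IsTreeMetric D ∧
      ∀ x y, D (f x) (f y) = dist x y := by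
  have hmin : ∀ x y z, min (gromovProduct x y o) (gromovProduct y z o) ≤ gromovProduct x z o := by
    intro x y z
    have := hX o x z y
    rwa [sub_zero, gromovProduct_comm z y] at this
  have hself : ∀ x, gromovProduct x x o = dist o x := by
    intro x; unfold gromovProduct; rw [dist_self]; ring
  -- The pair `(x, t)` is the point at height `t` on the segment from `o` to `x`. Segments agree up
  -- to height `(x, y)_o`, where points have distance `0` instead of being identified. Negative
  -- heights only prolong all segments beyond `o` by a common ray.
  refine ⟨{q : X × ℝ // q.2 ≤ dist o q.1}, _, fun x => ⟨(x, dist o x), le_rfl⟩,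
    IsTreeMetric.of_gromov (h := fun q => q.1.2)
      (Γ := fun p q => min (min p.1.2 q.1.2) (gromovProduct p.1.1 q.1.1 o)) ?_ ?_ ?_ ?_, ?_⟩
  · intro a
    rw [min_self, hself, min_eq_left a.2]
  · intro a b
    rw [min_comm a.1.2, gromovProduct_comm]
  · intro a b c
    have := hmin a.1.1 b.1.1 c.1.1
    simp only [le_min_iff, min_le_iff] at this ⊢
    refine ⟨⟨.inl (.inl (.inl le_rfl)), .inr (.inl (.inr le_rfl))⟩, ?_⟩
    rcases this with h | h
    · exact .inl (.inr h)
    · exact .inr (.inr h)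
  · intro a t ht
    refine ⟨⟨(a.1.1, t), ht.trans a.2⟩, rfl, fun b => ?_⟩
    dsimp only
    rw [← min_assoc, ← min_assoc, min_eq_left ht]
  · intro x y
    have h1 := gromovProduct_le x y o
    have h2 := gromovProduct_le y x o
    rw [gromovProduct_comm] at h2
    dsimp only
    rw [min_eq_right (le_min h1 h2)]
    unfold gromovProduct
    ring

/-! ### Weighted trees -/

namespace WeightedGraph

open SimpleGraph

variable {V : Type*} {T : WeightedGraph V}

theorem walkLength_append {u v w : V} (p : T.graph.Walk u v) (q : T.graph.Walk v w) :
    T.walkLength (p.append q) = T.walkLength p + T.walkLength q := by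
  simp [walkLength, Walk.edges_append]

theorem walkLength_reverse {u v : V} (p : T.graph.Walk u v) :
    T.walkLength p.reverse = T.walkLength p := by
  simp [walkLength, Walk.edges_reverse, List.sum_reverse]

theorem walkLength_nonneg (hT : ∀ e ∈ T.graph.edgeSet, 0 ≤ T.weight e) {u v : V}
    (p : T.graph.Walk u v) : 0 ≤ T.walkLength p := by
  refine List.sum_nonneg fun t ht => ?_
  obtain ⟨e, he, rfl⟩ := List.mem_map.1 ht
  exact hT e (p.edges_subset_edgeSet he)

theorem bddBelow_walkLength (hT : ∀ e ∈ T.graph.edgeSet, 0 ≤ T.weight e) (u v : V) :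
    BddBelow (Set.range fun p : T.graph.Walk u v => T.walkLength p) :=
  ⟨0, by rintro _ ⟨p, rfl⟩; exact walkLength_nonneg hT p⟩

theorem pathDist_le_walkLength (hT : ∀ e ∈ T.graph.edgeSet, 0 ≤ T.weight e) {u v : V}
    (p : T.graph.Walk u v) : T.pathDist u v ≤ T.walkLength p :=
  ciInf_le (bddBelow_walkLength hT u v) p

theorem sum_le_sum_of_sublist {l l' : List ℝ} (h : l.Sublist l') (h' : ∀ t ∈ l', 0 ≤ t) :
    l.sum ≤ l'.sum := by
  induction h with
  | slnil => exact le_rfl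
  | cons a _ ih =>
    rw [List.sum_cons]
    have h1 := h' a (by simp)
    have h2 := ih fun t ht => h' t (List.mem_cons_of_mem _ ht)
    linarith
  | cons_cons a _ ih =>
    rw [List.sum_cons, List.sum_cons]
    have h2 := ih fun t ht => h' t (List.mem_cons_of_mem _ ht)
    linarith

theorem walkLength_bypass_le [DecidableEq V] (hT : ∀ e ∈ T.graph.edgeSet, 0 ≤ T.weight e)
    {u v : V} (p : T.graph.Walk u v) : T.walkLength p.bypass ≤ T.walkLength p := by
  refine sum_le_sum_of_sublist (p.edges_bypass_sublist_edges.map _) fun t ht => ?_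
  obtain ⟨e, he, rfl⟩ := List.mem_map.1 ht
  exact hT e (p.edges_subset_edgeSet he)

namespace IsWeightedTree

theorem path_eq (hT : T.IsWeightedTree) {a b : V} {p q : T.graph.Walk a b} (hp : p.IsPath)
    (hq : q.IsPath) : p = q :=
  (hT.1.existsUnique_path a b).unique hp hq

theorem pathDist_eq (hT : T.IsWeightedTree) {u v : V} {p : T.graph.Walk u v} (hp : p.IsPath) :
    T.pathDist u v = T.walkLength p := by
  classical
  have : Nonempty (T.graph.Walk u v) := ⟨p⟩
  refine le_antisymm (pathDist_le_walkLength hT.2 p) (le_ciInf fun q => ?_)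
  -- Shortcutting any walk yields the unique path, and its edges are a sublist of those of the walk.
  rw [hT.path_eq hp q.bypass_isPath]
  exact walkLength_bypass_le hT.2 q

/-- `c` is on the path from `a` to `b`. -/
def OnPath (T : WeightedGraph V) (a c b : V) : Prop :=
  ∃ p : T.graph.Walk a b, p.IsPath ∧ c ∈ p.support

theorem exists_path (hT : T.IsWeightedTree) (a b : V) : ∃ p : T.graph.Walk a b, p.IsPath :=
  (hT.1.existsUnique_path a b).exists

theorem pathDist_symm (hT : T.IsWeightedTree) (a b : V) : T.pathDist a b = T.pathDist b a := by
  obtain ⟨p, hp⟩ := hT.exists_path a b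
  rw [hT.pathDist_eq hp, hT.pathDist_eq hp.reverse, walkLength_reverse]

theorem pathDist_self (hT : T.IsWeightedTree) (a : V) : T.pathDist a a = 0 := by
  rw [hT.pathDist_eq (Walk.IsPath.nil (u := a))]
  simp [walkLength]

theorem pathDist_triangle (hT : T.IsWeightedTree) (a b c : V) :
    T.pathDist a c ≤ T.pathDist a b + T.pathDist b c := by
  obtain ⟨p, hp⟩ := hT.exists_path a b
  obtain ⟨q, hq⟩ := hT.exists_path b c
  rw [hT.pathDist_eq hp, hT.pathDist_eq hq, ← walkLength_append]
  exact pathDist_le_walkLength hT.2 _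

theorem between_of_onPath (hT : T.IsWeightedTree) {a b c : V} (h : OnPath T a c b) :
    Between T.pathDist a c b := by
  classical
  obtain ⟨p, hp, hc⟩ := h
  unfold Between
  rw [hT.pathDist_eq hp, hT.pathDist_eq (hp.takeUntil hc), hT.pathDist_eq (hp.dropUntil hc),
    ← walkLength_append, Walk.take_spec]

/-- The path from `a` to `b` is the shortcut of the walk from `a` through `w` to `b`, so `c` is on
one of the two halves. -/
theorem onPath_separates (hT : T.IsWeightedTree) {a b c : V} (h : OnPath T a c b) (w : V) :
    OnPath T a c w ∨ OnPath T w c b := by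
  classical
  obtain ⟨p, hp, hc⟩ := h
  obtain ⟨q, hq⟩ := hT.exists_path a w
  obtain ⟨r, hr⟩ := hT.exists_path w b
  rw [hT.path_eq hp (q.append r).bypass_isPath] at hc
  have := (q.append r).support_bypass_subset_support hc
  rw [Walk.mem_support_append_iff] at this
  exact this.imp (fun h => ⟨q, hq, h⟩) fun h => ⟨r, hr, h⟩

theorem onPath_symm {a b c : V} (h : OnPath T a c b) : OnPath T b c a := by
  obtain ⟨p, hp, hc⟩ := h
  exact ⟨p.reverse, hp.reverse, by simpa using hc⟩

/-- The walk is stopped at its first visit to `S`. -/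
theorem _root_.SimpleGraph.Walk.exists_walk_to_set {G : SimpleGraph V} {S : Set V} {z x : V}
    (w : G.Walk z x) (hx : x ∈ S) :
    ∃ m ∈ S, ∃ q : G.Walk z m, ∀ c ∈ q.support, c ∈ S → c = m := by
  induction w with
  | nil => exact ⟨_, hx, .nil, fun c hc _ => by simpa using hc⟩
  | @cons u v t h p ih =>
    by_cases hu : u ∈ S
    · exact ⟨u, hu, .nil, fun c hc _ => by simpa using hc⟩
    · obtain ⟨m, hm, q, hq⟩ := ih hx
      refine ⟨m, hm, .cons h q, fun c hc hcS => ?_⟩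
      rw [Walk.support_cons, List.mem_cons] at hc
      rcases hc with rfl | hc
      · exact absurd hcS hu
      · exact hq c hc hcS

theorem onPath_append {z m x : V} {q : T.graph.Walk z m}
    {p : T.graph.Walk m x} (hq : q.IsPath) (hp : p.IsPath)
    (h : ∀ c ∈ q.support, c ∈ p.support → c = m) : OnPath T z m x := by
  refine ⟨q.append p, ?_, by simp⟩
  rw [Walk.isPath_def, Walk.support_append, List.nodup_append]
  refine ⟨hq.support_nodup, hp.support_nodup.tail, ?_⟩
  rintro c hc d hd rfl
  obtain rfl := h c hc (List.mem_of_mem_tail hd)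
  have := hp.support_nodup
  rw [← Walk.cons_tail_support, List.nodup_cons] at this
  exact this.1 hd

/-- The median is the point where a walk from `z` first meets the path from `x` to `y`. -/
theorem exists_median (hT : T.IsWeightedTree) (x y z : V) :
    ∃ m, OnPath T x m y ∧ OnPath T y m z ∧ OnPath T x m z := by
  classical
  obtain ⟨p, hp⟩ := hT.exists_path x y
  obtain ⟨w, -⟩ := hT.exists_path z x
  obtain ⟨m, hm, q, hq⟩ := w.exists_walk_to_set (S := {c | c ∈ p.support}) p.start_mem_support
  have hq' : ∀ c ∈ q.bypass.support, c ∈ p.support → c = m := fun c hc =>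
    hq c (q.support_bypass_subset_support hc)
  refine ⟨m, ⟨p, hp, hm⟩, onPath_symm (onPath_append q.bypass_isPath (hp.dropUntil hm)
    fun c hc hc' => hq' c hc (p.support_dropUntil_subset_support hm hc')),
    onPath_symm (onPath_append q.bypass_isPath (hp.takeUntil hm).reverse fun c hc hc' =>
      hq' c hc (p.support_takeUntil_subset_support hm (by simpa using hc')))⟩

/-- The shortest path metric of a weighted tree is a tree metric. -/
theorem isTreeMetric (hT : T.IsWeightedTree) : IsTreeMetric T.pathDist := by
  refine ⟨hT.pathDist_self, hT.pathDist_symm, fun a b c d => ?_, fun a b c => ?_⟩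
  · obtain ⟨m, m1, m2, m3⟩ := hT.exists_median a b c
    have e1 := hT.between_of_onPath m1
    have e2 := hT.between_of_onPath m2
    have e3 := hT.between_of_onPath m3
    have s1 := (hT.onPath_separates m1 d).imp hT.between_of_onPath hT.between_of_onPath
    have s2 := (hT.onPath_separates m2 d).imp hT.between_of_onPath hT.between_of_onPath
    have s3 := (hT.onPath_separates m3 d).imp hT.between_of_onPath hT.between_of_onPath
    have t1 := hT.pathDist_triangle a m d
    have t2 := hT.pathDist_triangle b m d
    have t3 := hT.pathDist_triangle c m d
    unfold Between at *
    rw [hT.pathDist_symm d b, hT.pathDist_symm d m] at s1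
    rw [hT.pathDist_symm d c, hT.pathDist_symm d m] at s2 s3
    have y1 := hT.pathDist_symm m b
    have y2 := hT.pathDist_symm m c
    rw [le_max_iff]
    by_contra hcon
    rw [not_or, not_le, not_le] at hcon
    rcases s1 with s1 | s1 <;> rcases s2 with s2 | s2 <;> rcases s3 with s3 | s3 <;> linarith
  · obtain ⟨m, m1, m2, m3⟩ := hT.exists_median a b c
    exact ⟨m, hT.between_of_onPath m1, hT.between_of_onPath m2, hT.between_of_onPath m3⟩

end IsWeightedTree

end WeightedGraph

namespace TreeRep

open Timed

variable {n : ℕ} {Y : Type*} {D : Y → Y → ℝ}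

/-! ### Zones in a tree -/

/-- The position of a point of each zone, if `m` is the median of `x, y, z`. -/
def InZone (D : Y → Y → ℝ) (x y z m w : Y) : Zone → Prop
  | .r1 => Between D w m x ∧ Between D w m y ∧ Between D w m z
  | .x1 => ¬ Between D w m x ∧ Between D w m y ∧ Between D w m z ∧ Between D w x m
  | .y1 => Between D w m x ∧ ¬ Between D w m y ∧ Between D w m z ∧ Between D w y m
  | .z1 => Between D w m x ∧ Between D w m y ∧ ¬ Between D w m z ∧ Between D w z m
  | .x2 => ¬ Between D w m x ∧ Between D w m y ∧ Between D w m z ∧ ¬ Between D w x m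
  | .y2 => Between D w m x ∧ ¬ Between D w m y ∧ Between D w m z ∧ ¬ Between D w y m
  | .z2 => Between D w m x ∧ Between D w m y ∧ ¬ Between D w m z ∧ ¬ Between D w z m

theorem max_three_cases {a b c : ℝ} (ha : ¬ a = max a (max b c)) (hb : ¬ b = max a (max b c)) :
    a ≤ c ∧ b ≤ c := by
  rcases le_total a b with h1 | h1 <;> rcases le_total b c with h2 | h2 <;>
    rcases le_total a c with h3 | h3 <;> simp_all

/-- The stored distances of distinct nodes in `A` are those of their positions, and positive. -/
def Fits (D : Y → Y → ℝ) (g : Node n → Y) (M : Memory n) (A : Node n → Prop) : Prop :=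
  ∀ p q, A p → A q → p ≠ q → M.dist p q = D (g p) (g q) ∧ 0 < D (g p) (g q)

/-- The distance to the median is the largest Gromov product. -/
theorem products_median (hD : IsTreeMetric D) {x y z m : Y} (hxy : Between D x m y)
    (hyz : Between D y m z) (hxz : Between D x m z) (w : Y) :
    (D w x + D w y - D x y) / 2 ≤ D w m ∧ (D w y + D w z - D y z) / 2 ≤ D w m ∧
    (D w z + D w x - D z x) / 2 ≤ D w m ∧
    (D w m = (D w x + D w y - D x y) / 2 ∨ D w m = (D w y + D w z - D y z) / 2 ∨
      D w m = (D w z + D w x - D z x) / 2) := by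
  have s1 := hD.separates hxy w
  have s2 := hD.separates hyz w
  have s3 := hD.separates hxz w
  have t1 := hD.triangle w m x
  have t2 := hD.triangle w m y
  have t3 := hD.triangle w m z
  unfold Between at *
  rw [hD.symm x w, hD.symm x m, hD.symm m w] at s1 s3
  rw [hD.symm y w, hD.symm y m, hD.symm m w] at s2
  rw [hD.symm x m] at hxy hxz
  rw [hD.symm y m] at hyz
  rw [hD.symm z x]
  refine ⟨by linarith, by linarith, by linarith, ?_⟩
  -- The median separates `w` from at least two of `x, y, z`, and the product of these two is the
  -- distance to the median.
  rcases s1 with s1 | s1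
  · rcases s2 with s2 | s2
    · left; linarith
    · right; right; linarith
  · rcases s3 with s3 | s3
    · left; linarith
    · right; left; linarith

/-- The classification of points is correct. -/
theorem classify_spec (hD : IsTreeMetric D) {g : Node n → Y} {M : Memory n} {x y z w : Node n}
    {m : Y} (hM : Fits D g M (· ∈ [x, y, z, w])) (hx : x ≠ y) (hy : y ≠ z) (hz : x ≠ z)
    (hwx : w ≠ x) (hwy : w ≠ y) (hwz : w ≠ z) (hxy : Between D (g x) m (g y))
    (hyz : Between D (g y) m (g z)) (hxz : Between D (g x) m (g z)) :
    (classify M x y z w).val.2 = D (g w) m ∧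
    InZone D (g x) (g y) (g z) m (g w) (classify M x y z w).val.1 ∧
    (D (g w) m = 0 → (classify M x y z w).val = (.r1, 0)) := by
  obtain ⟨p1, p2, p3, p4⟩ := products_median hD hxy hyz hxz (g w)
  have n1 := hD.triangle (g x) (g w) (g y)
  have n2 := hD.triangle (g y) (g w) (g z)
  have n3 := hD.triangle (g z) (g w) (g x)
  rw [hD.symm (g x) (g w)] at n1
  rw [hD.symm (g y) (g w)] at n2
  rw [hD.symm (g z) (g w)] at n3
  have s1 := hD.separates hxy (g w)
  have s2 := hD.separates hyz (g w)
  have s3 := hD.separates hxz (g w)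
  have t1 := hD.triangle (g w) m (g x)
  have t2 := hD.triangle (g w) m (g y)
  have t3 := hD.triangle (g w) m (g z)
  unfold Between at s1 s2 s3 hxy hyz hxz
  rw [hD.symm (g x) (g w), hD.symm (g x) m, hD.symm m (g w)] at s1 s3
  rw [hD.symm (g y) (g w), hD.symm (g y) m, hD.symm m (g w)] at s2
  rw [hD.symm (g x) m] at hxy hxz
  rw [hD.symm (g y) m] at hyz
  have e1 := (hM w x (by simp) (by simp) hwx).1
  have e2 := (hM w y (by simp) (by simp) hwy).1
  have e3 := (hM w z (by simp) (by simp) hwz).1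
  have e4 := (hM x y (by simp) (by simp) hx).1
  have e5 := (hM y z (by simp) (by simp) hy).1
  have e6 := (hM z x (by simp) (by simp) hz.symm).1
  have e7 := hD.symm (g z) (g x)
  have e8 := hD.symm (g x) m
  have e9 := hD.symm (g y) m
  have e10 := hD.symm (g z) m
  simp only [classify, val_bind, val_gromov, product, read, e1, e2, e3, e4, e5, e6]
  generalize hA : (D (g w) (g x) + D (g w) (g y) - D (g x) (g y)) / 2 = A at *
  generalize hB : (D (g w) (g y) + D (g w) (g z) - D (g y) (g z)) / 2 = B at *
  generalize hC : (D (g w) (g z) + D (g w) (g x) - D (g z) (g x)) / 2 = C at *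
  split_ifs with h1 h2 h3
  · obtain ⟨h1, h2⟩ := h1
    simp only [val_pure, InZone, Between, Prod.mk.injEq, true_and]
    refine ⟨?_, ⟨?_, ?_, ?_⟩, fun h0 => ?_⟩ <;>
      rcases s1 with s1 | s1 <;> rcases s2 with s2 | s2 <;> rcases s3 with s3 | s3 <;> linarith
  all_goals
    have h0 : D (g w) m ≠ 0 := fun h0 => h1 ⟨by linarith, by linarith⟩
    rw [not_and_or] at h1
  · have hBA : B ≤ A := h2 ▸ (le_max_left _ _).trans (le_max_right _ _)
    have hCA : C ≤ A := h2 ▸ (le_max_right _ _).trans (le_max_right _ _)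
    have hAm : A = D (g w) m := by rcases p4 with p4 | p4 | p4 <;> linarith
    -- If `m` also separated `w` from `z`, all three products would be equal.
    have hz : ¬ D (g w) (g z) = D (g w) m + D m (g z) := fun h => by
      rcases h1 with h1 | h1 <;> apply h1 <;> linarith
    simp only [val_bind, val_pure]
    refine ⟨hAm, ?_, fun h => absurd h h0⟩
    -- As `m` is between `w` and `y`, the product `B` is `(D w m + D w z - D m z) / 2`, which equals
    -- `D w z` exactly when `z` is between `w` and `m`. The same holds for `C`.
    split_ifs with h4 <;> simp only [InZone, Between]
    · refine ⟨by linarith, by linarith, hz, ?_⟩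
      rcases h4 with h4 | h4 <;> linarith
    · refine ⟨by linarith, by linarith, hz, fun h => h4 (.inl (by linarith))⟩
  · have hAB : A ≤ B := h3 ▸ le_max_left _ _
    have hCB : C ≤ B := h3 ▸ (le_max_right _ _).trans (le_max_right _ _)
    have hBm : B = D (g w) m := by rcases p4 with p4 | p4 | p4 <;> linarith
    have hx : ¬ D (g w) (g x) = D (g w) m + D m (g x) := fun h => by
      rcases h1 with h1 | h1 <;> apply h1 <;> linarith
    simp only [val_bind, val_pure]
    refine ⟨hBm, ?_, fun h => absurd h h0⟩
    split_ifs with h4 <;> simp only [InZone, Between]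
    · refine ⟨hx, by linarith, by linarith, ?_⟩
      rcases h4 with h4 | h4 <;> linarith
    · refine ⟨hx, by linarith, by linarith, fun h => h4 (.inl (by linarith))⟩
  · obtain ⟨hAC, hBC⟩ := max_three_cases h2 h3
    have hCm : C = D (g w) m := by rcases p4 with p4 | p4 | p4 <;> linarith
    have hy : ¬ D (g w) (g y) = D (g w) m + D m (g y) := fun h => by
      rcases h1 with h1 | h1 <;> apply h1 <;> linarith
    simp only [val_bind, val_pure]
    refine ⟨hCm, ?_, fun h => absurd h h0⟩
    split_ifs with h4 <;> simp only [InZone, Between]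
    · refine ⟨by linarith, hy, by linarith, ?_⟩
      rcases h4 with h4 | h4 <;> linarith
    · refine ⟨by linarith, hy, by linarith, fun h => h4 (.inl (by linarith))⟩

/-! ### Positions of the nodes -/

/-- All edges are between valid nodes, and their weights are the distances of the positions of their
ends, which are positive. -/
structure Realizes (D : Y → Y → ℝ) (g : Node n → Y) (M : Memory n) : Prop where
  valid : ValidEdges M
  weight : ∀ p q w, M.edge s(p, q) = some w → w = D (g p) (g q) ∧ (p ≠ q → 0 < w)

/-- A symmetric function that satisfies the triangle inequality and vanishes on the diagonal. -/
structure IsPseudo (ρ : Node n → Node n → ℝ) : Prop where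
  self : ∀ p, ρ p p = 0
  symm : ∀ p q, ρ p q = ρ q p
  triangle : ∀ p q t, ρ p t ≤ ρ p q + ρ q t

/-- `ρ` is at most the weight on every edge. -/
def Below (ρ : Node n → Node n → ℝ) (M : Memory n) : Prop :=
  ∀ p q w, M.edge s(p, q) = some w → ρ p q ≤ w

theorem Realizes.insertEdge (hD : IsTreeMetric D) {g : Node n → Y} {M : Memory n}
    (h : Realizes D g M) {p q : Node n} {v : ℝ} (hp : Valid M p) (hq : Valid M q)
    (hv : v = D (g p) (g q)) (hpos : p ≠ q → 0 < v) : Realizes D g (M.insertEdge p q v) := by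
  refine ⟨fun a b hab => ?_, fun a b w hab => ?_⟩
  · by_cases he : s(a, b) = s(p, q)
    · rcases Sym2.eq_iff.1 he with ⟨rfl, rfl⟩ | ⟨rfl, rfl⟩
      · exact hp
      · exact hq
    · exact h.valid a b (by simpa [Memory.insertEdge, he] using hab)
  · by_cases he : s(a, b) = s(p, q)
    · obtain rfl : v = w := by simpa [Memory.insertEdge, he] using hab
      rcases Sym2.eq_iff.1 he with ⟨rfl, rfl⟩ | ⟨rfl, rfl⟩
      · exact ⟨hv, hpos⟩
      · exact ⟨by rw [hv, hD.symm], fun hne => hpos hne.symm⟩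
    · exact h.weight a b w (by simpa [Memory.insertEdge, he] using hab)

theorem Realizes.eraseEdge {g : Node n → Y} {M : Memory n} (h : Realizes D g M) (p q : Node n) :
    Realizes D g (M.eraseEdge p q) := by
  have key : ∀ a b w, (M.eraseEdge p q).edge s(a, b) = some w → M.edge s(a, b) = some w := by
    intro a b w hab
    simp only [Memory.eraseEdge] at hab
    split_ifs at hab
    exact hab
  refine ⟨fun a b hab => ?_, fun a b w hab => h.weight a b w (key a b w hab)⟩
  obtain ⟨w, hw⟩ := Option.isSome_iff_exists.1 hab
  exact h.valid a b (by rw [key a b w hw]; rfl)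

/-- An overwritten edge causes no loss: by `Realizes` its old weight was the distance of the
positions as well. -/
theorem Below.of_insertEdge {g : Node n → Y} {M : Memory n} (h : Realizes D g M)
    {ρ : Node n → Node n → ℝ} (hD : IsTreeMetric D) (hρ : IsPseudo ρ) {p q : Node n} {v : ℝ}
    (hv : v = D (g p) (g q)) (hb : Below ρ (M.insertEdge p q v)) :
    Below ρ M ∧ ρ p q ≤ D (g p) (g q) := by
  have hpq : ρ p q ≤ D (g p) (g q) := hv ▸ hb p q v (by simp [Memory.insertEdge])
  refine ⟨fun a b w hab => ?_, hpq⟩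
  by_cases he : s(a, b) = s(p, q)
  · obtain ⟨hw, -⟩ := h.weight a b w hab
    rcases Sym2.eq_iff.1 he with ⟨rfl, rfl⟩ | ⟨rfl, rfl⟩
    · rwa [hw]
    · rwa [hw, hρ.symm, hD.symm]
  · exact hb a b w (by simpa [Memory.insertEdge, he] using hab)

theorem Below.of_eraseEdge {g : Node n → Y} {M : Memory n} (h : Realizes D g M)
    {ρ : Node n → Node n → ℝ} (hD : IsTreeMetric D) (hρ : IsPseudo ρ) {p q : Node n}
    (hb : Below ρ (M.eraseEdge p q)) (hpq : ρ p q ≤ D (g p) (g q)) : Below ρ M := by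
  intro a b w hab
  by_cases he : s(a, b) = s(p, q)
  · obtain ⟨hw, -⟩ := h.weight a b w hab
    rcases Sym2.eq_iff.1 he with ⟨rfl, rfl⟩ | ⟨rfl, rfl⟩
    · rwa [hw]
    · rwa [hw, hρ.symm, hD.symm]
  · exact hb a b w (by simpa [Memory.eraseEdge, he] using hab)

/-- A part of the algorithm that takes `M` to `M'` builds a tree that realizes the distances of the
positions of the nodes in `P` and of the new Steiner nodes. -/
structure Builds (D : Y → Y → ℝ) (g : Node n → Y) (M : Memory n) (g' : Node n → Y)
    (M' : Memory n) (P : Node n → Prop) : Prop where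
  agree : ∀ p, Valid M p → g' p = g p
  realizes : Realizes D g' M'
  -- The path metric is the largest pseudometric below the edge weights, so this bounds it by `D`
  -- without mentioning walks in a graph that is still changing.
  below : ∀ ρ, IsPseudo ρ → Below ρ M' → Below ρ M ∧
    ∀ p q, P p ∨ Fresh M M' p → P q ∨ Fresh M M' q → ρ p q ≤ D (g' p) (g' q)
  -- New Steiner nodes stay on the side of `a` on which all of `P` is, so whatever separates zones
  -- separates the nodes created inside them.
  hull : ∀ s, Fresh M M' s → ∀ a b, (∀ p, P p → Between D (g p) a b) → Between D (g' s) a b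

theorem Fits.mono {g : Node n → Y} {M : Memory n} {A B : Node n → Prop} (h : Fits D g M A)
    (hBA : ∀ p, B p → A p) : Fits D g M B :=
  fun p q hp hq => h p q (hBA p hp) (hBA q hq)

theorem Fits.of_frame {g g' : Node n → Y} {M M' : Memory n} {A P : Node n → Prop}
    (h : Fits D g M A) (hA : ∀ p, A p → Valid M p) (hF : Frame M M' P)
    (hg : ∀ p, Valid M p → g' p = g p) : Fits D g' M' A := by
  intro p q hp hq hpq
  rw [hF.dist p q (hA p hp) (hA q hq), hg p (hA p hp), hg q (hA q hq)]
  exact h p q hp hq hpq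

/-- The recursive step builds the right tree for every list of length less than `fuel`. -/
def StepBuilds (D : Y → Y → ℝ) (n fuel : ℕ) : Prop :=
  ∀ (g : Node n → Y) M L x y z, StepPre fuel M L x y z → x ≠ y →
    Fits D g M (· ∈ x :: y :: z :: L) → Realizes D g M →
    ∃ g', Builds D g M g' (stepVal fuel M L x y z) (· ∈ x :: y :: z :: L)

/-- Unlike in `processZone_grows`, a nonempty zone of type two needs `v ≠ r` here, since
`StepBuilds` is about distinct `x` and `y`. -/
theorem processZone_builds (hD : IsTreeMetric D) {fuel : ℕ} (hstep : StepBuilds D n fuel)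
    {g : Node n → Y} {M : Memory n} {r : Node n} {q : Zone} {L : List (Node n)} {v : Node n}
    (h : ZonePre fuel M r L v) (hL : q.isTwo = true → v = r → L = [])
    (he : q.isTwo = true → v ≠ r → (M.edge s(v, r)).isSome)
    (hM : Fits D g M (ZoneNode r q L v)) (hR : Realizes D g M) :
    ∃ g', Builds D g M g' (processZone (stepVal fuel) r q L v M) (ZoneNode r q L v) := by
  unfold processZone
  split_ifs with hq
  · have hn : ∀ {p}, ZoneNode r q L v p ↔ p = v ∨ p ∈ L ∨ p = r := by simp [ZoneNode, hq]
    unfold zone2Val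
    cases hc : closestOf M r L with
    | none =>
      rw [closestOf_eq_none_iff] at hc
      subst hc
      refine ⟨g, fun _ _ => rfl, hR, fun ρ hρ hb => ⟨hb, fun p t hp ht => ?_⟩,
        fun s hs => absurd hs (not_fresh_self rfl s)⟩
      have hvr : ρ v r ≤ D (g v) (g r) := by
        by_cases hvr : v = r
        · rw [hvr, hρ.self, hD.self]
        · obtain ⟨w, hw⟩ := Option.isSome_iff_exists.1 (he hq hvr)
          rw [← (hR.weight v r w hw).1]
          exact hb v r w hw
      have hp := hn.1 (hp.resolve_right (not_fresh_self rfl p))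
      have ht := hn.1 (ht.resolve_right (not_fresh_self rfl t))
      simp only [List.not_mem_nil, false_or] at hp ht
      rcases hp with rfl | rfl <;> rcases ht with rfl | rfl
      · rw [hρ.self, hD.self]
      · exact hvr
      · rwa [hρ.symm, hD.symm]
      · rw [hρ.self, hD.self]
    | some t =>
      obtain ⟨z, d⟩ := t
      have hz : z ∈ L := mem_of_closestOf_eq_some hc
      have hvr : v ≠ r := by
        rintro hvr
        rw [hL hq hvr] at hz
        simp at hz
      have hn' : ∀ {p}, ZoneNode r q L v p ↔ p ∈ r :: v :: z :: L.filter (· ≠ z) := by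
        intro p
        rw [hn]
        simp only [List.mem_cons, List.mem_filter, decide_eq_true_eq]
        by_cases hpz : p = z
        · simp [hpz, hz]
        · simp [hpz]; tauto
      simp only [filterMap_ne_eq_filter]
      have hM' : Fits D g (M.eraseEdge v r) (· ∈ r :: v :: z :: L.filter (· ≠ z)) :=
        hM.mono fun p hp => hn'.2 hp
      obtain ⟨g', b1, b2, b3, b4⟩ :=
        hstep g _ _ _ _ _ (h.stepPre_two hz) hvr.symm hM' (hR.eraseEdge v r)
      refine ⟨g', b1, b2, fun ρ hρ hb => ?_, fun s hs a b hab =>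
        b4 s hs a b fun p hp => hab p (hn'.2 hp)⟩
      obtain ⟨c1, c2⟩ := b3 ρ hρ hb
      refine ⟨Below.of_eraseEdge hR hD hρ c1 ?_, fun p t hp ht =>
        c2 p t (hp.imp_left hn'.1) (ht.imp_left hn'.1)⟩
      -- The rebuilt part bounds `ρ v r` by the distance of the positions, which restores the bound
      -- for the deleted edge.
      have := c2 v r (by simp) (by simp)
      rwa [b1 v (h.valid v (by simp)), b1 r (h.valid r (by simp))] at this
  · have hn : ∀ {p}, ZoneNode r q L v p ↔ p = v ∨ p ∈ L := by simp [ZoneNode, hq]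
    rcases L with _ | ⟨u, _ | ⟨z, L⟩⟩
    · refine ⟨g, fun _ _ => rfl, hR, fun ρ hρ hb => ⟨hb, fun p t hp ht => ?_⟩,
        fun s hs => absurd hs (not_fresh_self rfl s)⟩
      have hp := hn.1 (hp.resolve_right (not_fresh_self rfl p))
      have ht := hn.1 (ht.resolve_right (not_fresh_self rfl t))
      simp only [List.not_mem_nil, or_false] at hp ht
      rw [hp, ht, hρ.self, hD.self]
    · have huv : u ≠ v := by rintro rfl; exact h.apex_notMem (by simp)
      obtain ⟨d1, d2⟩ := hM u v (hn.2 (by simp)) (hn.2 (by simp)) huv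
      refine ⟨g, fun _ _ => rfl, hR.insertEdge hD (h.valid u (by simp)) (h.valid v (by simp)) d1
        fun _ => d1 ▸ d2, fun ρ hρ hb => ?_, fun s hs => absurd hs (not_fresh_self rfl s)⟩
      obtain ⟨c1, c2⟩ := Below.of_insertEdge hR hD hρ d1 hb
      refine ⟨c1, fun p t hp ht => ?_⟩
      have hp := hn.1 (hp.resolve_right (not_fresh_self rfl p))
      have ht := hn.1 (ht.resolve_right (not_fresh_self rfl t))
      simp only [List.mem_singleton] at hp ht
      rcases hp with rfl | rfl <;> rcases ht with rfl | rfl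
      · rw [hρ.self, hD.self]
      · rwa [hρ.symm, hD.symm]
      · exact c2
      · rw [hρ.self, hD.self]
    · have hn' : ∀ {p}, ZoneNode r q (u :: z :: L) v p ↔ p ∈ v :: u :: z :: L := by
        intro p; rw [hn]; simp
      have huv : v ≠ u := fun he => h.apex_notMem (by simp [he])
      obtain ⟨g', b1, b2, b3, b4⟩ := hstep g _ _ _ _ _ h.stepPre_one huv
        (hM.mono fun p hp => hn'.2 hp) hR
      refine ⟨g', b1, b2, fun ρ hρ hb => ?_, fun s hs a b hab =>
        b4 s hs a b fun p hp => hab p (hn'.2 hp)⟩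
      obtain ⟨c1, c2⟩ := b3 ρ hρ hb
      exact ⟨c1, fun p t hp ht => c2 p t (hp.imp_left hn'.1) (ht.imp_left hn'.1)⟩

/-- `O q` collects the Steiner nodes created by the recursion on the zone `q`. Bounds are obtained
within each zone only. -/
theorem processZones_builds (hD : IsTreeMetric D) {fuel : ℕ} (hstep : StepBuilds D n fuel)
    {r : Node n} {L : Zone → List (Node n)} {v : Zone → Node n} (hd : ZonesApart r L v)
    (hL : ∀ q : Zone, q.isTwo = true → v q = r → L q = [])
    (qs : List Zone) (hqs : qs.Nodup) (g : Node n → Y) (M : Memory n)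
    (h : ∀ q, ZonePre fuel M r (L q) (v q))
    (he : ∀ q ∈ qs, q.isTwo = true → v q ≠ r → (M.edge s(v q, r)).isSome)
    (hM : ∀ q, Fits D g M (ZoneNode r q (L q) (v q))) (hR : Realizes D g M) :
    ∃ g' : Node n → Y, (∀ p, Valid M p → g' p = g p) ∧
      Realizes D g' (qs.foldl (fun M q => processZone (stepVal fuel) r q (L q) (v q) M) M) ∧
      ∃ O : Zone → Node n → Prop,
        (∀ s, Fresh M (qs.foldl (fun M q => processZone (stepVal fuel) r q (L q) (v q) M) M) s →
          ∃ q ∈ qs, O q s) ∧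
        (∀ q s, O q s → q ∈ qs ∧
          ∀ a b, (∀ p, ZoneNode r q (L q) (v q) p → Between D (g p) a b) →
            Between D (g' s) a b) ∧
        ∀ ρ, IsPseudo ρ →
          Below ρ (qs.foldl (fun M q => processZone (stepVal fuel) r q (L q) (v q) M) M) →
          Below ρ M ∧ ∀ q ∈ qs, ∀ p t, ZoneNode r q (L q) (v q) p ∨ O q p →
            ZoneNode r q (L q) (v q) t ∨ O q t → ρ p t ≤ D (g' p) (g' t) := by
  induction qs generalizing M g with
  | nil =>
    refine ⟨g, fun _ _ => rfl, hR, fun _ _ => False, fun s hs => absurd hs (not_fresh_self rfl s),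
      fun _ _ hs => hs.elim, fun ρ _ hb => ⟨hb, fun q hq => by simp at hq⟩⟩
  | cons q qs ih =>
    rw [List.nodup_cons] at hqs
    obtain ⟨f1, -, -⟩ := processZone_grows (stepVal_grows fuel) (h q) (he q (by simp))
    obtain ⟨g₁, b1, b2, b3, b4⟩ := processZone_builds hD hstep (h q) (hL q) (he q (by simp))
      (hM q) hR
    rw [List.foldl_cons]
    set M₁ := processZone (stepVal fuel) r q (L q) (v q) M
    have hr : Valid M r := (h q).valid r (by simp)
    have hv : ∀ q p, ZoneNode r q (L q) (v q) p → Valid M p := by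
      rintro q p (rfl | hp | ⟨-, rfl⟩)
      · exact (h q).valid _ (by simp)
      · exact (h q).valid _ (by simp [hp])
      · exact hr
    obtain ⟨g₂, a1, a2, O, o1, o2, o3⟩ := ih hqs.2 g₁ M₁ (fun q' => (h q').of_frame f1)
      (fun q' hq' h2 hne => by
        have hqq : q ≠ q' := by rintro rfl; exact hqs.1 hq'
        rw [f1.edge_eq ((h q').valid _ (by simp)) hr (hd q q' hqq h2 hne)]
        exact he q' (List.mem_cons_of_mem _ hq') h2 hne)
      (fun q' => (hM q').of_frame (hv q') f1 b1) b2
    set M₂ := qs.foldl (fun M q => processZone (stepVal fuel) r q (L q) (v q) M) M₁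
    refine ⟨g₂, fun p hp => (a1 p (hp.mono f1.steiner)).trans (b1 p hp), a2,
      fun q' s => (q' = q ∧ Fresh M M₁ s) ∨ O q' s, fun s hs => ?_, fun q' s hs => ?_,
      fun ρ hρ hb => ?_⟩
    · rcases hs.cases (M₁ := M₁) with hs | hs
      · exact ⟨q, by simp, .inl ⟨rfl, hs⟩⟩
      · obtain ⟨q', hq', hs⟩ := o1 s hs
        exact ⟨q', List.mem_cons_of_mem _ hq', .inr hs⟩
    · rcases hs with ⟨rfl, hs⟩ | hs
      · refine ⟨by simp, fun a b hab => ?_⟩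
        rw [a1 s hs.1]
        exact b4 s hs a b hab
      · obtain ⟨h1, h2⟩ := o2 q' s hs
        refine ⟨List.mem_cons_of_mem _ h1, fun a b hab => h2 a b fun p hp => ?_⟩
        rw [b1 p (hv q' p hp)]
        exact hab p hp
    · obtain ⟨c1, c2⟩ := o3 ρ hρ hb
      obtain ⟨d1, d2⟩ := b3 ρ hρ c1
      refine ⟨d1, fun q' hq' p t hp ht => ?_⟩
      rcases List.mem_cons.1 hq' with rfl | hqq
      · have key : ∀ p, ZoneNode r q' (L q') (v q') p ∨ ((q' = q' ∧ Fresh M M₁ p) ∨ O q' p) →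
            (ZoneNode r q' (L q') (v q') p ∨ Fresh M M₁ p) ∧ g₂ p = g₁ p := by
          rintro p (hp | ⟨-, hp⟩ | hp)
          · exact ⟨.inl hp, a1 p ((hv q' p hp).mono f1.steiner)⟩
          · exact ⟨.inr hp, a1 p hp.1⟩
          · exact absurd (o2 q' p hp).1 hqs.1
        obtain ⟨hp, hp'⟩ := key p hp
        obtain ⟨ht, ht'⟩ := key t ht
        rw [hp', ht']
        exact d2 p t hp ht
      · have hne : q' ≠ q := by rintro rfl; exact hqs.1 hqq
        simp only [hne, false_and, false_or] at hp ht
        exact c2 q' hqq p t hp ht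

/-! ### The recursive step in a tree -/

/-- The Steiner node is at the median, and the table holds its distances. -/
structure Centred (D : Y → Y → ℝ) (g g₁ : Node n → Y) (M : Memory n) (x y z : Node n)
    (L : List (Node n)) (M₁ : Memory n) (r : Node n) : Prop where
  agree : ∀ p, Valid M p → g₁ p = g p
  fits : Fits D g₁ M₁ fun p => p ∈ x :: y :: z :: L ∨ p = r
  xy : Between D (g₁ x) (g₁ r) (g₁ y)
  yz : Between D (g₁ y) (g₁ r) (g₁ z)
  xz : Between D (g₁ x) (g₁ r) (g₁ z)
  weight_x : product M y z x = D (g₁ x) (g₁ r)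
  weight_y : product M x z y = D (g₁ y) (g₁ r)
  weight_z : product M x y z = D (g₁ z) (g₁ r)

theorem place_centred (hD : IsTreeMetric D) {fuel : ℕ} {g : Node n → Y} {M : Memory n}
    {x y z : Node n} {L : List (Node n)} (h : StepPre fuel M L x y z) (hxy : x ≠ y)
    (hM : Fits D g M (· ∈ x :: y :: z :: L)) :
    ∃ g₁, Centred D g g₁ M x y z L
      (place M x y z (product M y z x) (product M x z y) (product M x y z)
        (sorted M x y z L)).1
      (place M x y z (product M y z x) (product M x z y) (product M x y z)
        (sorted M x y z L)).2.1 := by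
  obtain ⟨m, m1, m2, m3⟩ := hD.median (g x) (g y) (g z)
  have e1 := (hM x y (by simp) (by simp) hxy).1
  have e2 := (hM y x (by simp) (by simp) hxy.symm).1
  have e3 := (hM x z (by simp) (by simp) h.xz).1
  have e4 := (hM y z (by simp) (by simp) h.yz).1
  have e5 := (hM z x (by simp) (by simp) h.xz.symm).1
  have e6 := (hM z y (by simp) (by simp) h.yz.symm).1
  have ha : product M y z x = D (g x) m := by
    unfold Between at *
    rw [product, e1, e3, e4, m1, m2, m3, hD.symm m (g y)]; ring
  have hb : product M x z y = D (g y) m := by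
    unfold Between at *
    rw [product, e2, e3, e4, hD.symm (g y) (g x), m1, m2, m3, hD.symm m (g y)]; ring
  have hc : product M x y z = D (g z) m := by
    unfold Between at *
    rw [product, e5, e6, e1, hD.symm (g z) (g x), hD.symm (g z) (g y), m1, m2, m3,
      hD.symm (g z) m, hD.symm m (g y)]; ring
  have hclass : ∀ w ∈ L, (classify M x y z w).val.2 = D (g w) m ∧
      (D (g w) m = 0 → (classify M x y z w).val = (.r1, 0)) := by
    intro w hw
    have hwx : w ≠ x := by rintro rfl; exact h.x_notMem hw
    have hwy : w ≠ y := by rintro rfl; exact h.y_notMem hw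
    have hwz : w ≠ z := by rintro rfl; exact h.z_notMem hw
    obtain ⟨c1, -, c3⟩ := classify_spec hD (g := g) (M := M) (w := w) (m := m)
      (hM.mono fun p hp => by
        simp only [List.mem_cons, List.not_mem_nil, or_false] at hp ⊢
        rcases hp with rfl | rfl | rfl | rfl
        · simp
        · simp
        · simp
        · simp [hw]) hxy h.yz h.xz hwx hwy hwz m1 m2 m3
    exact ⟨c1, c3⟩
  -- A node at distance zero from the median can stand for it in every distance, so the positions
  -- need no change.
  have hold : ∀ r ∈ x :: y :: z :: L, D (g r) m = 0 → Centred D g g M x y z L M r := by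
    intro r hr h0
    have heq : ∀ u, D (g r) u = D m u := by
      intro u
      have t1 := hD.triangle (g r) m u
      have t2 := hD.triangle m (g r) u
      rw [hD.symm m (g r)] at t2
      linarith
    have heq' : ∀ u, D u (g r) = D u m := fun u => by rw [hD.symm, heq, hD.symm]
    refine ⟨fun _ _ => rfl, hM.mono fun p hp => ?_, ?_, ?_, ?_, ?_, ?_, ?_⟩
    · rcases hp with hp | rfl
      · exact hp
      · exact hr
    iterate 3
      unfold Between
      rw [heq, heq']
      assumption
    all_goals
      rw [heq']
      assumption
  rw [ha, hb, hc]
  rcases place_cases M x y z (D (g x) m) (D (g y) m) (D (g z) m) L with ⟨h0, hP⟩ | ⟨-, h0, hP⟩ |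
    ⟨-, -, h0, hP⟩ | ⟨-, -, -, w, hw, h0, hP⟩ | ⟨hx0, hy0, hz0, hw0, hP⟩ <;> rw [hP]
  · exact ⟨g, hold x (by simp) h0⟩
  · exact ⟨g, hold y (by simp) h0⟩
  · exact ⟨g, hold z (by simp) h0⟩
  · refine ⟨g, hold w (by simp [hw]) ?_⟩
    rw [← (hclass w hw).1, h0]
  -- The new node is put at the median. Its distances are positive because the three weights are
  -- nonzero and no point of `L` is classified as `(.r1, 0)`.
  · set r : Node n := .inr M.steiner
    have hA : ∀ p ∈ x :: y :: z :: L, p ≠ r := fun p hp => (h.valid p hp).ne_next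
    have hg : ∀ p ∈ x :: y :: z :: L, Function.update g r m p = g p := fun p hp =>
      Function.update_of_ne (hA p hp) _ _
    have hr : Function.update g r m r = m := Function.update_self _ _ _
    set l := (x, D (g x) m) :: (y, D (g y) m) :: (z, D (g z) m) ::
      (sorted M x y z L).map fun s => (s.1, s.2.2) with hl
    have hl' : l.map Prod.fst = x :: y :: z :: L := by
      have := map_fst_sorted M x y z L
      simp only [hl, List.map_cons, List.map_map, List.cons.injEq, true_and]
      exact this
    have hnd : (l.map Prod.fst).Nodup := by
      rw [hl']
      have := h.xz
      have := h.yz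
      have := h.x_notMem
      have := h.y_notMem
      have := h.z_notMem
      have := h.nodup
      simp [*]
    have hrl : r ∉ l.map Prod.fst := by
      rw [hl']
      exact fun hm => hA r hm rfl
    have hmem : ∀ p ∈ x :: y :: z :: L, (p, D (g p) m) ∈ l ∧ 0 < D (g p) m := by
      intro p hp
      have hpos : D (g p) m ≠ 0 → 0 < D (g p) m := fun h => lt_of_le_of_ne (hD.nonneg _ _) h.symm
      simp only [List.mem_cons] at hp
      rcases hp with rfl | rfl | rfl | hp
      · exact ⟨by simp [hl], hpos hx0⟩
      · exact ⟨by simp [hl], hpos hy0⟩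
      · exact ⟨by simp [hl], hpos hz0⟩
      · obtain ⟨c1, c2⟩ := hclass p hp
        refine ⟨?_, hpos fun h0 => hw0 p hp (c2 h0)⟩
        simp only [hl, List.mem_cons, List.mem_map, sorted]
        exact .inr (.inr (.inr ⟨_, ⟨p, hp, rfl⟩, by rw [← c1]⟩))
    have hdist : ∀ p ∈ x :: y :: z :: L,
        (M.addSteiner x y z (D (g x) m) (D (g y) m) (D (g z) m) (sorted M x y z L)).dist p r =
          D (g p) m ∧
        (M.addSteiner x y z (D (g x) m) (D (g y) m) (D (g z) m) (sorted M x y z L)).dist r p =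
          D (g p) m := fun p hp => by
      rw [addSteiner_eq]
      exact foldl_setDist_of_mem l _ hnd hrl (hmem p hp).1
    refine ⟨Function.update g r m, fun p hp => Function.update_of_ne hp.ne_next _ _, ?_, ?_, ?_,
      ?_, ?_, ?_, ?_⟩
    · intro p q hp hq hpq
      by_cases hpr : p = r
      · have hqr : q ≠ r := fun h => hpq (hpr.trans h.symm)
        have hq := hq.resolve_right hqr
        dsimp only
        rw [hpr, hg q hq, hr, (hdist q hq).2, hD.symm m]
        exact ⟨rfl, (hmem q hq).2⟩
      · have hp := hp.resolve_right hpr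
        by_cases hqr : q = r
        · dsimp only
          rw [hqr, hg p hp, hr, (hdist p hp).1]
          exact ⟨rfl, (hmem p hp).2⟩
        · have hq := hq.resolve_right hqr
          rw [hg p hp, hg q hq, addSteiner_eq, foldl_setDist_of_ne _ _ hpr hqr]
          exact hM p q hp hq hpq
    iterate 3
      dsimp only
      rw [hr, hg _ (by simp), hg _ (by simp)]
      assumption
    all_goals
      dsimp only
      rw [hr, hg _ (by simp)]
      assumption

/-- The branch of the universal tree to which a zone belongs: `0` for the Steiner node, and `1, 2, 3`
for `x, y, z`. -/
def Zone.sector : Zone → ℕ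
  | .r1 => 0
  | .x1 | .x2 => 1
  | .y1 | .y2 => 2
  | .z1 | .z2 => 3

/-- The positions of the nodes of the zones relative to the Steiner node. -/
structure Zoned (D : Y → Y → ℝ) (g : Node n → Y) (r : Node n) (N : Zone → Node n → Prop)
    (v : Zone → Node n) : Prop where
  apex : ∀ q, N q (v q)
  root : ∀ q : Zone, q.isTwo = true → N q r
  across : ∀ q q' : Zone, q.sector ≠ q'.sector → ∀ p t, N q p → N q' t →
    Between D (g p) (g r) (g t)
  within : ∀ q q' : Zone, q.sector = q'.sector → q ≠ q' → ∀ p t, N q p → N q' t →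
    Between D (g p) (g (v q)) (g t)

theorem apex_eq_of_sector_eq {q q' : Zone} (h : q.sector = q'.sector) (x y z r : Node n) :
    q.apex x y z r = q'.apex x y z r := by
  cases q <;> cases q' <;> simp [Zone.sector] at h <;> rfl

/-- The nodes of the zones before the recursion are in the right positions. -/
theorem zoned_zonePoints (hD : IsTreeMetric D) {fuel : ℕ} {g g₁ : Node n → Y} {M M₁ : Memory n}
    {x y z r : Node n} {L : List (Node n)} (h : StepPre fuel M L x y z) (hxy : x ≠ y)
    (hM : Fits D g M (· ∈ x :: y :: z :: L)) (hC : Centred D g g₁ M x y z L M₁ r) :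
    Zoned D g₁ r
      (fun q => ZoneNode r q (zonePoints M x y z L r q) (q.apex x y z r))
      (fun q => q.apex x y z r) ∧
    ∀ q : Zone, q.isTwo = true → q.apex x y z r = r → zonePoints M x y z L r q = [] := by
  have hM' : Fits D g₁ M (· ∈ x :: y :: z :: L) := fun p q hp hq hpq => by
    rw [hC.agree p (h.valid p hp), hC.agree q (h.valid q hq)]
    exact hM p q hp hq hpq
  have hclass : ∀ q, ∀ w ∈ zonePoints M x y z L r q,
      InZone D (g₁ x) (g₁ y) (g₁ z) (g₁ r) (g₁ w) q := by
    intro q w hw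
    obtain ⟨hwL, -, rfl⟩ := mem_zonePoints.1 hw
    have hwx : w ≠ x := by rintro rfl; exact h.x_notMem hwL
    have hwy : w ≠ y := by rintro rfl; exact h.y_notMem hwL
    have hwz : w ≠ z := by rintro rfl; exact h.z_notMem hwL
    exact (classify_spec hD (hM'.mono fun p hp => by
        simp only [List.mem_cons, List.not_mem_nil, or_false] at hp ⊢
        rcases hp with rfl | rfl | rfl | rfl
        · simp
        · simp
        · simp
        · simp [hwL]) hxy h.yz h.xz hwx hwy hwz hC.xy hC.yz hC.xz).2.1
  have hrr : ∀ t, Between D t (g₁ r) (g₁ r) := fun t => hD.between_right _ _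
  have hrl : ∀ t, Between D (g₁ r) (g₁ r) t := fun t => hD.between_left _ _
  have hyx := hD.between_symm hC.xy
  have hzy := hD.between_symm hC.yz
  have hzx := hD.between_symm hC.xz
  have hxy := hC.xy
  have hyz := hC.yz
  have hxz := hC.xz
  have outside : ∀ q q' : Zone, q.sector ≠ q'.sector → ∀ p,
      ZoneNode r q (zonePoints M x y z L r q) (q.apex x y z r) p →
      Between D (g₁ p) (g₁ r) (g₁ (q'.apex x y z r)) := by
    rintro q q' hqq p (rfl | hp | ⟨-, rfl⟩)
    · cases q <;> cases q' <;> simp [Zone.sector] at hqq <;> simp only [Zone.apex] <;>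
        first | assumption | exact hrr _ | exact hrl _
    · have := hclass q p hp
      cases q <;> cases q' <;> simp [Zone.sector] at hqq <;> simp only [Zone.apex] <;>
        simp only [InZone] at this <;> first | exact hrr _ | tauto
    · exact hrl _
  have inside : ∀ q : Zone, q.sector ≠ 0 → ∀ p ∈ zonePoints M x y z L r q,
      ¬ Between D (g₁ p) (g₁ r) (g₁ (q.apex x y z r)) := by
    intro q hq p hp
    have := hclass q p hp
    cases q <;> simp [Zone.sector] at hq <;> simp only [Zone.apex] <;>
      simp only [InZone] at this <;> tauto
  have inside' : ∀ q : Zone, q.sector ≠ 0 → ∀ p,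
      ZoneNode r q (zonePoints M x y z L r q) (q.apex x y z r) p →
      p = r ∨ ¬ Between D (g₁ p) (g₁ r) (g₁ (q.apex x y z r)) := by
    rintro q hq p (rfl | hp | ⟨-, rfl⟩)
    · by_cases hpr : q.apex x y z r = r
      · exact .inl hpr
      · right
        intro hb
        have hA : q.apex x y z r ∈ x :: y :: z :: L := by
          cases q <;> simp [Zone.sector] at hq <;> simp [Zone.apex]
        have := (hC.fits _ r (.inl hA) (.inr rfl) hpr).2
        unfold Between at hb
        rw [hD.self, hD.symm (g₁ r)] at hb
        linarith
    · exact .inr (inside q hq p hp)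
    · exact .inl rfl
  -- The root `r` is between `t` and the apex of `q`, but not between `p` and this apex, so it
  -- separates `p` from `t`.
  have crossing : ∀ q q' : Zone, q.sector ≠ q'.sector → q.sector ≠ 0 → ∀ p t,
      ZoneNode r q (zonePoints M x y z L r q) (q.apex x y z r) p →
      ZoneNode r q' (zonePoints M x y z L r q') (q'.apex x y z r) t →
      Between D (g₁ p) (g₁ r) (g₁ t) := by
    intro q q' hqq hq p t hp ht
    rcases inside' q hq p hp with rfl | hb
    · exact hrl _
    · exact hD.between_symm ((hD.separates (outside q' q hqq.symm t ht) (g₁ p)).resolve_right hb)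
  -- The apex separates points of type one from `r`, but not points of type two, so it separates the
  -- two kinds from each other.
  have nested : ∀ q q' : Zone, q.sector = q'.sector → q ≠ q' → q'.isTwo = true → ∀ p t,
      ZoneNode r q (zonePoints M x y z L r q) (q.apex x y z r) p →
      ZoneNode r q' (zonePoints M x y z L r q') (q'.apex x y z r) t →
      Between D (g₁ p) (g₁ (q.apex x y z r)) (g₁ t) := by
    intro q q' hqq hne h2 p t hp ht
    have h1 : q.isTwo = false := by
      cases q <;> cases q' <;> simp [Zone.sector, Zone.isTwo] at hqq hne h2 ⊢
    have hap := apex_eq_of_sector_eq hqq x y z r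
    rcases hp with rfl | hp | ⟨hp, -⟩
    · exact hD.between_left _ _
    · have hpv : Between D (g₁ p) (g₁ (q.apex x y z r)) (g₁ r) := by
        have := hclass q p hp
        cases q <;> simp [Zone.isTwo] at h1 <;> simp only [Zone.apex] <;>
          simp only [InZone] at this <;> first | exact hrr _ | tauto
      rcases ht with rfl | ht | ⟨-, rfl⟩
      · rw [hap]; exact hD.between_right _ _
      · have : ¬ Between D (g₁ t) (g₁ (q'.apex x y z r)) (g₁ r) := by
          have := hclass q' t ht
          cases q' <;> simp [Zone.isTwo] at h2 <;> simp only [Zone.apex] <;>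
            simp only [InZone] at this <;> tauto
        rw [← hap] at this
        exact (hD.separates hpv (g₁ t)).resolve_right this
      · exact hpv
    · rw [h1] at hp
      cases hp
  refine ⟨⟨fun q => .inl rfl, fun q hq => .inr (.inr ⟨hq, rfl⟩), fun q q' hqq p t hp ht => ?_,
    fun q q' hqq hne p t hp ht => ?_⟩, fun q h2 hr => ?_⟩
  · by_cases hq : q.sector = 0
    · exact hD.between_symm (crossing q' q hqq.symm (fun h => hqq (hq.trans h.symm)) t p ht hp)
    · exact crossing q q' hqq hq p t hp ht
  · by_cases h2 : q'.isTwo = true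
    · exact nested q q' hqq hne h2 p t hp ht
    · have h2' : q.isTwo = true := by
        cases q <;> cases q' <;> simp [Zone.sector, Zone.isTwo] at hqq hne h2 ⊢
      rw [apex_eq_of_sector_eq hqq]
      exact hD.between_symm (nested q' q hqq.symm hne.symm h2' t p ht hp)
  · refine List.eq_nil_iff_forall_not_mem.2 fun w hw => inside q ?_ w hw ?_
    · cases q <;> simp [Zone.isTwo] at h2 <;> simp [Zone.sector]
    · rw [hr]; exact hrr _

/-- New nodes in the hulls of the zones are in the right positions. -/
theorem Zoned.extend (hD : IsTreeMetric D) {g g' : Node n → Y} {r : Node n}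
    {N : Zone → Node n → Prop} {v : Zone → Node n} (h : Zoned D g r N v)
    (hg : ∀ q p, N q p → g' p = g p) {O : Zone → Node n → Prop}
    (hO : ∀ q s, O q s → ∀ a b, (∀ p, N q p → Between D (g p) a b) → Between D (g' s) a b) :
    Zoned D g' r (fun q p => N q p ∨ O q p) v := by
  -- The hull property is applied to one end at a time, with the other end fixed.
  have lift : ∀ q q' c, (∀ p t, N q p → N q' t → Between D (g p) c (g t)) →
      ∀ p t, N q p ∨ O q p → N q' t ∨ O q' t → Between D (g' p) c (g' t) := by
    intro q q' c hc
    have h1 : ∀ p t, N q p ∨ O q p → N q' t → Between D (g' p) c (g t) := by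
      rintro p t (hp | hp) ht
      · rw [hg q p hp]; exact hc p t hp ht
      · exact hO q p hp _ _ fun p' hp' => hc p' t hp' ht
    rintro p t hp (ht | ht)
    · rw [hg q' t ht]; exact h1 p t hp ht
    · exact hD.between_symm (hO q' t ht _ _ fun t' ht' => hD.between_symm (h1 p t' hp ht'))
  have hr : g' r = g r := hg .x2 r (h.root .x2 rfl)
  refine ⟨fun q => .inl (h.apex q), fun q hq => .inl (h.root q hq), fun q q' hqq => ?_,
    fun q q' hqq hne => ?_⟩
  · rw [hr]
    exact lift q q' _ (h.across q q' hqq)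
  · rw [hg q _ (h.apex q)]
    exact lift q q' _ (h.within q q' hqq hne)

/-- Distances between nodes of different zones. -/
theorem Zoned.le_of_zones {g : Node n → Y} {r : Node n} {N : Zone → Node n → Prop}
    {v : Zone → Node n} (h : Zoned D g r N v) (hv₀ : v .r1 = r)
    (hv : ∀ q q' : Zone, q.sector = q'.sector → v q = v q')
    {ρ : Node n → Node n → ℝ} (hρ : IsPseudo ρ)
    (hN : ∀ q p t, N q p → N q t → ρ p t ≤ D (g p) (g t)) {q q' : Zone} {p t : Node n}
    (hp : N q p) (ht : N q' t) : ρ p t ≤ D (g p) (g t) := by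
  have chain : ∀ {a b c : Node n}, Between D (g a) (g b) (g c) → ρ a b ≤ D (g a) (g b) →
      ρ b c ≤ D (g b) (g c) → ρ a c ≤ D (g a) (g c) := by
    intro a b c hb h1 h2
    rw [hb]
    exact (hρ.triangle a b c).trans (add_le_add h1 h2)
  have htwin : ∀ q : Zone, q.isTwo = false → q.sector ≠ 0 →
      ∃ q' : Zone, q.sector = q'.sector ∧ q ≠ q' ∧ q'.isTwo = true := by
    intro q h1 h2
    cases q <;> first
      | exact absurd rfl h2
      | exact absurd h1 (by decide)
      | exact ⟨.x2, rfl, by decide, rfl⟩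
      | exact ⟨.y2, rfl, by decide, rfl⟩
      | exact ⟨.z2, rfl, by decide, rfl⟩
  -- A zone of type two contains `r`, and so does that of `r` itself. From a zone of type one at `x,
  -- y, z` the way to `r` leads through the apex and the zone of type two at the same apex.
  have hroot : ∀ q p, N q p → ρ p r ≤ D (g p) (g r) ∧ ρ r p ≤ D (g r) (g p) := by
    intro q p hp
    by_cases h2 : q.isTwo = true
    · exact ⟨hN q p r hp (h.root q h2), hN q r p (h.root q h2) hp⟩
    · by_cases h0 : q.sector = 0
      · have hr : N q r := by
          have := h.apex q
          rwa [hv q .r1 (h0.trans rfl), hv₀] at this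
        exact ⟨hN q p r hp hr, hN q r p hr hp⟩
      · obtain ⟨q', hs, hne, h2'⟩ := htwin q (by simpa using h2) h0
        have hr := h.root q' h2'
        have hv' : N q' (v q) := hv q q' hs ▸ h.apex q'
        refine ⟨chain (h.within q q' hs hne p r hp hr) (hN q _ _ hp (h.apex q))
          (hN q' _ _ hv' hr), chain (b := v q) ?_ (hN q' _ _ hr hv') (hN q _ _ (h.apex q) hp)⟩
        rw [hv q q' hs]
        exact h.within q' q hs.symm hne.symm r p hr hp
  by_cases hqq : q.sector = q'.sector
  · by_cases hne : q = q'
    · subst hne; exact hN q p t hp ht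
    · exact chain (h.within q q' hqq hne p t hp ht) (hN q _ _ hp (h.apex q))
        (hN q' _ _ (hv q q' hqq ▸ h.apex q') ht)
  · exact chain (h.across q q' hqq p t hp ht) (hroot q p hp).1 (hroot q' t ht).2

/-- Induction on the depth: the zones are separated before the recursion, the hull property extends
this to the nodes created in it, and bounds inside the zones then give all bounds. -/
theorem stepVal_builds (hD : IsTreeMetric D) (fuel : ℕ) : StepBuilds D n fuel := by
  induction fuel with
  | zero => exact fun g M L x y z h => absurd h.length (by simp)
  | succ fuel ih =>
    intro g M L x y z h hxy hM hR
    obtain ⟨g₁, hC⟩ := place_centred hD h hxy hM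
    obtain ⟨hP, hS⟩ := place_spec h (a := product M y z x) (b := product M x z y)
      (c := product M x y z) (fun he => absurd he hxy)
    rw [stepVal]
    set a := product M y z x
    set b := product M x z y
    set c := product M x y z
    rw [hS]
    simp only [zoneOf_filter_sorted]
    set M₁ := (place M x y z a b c (sorted M x y z L)).1
    set r := (place M x y z a b c (sorted M x y z L)).2.1
    have hF := frame_addStar M₁ x y z r a b c
    obtain ⟨hZ, hempty⟩ := zoned_zonePoints hD h hxy hM hC
    have hA : ∀ p ∈ x :: y :: z :: L, Valid M₁ p := fun p hp =>
      (h.valid p hp).mono hP.frame.steiner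
    have hR₁ : Realizes D g₁ M₁ := by
      refine ⟨hP.frame.validEdges (fun _ hp => hp.elim) hR.valid, fun p q w hpq => ?_⟩
      rw [hP.edge] at hpq
      have hq : Valid M q := hR.valid q p (by rw [Sym2.eq_swap, hpq]; rfl)
      rw [hC.agree p (hR.valid p q (by rw [hpq]; rfl)), hC.agree q hq]
      exact hR.weight p q w hpq
    have hpos : ∀ p ∈ x :: y :: z :: L, p ≠ r → 0 < D (g₁ p) (g₁ r) := fun p hp hpr =>
      (hC.fits p r (.inl hp) (.inr rfl) hpr).2
    have hRx := hR₁.insertEdge hD (hA x (by simp)) hP.valid hC.weight_x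
      fun hne => hC.weight_x ▸ hpos x (by simp) hne
    have hRy := hRx.insertEdge hD (hA y (by simp)) hP.valid hC.weight_y
      fun hne => hC.weight_y ▸ hpos y (by simp) hne
    have hRz := hRy.insertEdge hD (hA z (by simp)) hP.valid hC.weight_z
      fun hne => hC.weight_z ▸ hpos z (by simp) hne
    have hzn : ∀ q p, ZoneNode r q (zonePoints M x y z L r q) (q.apex x y z r) p →
        p ∈ x :: y :: z :: L ∨ p = r := by
      rintro q p (rfl | hp | ⟨-, rfl⟩)
      · cases q <;> simp [Zone.apex]
      · exact .inl (by simp [(mem_zonePoints.1 hp).1])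
      · exact .inr rfl
    have hzv : ∀ q p, ZoneNode r q (zonePoints M x y z L r q) (q.apex x y z r) p →
        Valid M₁ p := by
      intro q p hp
      rcases hzn q p hp with hp | rfl
      · exact hA p hp
      · exact hP.valid
    obtain ⟨g', a1, a2, O, o1, o2, o3⟩ := processZones_builds hD ih
      (zoneNode_zonePoints_apart h hP) hempty Zone.all (by decide) g₁
      (M₁.addStar x y z r a b c) (fun q => zonePre_zonePoints h hP hF q)
      (fun q _ h2 _ => addStar_edge _ _ _ _ _ _ _ _ (by
        cases q <;> simp [Zone.isTwo] at h2 <;> simp [Zone.apex]))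
      (fun q => hC.fits.mono (hzn q)) hRz
    set M₃ := Zone.all.foldl (fun M' q => processZone (stepVal fuel) r q
      (zonePoints M x y z L r q) (q.apex x y z r) M') (M₁.addStar x y z r a b c)
    have hZ' := hZ.extend hD (fun q p hp => a1 p (hzv q p hp)) fun q s hs => (o2 q s hs).2
    have hfresh : ∀ s, Fresh M M₃ s → Fresh M M₁ s ∨ ∃ q, O q s := by
      intro s hs
      rcases hs.cases (M₁ := M₁) with hs | hs
      · exact .inl hs
      · obtain ⟨q, -, hq⟩ := o1 s hs
        exact .inr ⟨q, hq⟩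
    have hmem : ∀ p, p ∈ x :: y :: z :: L ∨ Fresh M M₃ p →
        ∃ q, ZoneNode r q (zonePoints M x y z L r q) (q.apex x y z r) p ∨ O q p := by
      intro p hp
      by_cases hpr : p = r
      · exact ⟨.r1, .inl (.inl hpr)⟩
      rcases hp with hp | hp
      · simp only [List.mem_cons] at hp
        rcases hp with rfl | rfl | rfl | hp
        · exact ⟨.x1, .inl (.inl rfl)⟩
        · exact ⟨.y1, .inl (.inl rfl)⟩
        · exact ⟨.z1, .inl (.inl rfl)⟩
        · exact ⟨_, .inl (.inr (.inl (mem_zonePoints.2 ⟨hp, hpr, rfl⟩)))⟩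
      · rcases hfresh p hp with hp | ⟨q, hq⟩
        · exact absurd (hP.fresh p hp) hpr
        · exact ⟨q, .inr hq⟩
    refine ⟨g', fun p hp => (a1 p (hp.mono hP.frame.steiner)).trans (hC.agree p hp), a2,
      fun ρ hρ hb => ?_, fun s hs u w huw => ?_⟩
    -- The bound on edge weights is carried backwards, from the final memory through the zones and
    -- the three star edges to `M`.
    · obtain ⟨c1, c2⟩ := o3 ρ hρ hb
      obtain ⟨c1, -⟩ := Below.of_insertEdge hRy hD hρ hC.weight_z c1
      obtain ⟨c1, -⟩ := Below.of_insertEdge hRx hD hρ hC.weight_y c1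
      obtain ⟨c1, -⟩ := Below.of_insertEdge hR₁ hD hρ hC.weight_x c1
      refine ⟨fun p q w hpq => c1 p q w (by rwa [hP.edge]), fun p t hp ht => ?_⟩
      obtain ⟨q, hq⟩ := hmem p hp
      obtain ⟨q', hq'⟩ := hmem t ht
      exact hZ'.le_of_zones rfl (fun q q' hqq => apex_eq_of_sector_eq hqq x y z r) hρ
        (fun q p t hp ht => c2 q (by cases q <;> decide) p t hp ht) hq hq'
    -- The median lies in the hull of `x` and `y`, so a zone that involves `r` does not enlarge the
    -- hull.
    · have hroot : Between D (g₁ r) u w := hD.between_of_between hC.xy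
        (by rw [hC.agree x (h.valid x (by simp))]; exact huw x (by simp))
        (by rw [hC.agree y (h.valid y (by simp))]; exact huw y (by simp))
      rcases hfresh s hs with hs | ⟨q, hq⟩
      · rw [hP.fresh s hs]
        have : g' r = g₁ r := a1 r hP.valid
        rwa [this]
      · refine (o2 q s hq).2 u w fun p hp => ?_
        rcases hzn q p hp with hp | rfl
        · rw [hC.agree p (h.valid p hp)]; exact huw p hp
        · exact hroot

end TreeRep

namespace TreeRep

open Timed SimpleGraph

variable {n : ℕ}

/-! ### The tree in the memory -/

theorem buildVal_grows {d : Fin n → Fin n → ℝ} (hd : ∀ i, d i i = 0) {A : List (Node n)}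
    (hA : A.Nodup) (hlen : A.length ≤ n) (hne : A ≠ []) (hv : ∀ p ∈ A, Valid (initial d) p) :
    Grows (initial d) (buildVal (initial d) A) A (A.length - 1) := by
  have hdiag : ∀ p, (initial d).dist p p = 0 := by
    rintro (i | s)
    · exact hd i
    · rfl
  rcases A with _ | ⟨x, _ | ⟨y, _ | ⟨z, L⟩⟩⟩
  · exact absurd rfl hne
  · refine ⟨.rfl, fun R hR => ⟨hR, fun p q hp hq => ?_⟩, fun m hm => hm.mono (by simp)⟩
    have hp := List.mem_singleton.1 (hp.resolve_right (not_fresh_self rfl p))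
    have hq := List.mem_singleton.1 (hq.resolve_right (not_fresh_self rfl q))
    rw [hp, hq]
  · refine ⟨(Frame.insertEdge _ x y _).mono (by simp), fun R hR => ?_, fun m hm => ?_⟩
    · obtain ⟨h1, h2⟩ := hR.of_insertEdge
      refine ⟨h1, fun p q hp hq => ?_⟩
      have hp := hp.resolve_right (not_fresh_self rfl p)
      have hq := hq.resolve_right (not_fresh_self rfl q)
      simp only [List.mem_cons, List.not_mem_nil, or_false] at hp hq
      rcases hp with rfl | rfl <;> rcases hq with rfl | rfl
      · exact R.refl _
      · exact h2
      · exact R.symm h2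
      · exact R.refl _
    · refine (hm.insertEdge x y _).mono ?_
      simp only [List.length_cons, List.length_nil]
      split_ifs <;> omega
  · simp only [List.nodup_cons, List.mem_cons, not_or, List.length_cons] at hA hlen
    have := stepVal_grows n (initial d) L x y z ⟨by omega, hA.2.2.2, hA.1.2.2, hA.2.1.2,
      hA.2.2.1, hA.1.2.1, hA.2.1.1, hv, hdiag⟩
    rw [if_neg hA.1.1] at this
    have hl : (x :: y :: z :: L).length - 1 = 2 + L.length := by
      simp only [List.length_cons]; omega
    rw [hl]
    exact this

theorem buildVal_builds {Y : Type*} {D : Y → Y → ℝ} (hD : IsTreeMetric D)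
    {d : Fin n → Fin n → ℝ} (hd : ∀ i, d i i = 0) {A : List (Node n)} (hA : A.Nodup)
    (hlen : A.length ≤ n) (hne : A ≠ []) (hv : ∀ p ∈ A, Valid (initial d) p) {g : Node n → Y}
    (hg : Fits D g (initial d) (· ∈ A)) :
    ∃ g', Builds D g (initial d) g' (buildVal (initial d) A) (· ∈ A) := by
  have hdiag : ∀ p, (initial d).dist p p = 0 := by
    rintro (i | s)
    · exact hd i
    · rfl
  have hR : Realizes D g (initial d) :=
    ⟨fun p q h => by simp [initial] at h, fun p q w h => by simp [initial] at h⟩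
  rcases A with _ | ⟨x, _ | ⟨y, _ | ⟨z, L⟩⟩⟩
  · exact absurd rfl hne
  · refine ⟨g, fun _ _ => rfl, hR, fun ρ hρ hb => ⟨hb, fun p q hp hq => ?_⟩,
      fun s hs => absurd hs (not_fresh_self rfl s)⟩
    have hp := List.mem_singleton.1 (hp.resolve_right (not_fresh_self rfl p))
    have hq := List.mem_singleton.1 (hq.resolve_right (not_fresh_self rfl q))
    rw [hp, hq, hρ.self, hD.self]
  · have hxy : x ≠ y := by simpa using hA
    obtain ⟨d1, d2⟩ := hg x y (by simp) (by simp) hxy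
    refine ⟨g, fun _ _ => rfl, hR.insertEdge hD (hv x (by simp)) (hv y (by simp)) d1
      fun _ => d1 ▸ d2, fun ρ hρ hb => ?_, fun s hs => absurd hs (not_fresh_self rfl s)⟩
    obtain ⟨c1, c2⟩ := Below.of_insertEdge hR hD hρ d1 hb
    refine ⟨c1, fun p q hp hq => ?_⟩
    have hp := hp.resolve_right (not_fresh_self rfl p)
    have hq := hq.resolve_right (not_fresh_self rfl q)
    simp only [List.mem_cons, List.not_mem_nil, or_false] at hp hq
    rcases hp with rfl | rfl <;> rcases hq with rfl | rfl
    · rw [hρ.self, hD.self]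
    · exact c2
    · rwa [hρ.symm, hD.symm]
    · rw [hρ.self, hD.self]
  · simp only [List.nodup_cons, List.mem_cons, not_or, List.length_cons] at hA hlen
    exact stepVal_builds hD n g (initial d) L x y z ⟨by omega, hA.2.2.2, hA.1.2.2, hA.2.1.2,
      hA.2.2.1, hA.1.2.1, hA.2.1.1, hv, hdiag⟩ hA.1.1 hg hR

/-! ### The output -/

/-- The node of the memory that corresponds to a node of the output. -/
def embed (M : Memory n) : Fin n ⊕ Fin M.steiner → Node n := Sum.map id Fin.val

theorem embed_injective (M : Memory n) : Function.Injective (embed M) :=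
  Function.injective_id.sumMap Fin.val_injective

theorem valid_embed (M : Memory n) (u : Fin n ⊕ Fin M.steiner) : Valid M (embed M u) := by
  rcases u with i | s
  · trivial
  · exact s.2

theorem exists_embed {M : Memory n} {p : Node n} (hp : Valid M p) : ∃ u, embed M u = p := by
  rcases p with i | s
  · exact ⟨.inl i, rfl⟩
  · exact ⟨.inr ⟨s, hp⟩, rfl⟩

theorem embed_leftInverse (M : Memory n) [Nonempty (Fin n ⊕ Fin M.steiner)]
    (u : Fin n ⊕ Fin M.steiner) : Function.invFun (embed M) (embed M u) = u :=
  Function.leftInverse_invFun (embed_injective M) u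

theorem adj_output {M : Memory n} {u v : Fin n ⊕ Fin M.steiner} :
    M.outputTree.graph.Adj u v ↔ (M.edge s(embed M u, embed M v)).isSome ∧ u ≠ v := by
  simp [Memory.outputTree, Memory.toGraph, embed]

theorem weight_output {M : Memory n} {u v : Fin n ⊕ Fin M.steiner} {w : ℝ}
    (h : M.edge s(embed M u, embed M v) = some w) :
    M.outputTree.weight s(u, v) = max 0 w := by
  simp only [embed] at h
  simp [Memory.outputTree, Memory.toGraph, h]

theorem weight_output_nonneg (M : Memory n) (e : Sym2 (Fin n ⊕ Fin M.steiner)) :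
    0 ≤ M.outputTree.weight e := by
  simp only [Memory.outputTree, Memory.toGraph]
  cases M.edge (e.map (Sum.map id Fin.val)) <;> simp

/-- The output is a tree, for every table of distances. -/
theorem isWeightedTree_output {d : Fin n → Fin n → ℝ} {M : Memory n} {A : List (Node n)}
    (hn : 1 ≤ n) (hA : ∀ p, p ∈ A ↔ Valid (initial d) p)
    (h : Grows (initial d) M A (n - 1)) : M.outputTree.IsWeightedTree := by
  have : Nonempty (Fin n ⊕ Fin M.steiner) := ⟨.inl ⟨0, hn⟩⟩
  refine ⟨?_, fun e _ => weight_output_nonneg M e⟩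
  have hval : ValidEdges M := h.frame.validEdges (fun p hp => (hA p).1 hp)
    fun p q hpq => by simp [initial] at hpq
  have hconn : M.outputTree.graph.Connected := by
    refine ⟨fun u v => ?_⟩
    -- Reachability in the output, pulled back to the nodes of the memory, contains all stored
    -- edges.
    have hR := (h.joined (M.outputTree.graph.reachableSetoid.comap
      (Function.invFun (embed M))) fun p q hpq => ?_).2 (embed M u) (embed M v)
    · have hmem : ∀ u, embed M u ∈ A ∨ Fresh (initial d) M (embed M u) := fun u => by
        rw [hA]
        by_cases hu : Valid (initial d) (embed M u)
        · exact .inl hu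
        · exact .inr ⟨valid_embed M u, hu⟩
      have := hR (hmem u) (hmem v)
      rw [Setoid.comap_rel, embed_leftInverse, embed_leftInverse] at this
      exact this
    · obtain ⟨u, rfl⟩ := exists_embed (hval p q hpq)
      obtain ⟨v, rfl⟩ := exists_embed (hval q _ (by rwa [Sym2.eq_swap]))
      rw [Setoid.comap_rel, embed_leftInverse, embed_leftInverse]
      by_cases huv : u = v
      · rw [huv]
      · exact (adj_output.2 ⟨hpq, huv⟩).reachable
  refine isTree_iff_connected_and_card.2 ⟨hconn, le_antisymm ?_
    hconn.card_vert_le_card_edgeSet_add_one⟩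
  -- The count starts from a memory without edges. A connected graph has at least as many edges as a
  -- tree, so the upper bound is enough.
  obtain ⟨F, hF, hF'⟩ := h.count 0 ⟨∅, by simp, fun e he => by simp [initial] at he⟩
  have hcard : Nat.card M.outputTree.graph.edgeSet ≤ F.card := by
    have hmem : ∀ e : M.outputTree.graph.edgeSet, e.1.map (embed M) ∈ F := by
      rintro ⟨e, he⟩
      induction e with
      | h u v =>
        rw [mem_edgeSet, adj_output] at he
        exact hF' _ he.1 (by simpa using (embed_injective M).ne he.2)
    have := Nat.card_le_card_of_injective (fun e => (⟨_, hmem e⟩ : F)) fun e e' hee =>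
      Subtype.ext (Sym2.map.injective (embed_injective M) (congrArg Subtype.val hee))
    simpa using this
  have hst : (initial d : Memory n).steiner = 0 := rfl
  have hV : Nat.card (Fin n ⊕ Fin M.steiner) = n + M.steiner := by
    rw [Nat.card_sum, Nat.card_fin, Nat.card_fin]
  rw [hV]
  omega

/-! ### The metric of the output -/

section Metric

variable {Y : Type*} {D : Y → Y → ℝ} {g : Node n → Y} {M : Memory n}

theorem weight_output_of_realizes (hR : Realizes D g M) {u v : Fin n ⊕ Fin M.steiner}
    (h : M.outputTree.graph.Adj u v) :
    M.outputTree.weight s(u, v) = D (g (embed M u)) (g (embed M v)) ∧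
      0 < D (g (embed M u)) (g (embed M v)) := by
  obtain ⟨h1, h2⟩ := adj_output.1 h
  obtain ⟨w, hw⟩ := Option.isSome_iff_exists.1 h1
  obtain ⟨h3, h4⟩ := hR.weight _ _ w hw
  have h5 := h4 ((embed_injective M).ne h2)
  rw [weight_output hw, max_eq_right h5.le, ← h3]
  exact ⟨rfl, h5⟩

theorem le_walkLength_output (hD : IsTreeMetric D) (hR : Realizes D g M)
    {u v : Fin n ⊕ Fin M.steiner} (p : M.outputTree.graph.Walk u v) :
    D (g (embed M u)) (g (embed M v)) ≤ M.outputTree.walkLength p := by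
  induction p with
  | nil => rw [hD.self]; simp [WeightedGraph.walkLength]
  | @cons u v w h p ih =>
    have h1 := (weight_output_of_realizes hR h).1
    have h2 := hD.triangle (g (embed M u)) (g (embed M v)) (g (embed M w))
    simp only [WeightedGraph.walkLength, Walk.edges_cons, List.map_cons, List.sum_cons] at ih ⊢
    linarith

/-- The shortest path metric of the output is given by the positions of the nodes. -/
theorem pathDist_output (hD : IsTreeMetric D) {d : Fin n → Fin n → ℝ} {g₀ : Node n → Y}
    {A : List (Node n)} (hn : 1 ≤ n) (hA : ∀ p, p ∈ A ↔ Valid (initial d) p)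
    (hT : M.outputTree.IsWeightedTree) (h : Builds D g₀ (initial d) g M (· ∈ A))
    (u v : Fin n ⊕ Fin M.steiner) :
    M.outputTree.pathDist u v = D (g (embed M u)) (g (embed M v)) := by
  have : Nonempty (Fin n ⊕ Fin M.steiner) := ⟨.inl ⟨0, hn⟩⟩
  have hR := h.realizes
  refine le_antisymm ?_ ?_
  -- The duality is applied to the path metric of the output itself. Nodes that are not valid get
  -- the arbitrary value of `Function.invFun`, which leaves it a pseudometric.
  · have hb := (h.below (fun p q => M.outputTree.pathDist
      (Function.invFun (embed M) p) (Function.invFun (embed M) q))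
      ⟨fun _ => hT.pathDist_self _, fun _ _ => hT.pathDist_symm _ _,
        fun _ _ _ => hT.pathDist_triangle _ _ _⟩ fun p q w hw => ?_).2 (embed M u) (embed M v)
    · have hmem : ∀ u, embed M u ∈ A ∨ Fresh (initial d) M (embed M u) := fun u => by
        rw [hA]
        by_cases hu : Valid (initial d) (embed M u)
        · exact .inl hu
        · exact .inr ⟨valid_embed M u, hu⟩
      have := hb (hmem u) (hmem v)
      rwa [embed_leftInverse, embed_leftInverse] at this
    · obtain ⟨u, rfl⟩ := exists_embed (hR.valid p q (by rw [hw]; rfl))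
      obtain ⟨v, rfl⟩ := exists_embed (hR.valid q _ (by rw [Sym2.eq_swap, hw]; rfl))
      dsimp only
      rw [embed_leftInverse, embed_leftInverse]
      by_cases huv : u = v
      · rw [huv, hT.pathDist_self, (hR.weight _ _ w hw).1]
        exact hD.nonneg _ _
      · have hadj : M.outputTree.graph.Adj u v := adj_output.2 ⟨by rw [hw]; rfl, huv⟩
        refine (WeightedGraph.pathDist_le_walkLength hT.2 hadj.toWalk).trans (le_of_eq ?_)
        have h1 := (weight_output_of_realizes hR hadj).1
        rw [← (hR.weight _ _ w hw).1] at h1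
        simpa [WeightedGraph.walkLength] using h1
  · obtain ⟨p, hp⟩ := hT.exists_path u v
    rw [hT.pathDist_eq hp]
    exact le_walkLength_output hD hR p

/-- Distinct nodes of the output are in distinct positions. -/
theorem position_injective (hD : IsTreeMetric D) {d : Fin n → Fin n → ℝ} {g₀ : Node n → Y}
    {A : List (Node n)} (hn : 1 ≤ n) (hA : ∀ p, p ∈ A ↔ Valid (initial d) p)
    (hT : M.outputTree.IsWeightedTree) (h : Builds D g₀ (initial d) g M (· ∈ A)) :
    Function.Injective fun u => g (embed M u) := by
  intro u v huv
  by_contra hne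
  have h1 := pathDist_output hD hn hA hT h u v
  dsimp only at huv
  rw [huv, hD.self] at h1
  obtain ⟨p, hp⟩ := hT.exists_path u v
  rw [hT.pathDist_eq hp] at h1
  -- A nontrivial path begins with an edge of positive weight, so its length cannot vanish.
  cases p with
  | nil => exact hne rfl
  | cons h2 p =>
    obtain ⟨h3, h4⟩ := weight_output_of_realizes h.realizes h2
    have h5 := WeightedGraph.walkLength_nonneg hT.2 p
    simp only [WeightedGraph.walkLength, Walk.edges_cons, List.map_cons, List.sum_cons] at h1 h5
    linarith

end Metric

/-- No Steiner node exists yet, so `f i₀` is only a default position. -/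
theorem fits_initial {Y : Type*} {D : Y → Y → ℝ} {d : Fin n → Fin n → ℝ} {f : Fin n → Y}
    (i₀ : Fin n) (hf : ∀ i j, D (f i) (f j) = d i j) (hpos : ∀ i j, i ≠ j → 0 < d i j)
    {A : List (Node n)} (hA : ∀ p, p ∈ A ↔ Valid (initial d) p) :
    Fits D (Sum.elim f fun _ => f i₀) (initial d) (· ∈ A) := by
  intro p q hp hq hpq
  rw [hA] at hp hq
  rcases p with i | s
  · rcases q with j | t
    · refine ⟨(hf i j).symm, (hf i j).symm ▸ hpos i j fun h => hpq (by rw [h])⟩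
    · exact absurd hq (Nat.not_lt_zero _)
  · exact absurd hp (Nat.not_lt_zero _)

end TreeRep

/-! ### Proof of the theorem -/

theorem theorem1 :
    ∃ C : ℝ, ∀ {X : Type*} [MetricSpace X] (δ : ℝ), 0 ≤ δ → IsHyperbolic X δ →
      ∀ (n : ℕ), 1 ≤ n → ∀ p : Fin n → X, Function.Injective p →
      ∀ order : List (Fin n), order.Nodup → (∀ i, i ∈ order) →
        -- the output is a weighted tree
        (TreeRep.onPoints 1 p order).val.tree.IsWeightedTree ∧
        -- for `δ = 0`, its metric is the given one, and it has the fewest possible nodes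
        (δ = 0 →
          (∀ i j : Fin n, (TreeRep.onPoints 1 p order).val.tree.pathDist (Sum.inl i) (Sum.inl j) =
            dist (p i) (p j)) ∧
          (∀ (V : Type) [Fintype V] (T' : WeightedGraph V) (f : Fin n → V),
            T'.IsWeightedTree → (∀ i j, T'.pathDist (f i) (f j) = dist (p i) (p j)) →
              n + (TreeRep.onPoints 1 p order).val.steiner ≤ Fintype.card V)) ∧
        -- the running time
        ((TreeRep.onPoints 1 p order).time : ℝ) ≤ C * (n : ℝ) ^ 2 ∧
        -- any number of threads returns the same tree, and the running time on `K` threads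
        (∀ K : ℕ, 1 ≤ K →
          (TreeRep.onPoints K p order).val = (TreeRep.onPoints 1 p order).val ∧
          ((TreeRep.onPoints K p order).time : ℝ) ≤
            C * ((n : ℝ) ^ 2 / K + n * (1 + Nat.clog 2 K))) := by
  -- On one thread the bound `300 * (n ^ 2 + n)` is at most `600 * n ^ 2`.
  refine ⟨600, fun {X} _ δ hδ hX n hn p hp order hnd hall => ?_⟩
  have hlen : order.length = n := by
    have h1 : order.toFinset = Finset.univ := Finset.eq_univ_of_forall fun i => by simp [hall i]
    rw [← List.toFinset_card_of_nodup hnd, h1, Finset.card_fin]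
  set d : Fin n → Fin n → ℝ := fun i j => dist (p i) (p j) with hd
  have hdd : ∀ i, d i i = 0 := fun i => dist_self _
  have hdpos : ∀ i j, i ≠ j → 0 < d i j := fun i j hij => dist_pos.2 (hp.ne hij)
  set A : List (TreeRep.Node n) := order.map Sum.inl with hAdef
  have hA : ∀ q, q ∈ A ↔ TreeRep.Valid (TreeRep.initial d) q := by
    rintro (i | s)
    · simp [hAdef, hall i, TreeRep.Valid]
    · simp [hAdef, TreeRep.Valid, TreeRep.initial]
  have hAlen : A.length = n := by simp [hAdef, hlen]
  have hAnd : A.Nodup := hnd.map Sum.inl_injective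
  have hAne : A ≠ [] := by
    rintro h
    rw [h] at hAlen
    simp only [List.length_nil] at hAlen
    omega
  have hgrow := TreeRep.buildVal_grows hdd hAnd hAlen.le hAne fun q hq => (hA q).1 hq
  rw [hAlen] at hgrow
  have hT := TreeRep.isWeightedTree_output hn hA hgrow
  have hval : ∀ K, 1 ≤ K → (TreeRep.onPoints K p order).val =
      ⟨_, (TreeRep.buildVal (TreeRep.initial d) A).outputTree⟩ := fun K hK =>
    TreeRep.val_treeRep hK d order
  have htime : ∀ K : ℕ, 1 ≤ K → ((TreeRep.onPoints K p order).time : ℝ) ≤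
      300 * ((n : ℝ) ^ 2 / K + n * (1 + Nat.clog 2 K)) := fun K hK =>
    TreeRep.time_treeRep_le hK hn d hlen
  have hn' : (1 : ℝ) ≤ n := by exact_mod_cast hn
  rw [hval 1 le_rfl]
  refine ⟨hT, fun h0 => ⟨fun i j => ?_, fun V _ T' f hT' hf => ?_⟩, ?_, fun K hK => ⟨hval K hK, ?_⟩⟩
  · subst h0
    -- For exactness the positions are taken in a tree that contains `X`.
    obtain ⟨Y, D, f, hD, hf⟩ := hX.exists_isTreeMetric (p ⟨0, hn⟩)
    obtain ⟨g, hg⟩ := TreeRep.buildVal_builds hD hdd hAnd hAlen.le hAne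
      (fun q hq => (hA q).1 hq)
      (TreeRep.fits_initial (f := fun i => f (p i)) ⟨0, hn⟩ (fun i j => hf _ _) hdpos hA)
    rw [TreeRep.pathDist_output hD hn hA hT hg]
    change D (g (Sum.inl i)) (g (Sum.inl j)) = _
    rw [hg.agree (Sum.inl i) trivial, hg.agree (Sum.inl j) trivial]
    exact hf _ _
  -- For minimality the positions are nodes of `T'` itself, and their injectivity bounds the number
  -- of nodes.
  · have hD := hT'.isTreeMetric
    obtain ⟨g, hg⟩ := TreeRep.buildVal_builds hD hdd hAnd hAlen.le hAne
      (fun q hq => (hA q).1 hq) (TreeRep.fits_initial ⟨0, hn⟩ hf hdpos hA)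
    have := Fintype.card_le_of_injective _ (TreeRep.position_injective hD hn hA hT hg)
    simpa using this
  · have := htime 1 le_rfl
    simp only [Nat.cast_one, div_one, Nat.clog_one_right, Nat.cast_zero, add_zero, mul_one] at this
    nlinarith
  · refine (htime K hK).trans (mul_le_mul_of_nonneg_right (by norm_num) (by positivity))
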